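/- Let $\mathbb{F}$ be a field of characteristic $0$. An associative interchange algebra is a vector space with two associative bilinear operations $\circ,\bullet$ satisfying $(a\circ b)\bullet(c\circ d)=(a\bullet c)\circ(b\bullet d)$. In the free associative interchange algebra on countably many generators put $[a,b]_\circ=a\circ b-b\circ a$ and $[a,b]_\bullet=a\bullet b-b\bullet a$. Polynomial identities for these brackets are elements of the free nonassociative algebra with two bilinear operation symbols $[-,-]_\circ,[-,-]_\bullet$ that vanish under all substitutions. The consequences of a set of identities are the elements of the ideal generated by all their substitution instances. For $n\ge 0$ let $\mathrm{All}(n)$ be the $S_n$-module of multilinear identities of degree $n$ satisfied by the two brackets, $\mathrm{Old}(n)$ the multilinear consequences in degree $n$ of the elements of $\mathrm{All}(k)$ for $k<n$, and $\mathrm{New}(n)=\mathrm{All}(n)/\mathrm{Old}(n)$. (1) A multilinear polynomial of degree $6$ is an identity satisfied by the two brackets if and only if it is a consequence of: (i) anticommutativity and the Jacobi identity for each of the two brackets; (ii) the following identity, where $\sigma$ runs over all permutations of $\{b,c,d,e\}$, $\epsilon(\sigma)$ is the sign, and $x^\sigma$ is the image of $x$ under $\sigma$: $$ \begin{aligned}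 \sum_{\sigma}\epsilon(\sigma)\Big\{ &2[[ab^\sigma]_\circ[a[c^\sigma[d^\sigma e^\sigma]_\circ]_\bullet]_\circ]_\bullet -2[[ab^\sigma]_\circ[c^\sigma[a[d^\sigma e^\sigma]_\circ]_\bullet]_\circ]_\bullet +2[[ab^\sigma]_\circ[c^\sigma[d^\sigma[ae^\sigma]_\circ]_\bullet]_\circ]_\bullet\\ &-[[b^\sigma c^\sigma]_\circ[a[d^\sigma[ae^\sigma]_\circ]_\bullet]_\circ]_\bullet +[[b^\sigma c^\sigma]_\circ[d^\sigma[a[ae^\sigma]_\circ]_\bullet]_\circ]_\bullet +[[ab^\sigma]_\circ[[ac^\sigma]_\circ[d^\sigma e^\sigma]_\bullet]_\circ]_\bullet\\ &+2[[ab^\sigma]_\circ[[c^\sigma d^\sigma]_\circ[ae^\sigma]_\bullet]_\circ]_\bullet +[[b^\sigma c^\sigma]_\circ[[ad^\sigma]_\circ[ae^\sigma]_\bullet]_\circ]_\bullet +[[a[ab^\sigma]_\circ]_\circ[c^\sigma[d^\sigma e^\sigma]_\bullet]_\circ]_\bullet\\ &-[[a[b^\sigma c^\sigma]_\circ]_\circ[d^\sigma[ae^\sigma]_\bullet]_\circ]_\bullet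 +[[b^\sigma[ac^\sigma]_\circ]_\circ[a[d^\sigma e^\sigma]_\bullet]_\circ]_\bullet \Big\}\equiv 0; \end{aligned} $$ (iii) the identity obtained from (ii) by interchanging $\circ$ and $\bullet$. (2) There are exactly two new irreducible identities in degree $6$, both for the partition $21^4$: the complete linearizations of (ii) and (iii) belong to $\mathrm{All}(6)$, each of their classes generates a simple submodule of $\mathrm{New}(6)$ isomorphic to the simple $S_6$-module $[21^4]$, and $\mathrm{New}(6)$ is the direct sum of these two submodules. -/

import Mathlib

open scoped MonoidAlgebra

noncomputable section

namespace Interchange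

/-- The two binary operation symbols `∘` and `•`. -/
inductive Op : Type
  | circ
  | bullet

/-- Nonassociative monomials in the two operation symbols, with indeterminates in `X`. -/
inductive Mono (X : Type*) : Type _
  | var (x : X) : Mono X
  | op (w : Op) (s t : Mono X) : Mono X

/-- The multiset of indeterminates occurring in a monomial. -/
def Mono.vars {X : Type*} : Mono X → Multiset X
  | .var x => {x}
  | .op _ s t => s.vars + t.vars

/-- Renaming of the indeterminates of a monomial. -/
def Mono.rename {X Y : Type*} (r : X → Y) : Mono X → Mono Y
  | .var x => .var (r x)
  | .op w s t => .op w (s.rename r) (t.rename r)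

/-- The underlying vector space of the free algebra with two bilinear operations on `X`: it has
the monomials as a basis. -/
def FreeAlg (F X : Type*) [Field F] := Mono X →₀ F

variable (F : Type*) [Field F]

instance (X : Type*) : AddCommGroup (FreeAlg F X) := inferInstanceAs (AddCommGroup (Mono X →₀ F))

instance (X : Type*) : Module F (FreeAlg F X) := inferInstanceAs (Module F (Mono X →₀ F))

/-- The basis of the free algebra that consists of the monomials. -/
def monoBasis (X : Type*) : Module.Basis (Mono X) F (FreeAlg F X) :=
  Module.Basis.ofRepr (LinearEquiv.refl F (Mono X →₀ F))

/-- A pair of bilinear operations on `A`. -/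
abbrev Ops (A : Type*) [AddCommGroup A] [Module F A] := Op → A →ₗ[F] A →ₗ[F] A

variable {F}

/-- The generators of the free algebra. -/
def X {X : Type*} (x : X) : FreeAlg F X := monoBasis F X (Mono.var x)

/-- The two bilinear operations of the free algebra, given on monomials `s`, `t` by the
monomial `op w s t`. -/
def freeMul {X : Type*} : Ops F (FreeAlg F X) := fun w =>
  (monoBasis F X).constr F fun s =>
    (monoBasis F X).constr F fun t => monoBasis F X (Mono.op w s t)

/-- The value of a monomial in an algebra with operations `m` under the substitution `v`. -/
def evalMono {A : Type*} [AddCommGroup A] [Module F A] (m : Ops F A) {X : Type*} (v : X → A) :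
    Mono X → A
  | .var x => v x
  | .op w s t => m w (evalMono m v s) (evalMono m v t)

/-- The value of a polynomial in an algebra with operations `m` under the substitution `v`. -/
def eval {A : Type*} [AddCommGroup A] [Module F A] (m : Ops F A) {X : Type*} (v : X → A) :
    FreeAlg F X →ₗ[F] A :=
  (monoBasis F X).constr F (evalMono m v)

/-- Substitution of polynomials for the indeterminates of a polynomial. -/
abbrev subst {X Y : Type*} (v : X → FreeAlg F Y) : FreeAlg F X →ₗ[F] FreeAlg F Y :=
  eval freeMul v

/-- Renaming of the indeterminates of a polynomial. -/
def rename {X Y : Type*} (r : X → Y) : FreeAlg F X →ₗ[F] FreeAlg F Y :=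
  (monoBasis F X).constr F fun t => monoBasis F Y (t.rename r)

/-- The set of all polynomial identities in the indeterminates `X` of an algebra with
operations `m`: the polynomials that vanish under every substitution. -/
def identities {A : Type*} [AddCommGroup A] [Module F A] (m : Ops F A) (X : Type*) :
    Submodule F (FreeAlg F X) :=
  ⨅ v : X → A, LinearMap.ker (eval m v)

/-- Two-sided ideals of the free algebra. -/
def IsIdeal {X : Type*} (I : Submodule F (FreeAlg F X)) : Prop :=
  ∀ (w : Op) (a b : FreeAlg F X), a ∈ I → freeMul w a b ∈ I ∧ freeMul w b a ∈ I

/-- The consequences, in the indeterminates `X`, of a set `S` of polynomial identities: the ideal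
of the free algebra on `X` generated by all substitution instances of elements of `S`. -/
def consequences {Y : Type*} (S : Set (FreeAlg F Y)) (X : Type*) : Submodule F (FreeAlg F X) :=
  sInf {I | IsIdeal I ∧ ∀ g ∈ S, ∀ v : Y → FreeAlg F X, subst v g ∈ I}

theorem isIdeal_consequences {Y : Type*} (S : Set (FreeAlg F Y)) (X : Type*) :
    IsIdeal (consequences S X) := by
  intro w a b ha
  simp only [consequences, Submodule.mem_sInf, Set.mem_ofPred_eq] at ha ⊢
  exact ⟨fun I hI => (hI.1 w a b (ha I hI)).1, fun I hI => (hI.1 w a b (ha I hI)).2⟩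

/-- The operations induced on the quotient of the free algebra by an ideal. -/
def quotMul {X : Type*} (I : Submodule F (FreeAlg F X)) (hI : IsIdeal I) :
    Ops F (FreeAlg F X ⧸ I) := fun w =>
  I.liftQ (I.liftQ ((freeMul w).compr₂ I.mkQ).flip (by
    intro b hb
    rw [LinearMap.mem_ker]
    ext1 a
    simpa using (hI w b a hb).2)).flip (by
    intro a ha
    rw [LinearMap.mem_ker]
    ext b
    simpa using (hI w a b ha).1)

/-- The operations of `quotMul` are the products of representatives. -/
theorem quotMul_mk {X : Type*} (I : Submodule F (FreeAlg F X)) (hI : IsIdeal I) (w : Op)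
    (a b : FreeAlg F X) :
    quotMul I hI w (I.mkQ a) (I.mkQ b) = I.mkQ (freeMul w a b) := rfl

variable (F)

/-- Associativity of the operation `w`. -/
def assoc (w : Op) : FreeAlg F ℕ :=
  freeMul w (freeMul w (X 0) (X 1)) (X 2) - freeMul w (X 0) (freeMul w (X 1) (X 2))

/-- The interchange identity `(a ∘ b) • (c ∘ d) = (a • c) ∘ (b • d)`. -/
def interchange : FreeAlg F ℕ :=
  freeMul .bullet (freeMul .circ (X 0) (X 1)) (freeMul .circ (X 2) (X 3)) -
    freeMul .circ (freeMul .bullet (X 0) (X 2)) (freeMul .bullet (X 1) (X 3))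

/-- The defining identities of associative interchange algebras. -/
def assocInterchange : Set (FreeAlg F ℕ) :=
  {assoc F .circ, assoc F .bullet, interchange F}

/-- The free associative interchange algebra on `X`. -/
abbrev FreeAI (X : Type*) := FreeAlg F X ⧸ consequences (assocInterchange F) X

/-- The operations `∘` and `•` of the free associative interchange algebra. -/
def mulAI (X : Type*) : Ops F (FreeAI F X) :=
  quotMul _ (isIdeal_consequences (assocInterchange F) X)

variable {F} in
/-- The brackets `a b - b a` of the operations `m`. -/
def brackets {A : Type*} [AddCommGroup A] [Module F A] (m : Ops F A) : Ops F A :=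
  fun w => m w - (m w).flip

/-- The multilinear polynomials of degree `n`: the span of the monomials in which each of the
`n` indeterminates occurs exactly once. -/
def multilinear (n : ℕ) : Submodule F (FreeAlg F (Fin n)) :=
  Submodule.span F (monoBasis F (Fin n) '' {t | t.vars = (Finset.univ : Finset (Fin n)).val})

/-- The multilinear identities of degree `n` satisfied by the two Lie brackets in the free
associative interchange algebra on countably many generators. The operation symbols now stand for
the two brackets. -/
def allIds (n : ℕ) : Submodule F (FreeAlg F (Fin n)) :=
  multilinear F n ⊓ identities (brackets (mulAI F ℕ)) (Fin n)

/-- The multilinear identities of degree less than `n` satisfied by the two Lie brackets. -/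
def lowerIds (n : ℕ) : Set (FreeAlg F ℕ) :=
  {g | ∃ k < n, ∃ f ∈ allIds F k, g = rename (fun i : Fin k => (i : ℕ)) f}

/-- The multilinear consequences in degree `n` of the identities of lower degree. -/
def oldIds (n : ℕ) : Submodule F (FreeAlg F (Fin n)) :=
  multilinear F n ⊓ consequences (lowerIds F n) (Fin n)

section Action

variable {F}

theorem rename_mono {X Y : Type*} (r : X → Y) (t : Mono X) :
    rename r (monoBasis F X t) = monoBasis F Y (t.rename r) := by
  simp [rename]

theorem Mono.rename_id {X : Type*} (t : Mono X) : t.rename id = t := by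
  induction t with
  | var x => rfl
  | op w s t hs ht => simp [Mono.rename, hs, ht]

theorem Mono.rename_rename {X Y Z : Type*} (r : X → Y) (q : Y → Z) (t : Mono X) :
    (t.rename r).rename q = t.rename (q ∘ r) := by
  induction t with
  | var x => rfl
  | op w s t hs ht => simp [Mono.rename, hs, ht]

theorem Mono.vars_rename {X Y : Type*} (r : X → Y) (t : Mono X) :
    (t.rename r).vars = t.vars.map r := by
  induction t with
  | var x => rfl
  | op w s t hs ht => simp [Mono.rename, Mono.vars, hs, ht]

theorem evalMono_rename {A : Type*} [AddCommGroup A] [Module F A] (m : Ops F A) {X Y : Type*}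
    (r : X → Y) (v : Y → A) (t : Mono X) :
    evalMono m v (t.rename r) = evalMono m (v ∘ r) t := by
  induction t with
  | var x => rfl
  | op w s t hs ht => simp [Mono.rename, evalMono, hs, ht]

theorem eval_rename {A : Type*} [AddCommGroup A] [Module F A] (m : Ops F A) {X Y : Type*}
    (r : X → Y) (v : Y → A) (f : FreeAlg F X) :
    eval m v (rename r f) = eval m (v ∘ r) f := by
  have h : eval m v ∘ₗ rename r = eval m (v ∘ r) := by
    refine (monoBasis F X).ext fun t => ?_
    simp [rename_mono, eval, evalMono_rename]
  exact LinearMap.congr_fun h f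

theorem freeMul_mono {X : Type*} (w : Op) (s t : Mono X) :
    freeMul w (monoBasis F X s) (monoBasis F X t) = monoBasis F X (Mono.op w s t) := by
  simp [freeMul]

theorem rename_freeMul {X Y : Type*} (r : X → Y) (w : Op) (a b : FreeAlg F X) :
    rename r (freeMul w a b) = freeMul w (rename r a) (rename r b) := by
  have h : (freeMul w).compr₂ (rename r) =
      ((freeMul w).compl₁₂ (rename r) (rename r) :
        FreeAlg F X →ₗ[F] FreeAlg F X →ₗ[F] FreeAlg F Y) := by
    refine (monoBasis F X).ext fun s => (monoBasis F X).ext fun t => ?_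
    simp [freeMul_mono, rename_mono, Mono.rename]
  exact LinearMap.congr_fun (LinearMap.congr_fun h a) b

theorem rename_evalMono {X Y Z : Type*} (r : Y → Z) (v : X → FreeAlg F Y) (t : Mono X) :
    rename r (evalMono freeMul v t) = evalMono freeMul (fun x => rename r (v x)) t := by
  induction t with
  | var x => rfl
  | op w s t hs ht => simp [evalMono, rename_freeMul, hs, ht]

theorem rename_subst {X Y Z : Type*} (r : Y → Z) (v : X → FreeAlg F Y) (f : FreeAlg F X) :
    rename r (subst v f) = subst (fun x => rename r (v x)) f := by
  have h : rename r ∘ₗ subst v = subst (fun x => rename r (v x)) := by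
    refine (monoBasis F X).ext fun t => ?_
    simp [eval, rename_evalMono]
  exact LinearMap.congr_fun h f

theorem rename_mem_consequences {Y X Z : Type*} (S : Set (FreeAlg F Y)) (r : X → Z)
    {f : FreeAlg F X} (hf : f ∈ consequences S X) : rename r f ∈ consequences S Z := by
  have hle : consequences S X ≤ (consequences S Z).comap (rename r) := by
    refine sInf_le ⟨fun w a b ha => ?_, fun g hg v => ?_⟩
    · simp only [Submodule.mem_comap, rename_freeMul]
      exact isIdeal_consequences S Z w _ _ ha
    · rw [Submodule.mem_comap, rename_subst]
      simp only [consequences, Submodule.mem_sInf]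
      exact fun I hI => hI.2 g hg _
  exact hle hf

theorem rename_mem_multilinear {n : ℕ} (g : Equiv.Perm (Fin n)) {f : FreeAlg F (Fin n)}
    (hf : f ∈ multilinear F n) : rename g f ∈ multilinear F n := by
  have hle : multilinear F n ≤ (multilinear F n).comap (rename g) := by
    rw [multilinear, Submodule.span_le]
    rintro _ ⟨t, ht, rfl⟩
    simp only [SetLike.mem_coe, Submodule.mem_comap, rename_mono]
    refine Submodule.subset_span ⟨t.rename g, ?_, rfl⟩
    rw [Set.mem_ofPred_eq] at ht ⊢
    rw [Mono.vars_rename, ht]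
    exact congrArg Finset.val (Finset.map_univ_equiv g)
  exact hle hf

theorem rename_mem_allIds {n : ℕ} (g : Equiv.Perm (Fin n)) {f : FreeAlg F (Fin n)}
    (hf : f ∈ allIds F n) : rename g f ∈ allIds F n := by
  refine ⟨rename_mem_multilinear g hf.1, ?_⟩
  have h := hf.2
  simp only [identities, SetLike.mem_coe, Submodule.mem_iInf, LinearMap.mem_ker] at h ⊢
  intro v
  rw [eval_rename]
  exact h _

theorem rename_mem_oldIds {n : ℕ} (g : Equiv.Perm (Fin n)) {f : FreeAlg F (Fin n)}
    (hf : f ∈ oldIds F n) : rename g f ∈ oldIds F n :=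
  ⟨rename_mem_multilinear g hf.1, rename_mem_consequences _ _ hf.2⟩

end Action

/-- The action of the symmetric group on polynomials in `n` indeterminates by
`(σ f)(x_1, …, x_n) = f(x_{σ(1)}, …, x_{σ(n)})`. -/
def permRep (n : ℕ) : Representation F (Equiv.Perm (Fin n)) (FreeAlg F (Fin n)) where
  toFun g := rename g
  map_one' := by
    refine (monoBasis F _).ext fun t => ?_
    rw [rename_mono]
    exact congrArg (monoBasis F _) (Mono.rename_id t)
  map_mul' g h := by
    refine (monoBasis F _).ext fun t => ?_
    simp only [rename_mono, Module.End.mul_apply, Mono.rename_rename]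
    rfl

/-- The action of the symmetric group on the multilinear identities of degree `n`. -/
def allRep (n : ℕ) : Representation F (Equiv.Perm (Fin n)) (allIds F n) :=
  (permRep F n).subrepresentation (allIds F n) (fun g _ hf => rename_mem_allIds g hf)

/-- The quotient of all multilinear identities of degree `n` by the old ones, with the action of
the symmetric group. -/
def newRep (n : ℕ) : Representation F (Equiv.Perm (Fin n))
    (allIds F n ⧸ (oldIds F n).submoduleOf (allIds F n)) :=
  (allRep F n).quotient _ (fun g _ hf => rename_mem_oldIds g hf)

/-- The new identities of degree `n`, as a module over the group algebra. -/
abbrev NewModule (n : ℕ) := (newRep F n).asModule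

variable {F} in
/-- The class of an identity of degree `n` in the module of new identities. -/
def newClass {n : ℕ} (f : FreeAlg F (Fin n)) (hf : f ∈ allIds F n) : NewModule F n :=
  (newRep F n).asModuleEquiv.symm (Submodule.Quotient.mk ⟨f, hf⟩)

variable {F} in
/-- The submodule of the module of new identities generated by an identity of degree `n`. -/
def newSpan {n : ℕ} (f : FreeAlg F (Fin n)) (hf : f ∈ allIds F n) :
    Submodule F[Equiv.Perm (Fin n)] (NewModule F n) :=
  Submodule.span _ {newClass f hf}

/-- Anticommutativity of the bracket `w`. -/
def anticomm (w : Op) : FreeAlg F ℕ :=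
  freeMul w (X 0) (X 1) + freeMul w (X 1) (X 0)

/-- The Jacobi identity for the bracket `w`. -/
def jacobi (w : Op) : FreeAlg F ℕ :=
  freeMul w (X 0) (freeMul w (X 1) (X 2)) + freeMul w (X 1) (freeMul w (X 2) (X 0)) +
    freeMul w (X 2) (freeMul w (X 0) (X 1))

/-- The summand of the new identity, with `p = [-,-]_∘` and `q = [-,-]_•`. -/
def newTerm {A : Type*} [AddCommGroup A] [Module F A] (p q : A →ₗ[F] A →ₗ[F] A)
    (a b c d e : A) : A :=
  (2 : F) • q (p a b) (p a (q c (p d e)))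
    - (2 : F) • q (p a b) (p c (q a (p d e)))
    + (2 : F) • q (p a b) (p c (q d (p a e)))
    - q (p b c) (p a (q d (p a e)))
    + q (p b c) (p d (q a (p a e)))
    + q (p a b) (p (p a c) (q d e))
    + (2 : F) • q (p a b) (p (p c d) (q a e))
    + q (p b c) (p (p a d) (q a e))
    + q (p a (p a b)) (p c (q d e))
    - q (p a (p b c)) (p d (q a e))
    + q (p b (p a c)) (p a (q d e))

/-- The new identity in the indeterminates `a = X 0` and `b, c, d, e = X 1, X 2, X 3, X 4`, an
alternating sum over the permutations of `{b, c, d, e}`. The identity itself has `u = ∘` and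
`w = •`; interchanging the two operations gives `u = •` and `w = ∘`. -/
def newLL6 (u w : Op) : FreeAlg F ℕ :=
  ∑ s : Equiv.Perm (Fin 4), ((Equiv.Perm.sign s : ℤ) : F) •
    newTerm F (freeMul u) (freeMul w) (X 0)
      (X ((s 0 : ℕ) + 1)) (X ((s 1 : ℕ) + 1)) (X ((s 2 : ℕ) + 1)) (X ((s 3 : ℕ) + 1))

variable {F} in
/-- The complete linearization `f(x₀ + x₁, …) - f(x₀, …) - f(x₁, …)` of a polynomial
`f(a, b, c, d, e)` that is quadratic in `a = X 0` and linear in `X 1, X 2, X 3, X 4`; the latter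
become `x₂, x₃, x₄, x₅`. -/
def linearize (f : FreeAlg F ℕ) : FreeAlg F (Fin 6) :=
  let v (a : FreeAlg F (Fin 6)) (k : ℕ) : FreeAlg F (Fin 6) :=
    if k = 0 then a else X (Fin.ofNat 6 (k + 1))
  subst (v (X 0 + X 1)) f - subst (v (X 0)) f - subst (v (X 1)) f

/-- The Young symmetrizer of the tableau on `{0, …, n - 1}` that has the entry `i` in row `row i`
and column `col i`. -/
def youngSymmetrizer {n : ℕ} (row col : Fin n → ℕ) : F[Equiv.Perm (Fin n)] :=
  open Classical in
  (∑ g : Equiv.Perm (Fin n) with ∀ i, row (g i) = row i, MonoidAlgebra.of F _ g) *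
    ∑ g : Equiv.Perm (Fin n) with ∀ i, col (g i) = col i,
      ((Equiv.Perm.sign g : ℤ) : F) • MonoidAlgebra.of F _ g

/-- The module `[21⁴]` of the symmetric group on six letters: the left ideal generated by the
Young symmetrizer of the tableau with rows `(0, 1), (2), (3), (4), (5)`. -/
def specht21111 : Submodule F[Equiv.Perm (Fin 6)] F[Equiv.Perm (Fin 6)] :=
  Submodule.span _ {youngSymmetrizer F ![0, 0, 1, 2, 3, 4] ![0, 1, 0, 0, 0, 0]}

end Interchange

end

noncomputable section

namespace Interchange

/-! ### Associative normal forms of monomials -/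

/-! A polynomial in the brackets is studied through its expansion in the free algebra with two
unrelated associative products, whose basis consists of the right-associated monomials. A Dynkin
operator that divides, at each node, by the number of factors recovers the value of the polynomial
in any algebra with two Lie brackets from its expansion. In characteristic 0 the kernel of `expand`
therefore consists exactly of the consequences of anticommutativity and the Jacobi identities
(`mem_consequences_lieIds_iff`).

The interchange law imposes conditions on the expansion of an identity: its coefficients add up to
zero over every class of monomials that are equivalent under interchange. Reversing the product `∘`
preserves the axioms and multiplies each bracket monomial by a sign, so the sums vanish separately
over the two parities of the number of `∘` (`coef_parity_sum`). On the other hand, expansions of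
brackets satisfy reversal and shuffle relations, whatever the interchange law. A finite check
reduces degree 6 to eleven types of monomials for each choice of the first operation. For eight
types the relations force the coefficients to vanish. The other three, A, B and D, are determined by
B, the coefficients at `(a ∘ (b • c)) • (d ∘ e ∘ f)` (`expand_eq_zero_of_treeB`).

Multiplied by the sign of the permutation of the letters, the B coefficients have the form `h f - h
d` for a function `h` on the six letters, unique up to a constant (`exists_potential_coefB`). Thus a
multilinear identity of degree 6 is described, modulo the Lie identities, by two such potentials,
one for each operation. Functions modulo constants, twisted by the sign, form a simple module
isomorphic to `[21⁴]`.

That the new identity holds is a computation with alternating sums. By its symmetries and one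
coefficient, the potential of its linearization is twice `e₁ - e₀` for one operation, and it is zero
for the other (`coefB_linearize`, `coefB_linearize_of_ne`). Since `e₁ - e₀` generates all vectors of
sum zero, the two identities generate everything, each contributing one of two independent copies.

Nothing new happens in lower degree: bracketing an identity with new letters up to degree 6 gives an
identity without B coefficients, so its expansion vanishes. Hence the old identities in degree 6 are
exactly the kernel of `expand` (`mem_oldIds_iff`). -/

instance : DecidableEq Op
  | .circ, .circ => isTrue rfl
  | .bullet, .bullet => isTrue rfl
  | .circ, .bullet => isFalse nofun
  | .bullet, .circ => isFalse nofun

/-- The other operation symbol. -/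
def Op.swap : Op → Op
  | .circ => .bullet
  | .bullet => .circ

theorem Op.swap_ne (u : Op) : u.swap ≠ u := by cases u <;> nofun

theorem Op.ne_swap (u : Op) : u ≠ u.swap := by cases u <;> nofun

namespace Mono

variable {α β : Type*}

/-- The product of two monomials, kept associated to the right. -/
def app (w : Op) : Mono α → Mono α → Mono α
  | .var x, t => .op w (.var x) t
  | .op w' a b, t => if w' = w then .op w a (app w b t) else .op w (.op w' a b) t

/-- The right-associated normal form of a monomial. -/
def norm : Mono α → Mono α
  | .var x => .var x
  | .op w s t => app w s.norm t.norm

/-- The outermost operation of a monomial is `w`. -/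
def rooted (w : Op) : Mono α → Bool
  | .var _ => false
  | .op u _ _ => decide (u = w)

/-- All products in the monomial are associated to the right. -/
def isNormal : Mono α → Bool
  | .var _ => true
  | .op w s t => !s.rooted w && s.isNormal && t.isNormal

@[simp] theorem rooted_var (w : Op) (x : α) : (var x).rooted w = false := rfl

@[simp] theorem rooted_op (w w' : Op) (s t : Mono α) :
    (op w' s t).rooted w = decide (w' = w) := rfl

theorem app_of_not_rooted {w : Op} {s : Mono α} (hs : s.rooted w = false) (t : Mono α) :
    app w s t = op w s t := by
  cases s with
  | var x => rfl
  | op w' a b => simp_all [app]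

@[simp] theorem app_op (w : Op) (a b t : Mono α) : app w (op w a b) t = op w a (app w b t) := by
  simp [app]

/-- `app w` recurses only along the right spine of a `w`-product, so no induction hypothesis is
needed for left factors, nor for monomials whose outermost operation is not `w`. -/
theorem app_induction {w : Op} {P : Mono α → Prop}
    (base : ∀ s, s.rooted w = false → P s) (step : ∀ a b, P b → P (op w a b)) (s : Mono α) :
    P s := by
  induction s with
  | var x => exact base _ rfl
  | op w' a b _ hb =>
    by_cases h : w' = w
    · subst h; exact step a b hb
    · exact base _ (by simp [h])

@[simp] theorem rooted_app (w w' : Op) (s t : Mono α) :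
    (app w s t).rooted w' = decide (w = w') := by
  induction s using app_induction (w := w) with
  | base s hs => simp [app_of_not_rooted hs]
  | step a b _ => simp

theorem app_assoc (w : Op) (s t r : Mono α) : app w (app w s t) r = app w s (app w t r) := by
  induction s using app_induction (w := w) with
  | base s hs => simp [app_of_not_rooted hs]
  | step a b hb => simp [hb]

theorem isNormal_app (w : Op) {s t : Mono α} (hs : s.isNormal) (ht : t.isNormal) :
    (app w s t).isNormal := by
  induction s using app_induction (w := w) with
  | base s h => simp [app_of_not_rooted h, isNormal, h, hs, ht]
  | step a b hb =>
    simp only [isNormal, Bool.and_eq_true, app_op] at hs ⊢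
    exact ⟨hs.1, hb hs.2⟩

theorem norm_of_isNormal {t : Mono α} (ht : t.isNormal) : t.norm = t := by
  induction t with
  | var x => rfl
  | op w s t hs h =>
    simp only [isNormal, Bool.and_eq_true, Bool.not_eq_true'] at ht
    rw [norm, hs ht.1.2, h ht.2, app_of_not_rooted ht.1.1]

theorem app_eq_op_iff {w : Op} {a b : Mono α} (ha : a.rooted w = false) (hb : b.rooted w = false)
    (s t : Mono α) : app w s t = op w a b ↔ s = a ∧ t = b := by
  induction s using app_induction (w := w) with
  | base s hs => simp [app_of_not_rooted hs]
  | step x y _ =>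
    rw [app_op]
    constructor
    · rintro h
      injection h with _ _ h
      rw [← h] at hb
      simp at hb
    · rintro ⟨rfl, -⟩
      simp at ha

/-- Three factors that are not themselves `w`-products can be cut in two places, two such factors
only in one. These cuts become the terms of the coefficient formulas for products of three and two
factors. -/
theorem app_eq_op_op_iff {w : Op} {a b c : Mono α} (ha : a.rooted w = false)
    (hb : b.rooted w = false) (hc : c.rooted w = false) (s t : Mono α) :
    app w s t = op w a (op w b c) ↔ s = a ∧ t = op w b c ∨ s = op w a b ∧ t = c := by
  induction s using app_induction (w := w) with
  | base s hs =>
    rw [app_of_not_rooted hs]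
    constructor
    · rintro h
      injection h with _ h h'
      exact Or.inl ⟨h, h'⟩
    · rintro (⟨rfl, rfl⟩ | ⟨rfl, -⟩)
      · rfl
      · simp at hs
  | step x y _ =>
    rw [app_op]
    constructor
    · rintro h
      injection h with _ h h'
      rw [app_eq_op_iff hb hc] at h'
      exact Or.inr ⟨by rw [h, h'.1], h'.2⟩
    · rintro (⟨rfl, -⟩ | ⟨h, rfl⟩)
      · simp at ha
      · injection h with _ h h'
        rw [h, h', app_of_not_rooted hb]

theorem app_rename (r : α → β) (w : Op) (s t : Mono α) :
    (app w s t).rename r = app w (s.rename r) (t.rename r) := by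
  induction s with
  | var x => rfl
  | op w' a b _ hb =>
    by_cases h : w' = w
    · subst h; simp [rename, hb]
    · simp [rename, app, h]

theorem rename_injective {r : α → β} (hr : Function.Injective r) :
    Function.Injective (Mono.rename r) := by
  intro s
  induction s with
  | var x =>
    intro t h
    cases t with
    | var y => simpa [rename, hr.eq_iff] using h
    | op => simp [rename] at h
  | op w a b ha hb =>
    intro t h
    cases t with
    | var y => simp [rename] at h
    | op w' a' b' =>
      simp only [rename, op.injEq] at h ⊢
      exact ⟨h.1, ha h.2.1, hb h.2.2⟩

theorem vars_app (w : Op) (s t : Mono α) : (app w s t).vars = s.vars + t.vars := by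
  induction s using app_induction (w := w) with
  | base s hs => simp [app_of_not_rooted hs, vars]
  | step a b hb => simp [vars, hb, add_assoc]

/-- The number of occurrences of `∘`. -/
def circCount : Mono α → ℕ
  | .var _ => 0
  | .op w s t => (if w = .circ then 1 else 0) + s.circCount + t.circCount

theorem circCount_app (w : Op) (s t : Mono α) :
    (app w s t).circCount = (if w = .circ then 1 else 0) + s.circCount + t.circCount := by
  induction s using app_induction (w := w) with
  | base s hs => simp [app_of_not_rooted hs, circCount]
  | step a b hb => simp only [app_op, circCount, hb]; ring

/-- The number of factors of a monomial with respect to the operation `w`. -/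
def len (w : Op) : Mono α → ℕ
  | .var _ => 1
  | .op w' s t => if w' = w then s.len w + t.len w else 1

theorem len_pos (w : Op) (t : Mono α) : 0 < t.len w := by
  induction t with
  | var x => simp [len]
  | op w' s t hs ht => unfold len; split <;> omega

theorem len_app (w w' : Op) (s t : Mono α) :
    (app w s t).len w' = if w = w' then s.len w' + t.len w' else 1 := by
  induction s using app_induction (w := w) with
  | base s hs => simp [app_of_not_rooted hs, len]
  | step a b hb =>
    simp only [app_op, len, hb]
    split <;> omega

end Mono

/-! ### The expansion of brackets -/

variable {F : Type*} [Field F] {α β : Type*}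

open Mono

/-- Extension of a function on monomials to a linear map. -/
def lin {A : Type*} [AddCommGroup A] [Module F A] (g : Mono α → A) : FreeAlg F α →ₗ[F] A :=
  (monoBasis F α).constr F g

@[simp] theorem lin_mono {A : Type*} [AddCommGroup A] [Module F A] (g : Mono α → A) (t : Mono α) :
    lin g (monoBasis F α t) = g t := by simp [lin]

/-- The two products on the free algebra that are associated to the right on monomials. -/
def assocMul : Ops F (FreeAlg F α) := fun w =>
  lin fun s => lin fun t => monoBasis F α (app w s t)

@[simp] theorem assocMul_mono (w : Op) (s t : Mono α) :
    assocMul w (monoBasis F α s) (monoBasis F α t) = monoBasis F α (app w s t) := by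
  simp [assocMul]

theorem eval_mono {A : Type*} [AddCommGroup A] [Module F A] (m : Ops F A) (v : α → A)
    (t : Mono α) : eval m v (monoBasis F α t) = evalMono m v t := by simp [eval]

/-- The expansion of all brackets into products. -/
def expand : FreeAlg F α →ₗ[F] FreeAlg F α :=
  eval (brackets assocMul) X

theorem expand_var (x : α) : expand (monoBasis F α (var x)) = monoBasis F α (var x) := by
  simp [expand, eval_mono, evalMono, X]

theorem expand_op (w : Op) (s t : Mono α) :
    expand (monoBasis F α (op w s t)) =
      assocMul w (expand (monoBasis F α s)) (expand (monoBasis F α t)) -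
        assocMul w (expand (monoBasis F α t)) (expand (monoBasis F α s)) := by
  simp [expand, eval_mono, evalMono, brackets]

theorem freeAlg_induction {P : FreeAlg F α → Prop} (f : FreeAlg F α) (zero : P 0)
    (mono : ∀ t, P (monoBasis F α t)) (add : ∀ f g, P f → P g → P (f + g))
    (smul : ∀ (c : F) f, P f → P (c • f)) : P f := by
  have hf : f ∈ Submodule.span F (Set.range (monoBasis F α)) := by
    rw [(monoBasis F α).span_eq]; trivial
  induction hf using Submodule.span_induction with
  | mem x h => obtain ⟨t, rfl⟩ := h; exact mono t
  | zero => exact zero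
  | add x y _ _ hx hy => exact add x y hx hy
  | smul c x _ hx => exact smul c x hx

theorem linearMap_ext {A : Type*} [AddCommGroup A] [Module F A] {g h : FreeAlg F α →ₗ[F] A}
    (H : ∀ t, g (monoBasis F α t) = h (monoBasis F α t)) : g = h :=
  (monoBasis F α).ext H

theorem bilinear_ext {A : Type*} [AddCommGroup A] [Module F A]
    {g h : FreeAlg F α →ₗ[F] FreeAlg F α →ₗ[F] A}
    (H : ∀ s t, g (monoBasis F α s) (monoBasis F α t) = h (monoBasis F α s) (monoBasis F α t)) :
    g = h :=
  linearMap_ext fun s => linearMap_ext fun t => H s t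

theorem eval_freeMul {A : Type*} [AddCommGroup A] [Module F A] (m : Ops F A) (v : α → A)
    (w : Op) (a b : FreeAlg F α) :
    eval m v (freeMul w a b) = m w (eval m v a) (eval m v b) := by
  have h : (freeMul w).compr₂ (eval m v) = (m w).compl₁₂ (eval m v) (eval m v) :=
    bilinear_ext fun s t => by simp [freeMul_mono, eval_mono, evalMono]
  exact LinearMap.congr_fun₂ h a b

theorem eval_X {A : Type*} [AddCommGroup A] [Module F A] (m : Ops F A) (v : α → A) (x : α) :
    eval m v (X x) = v x := by
  rw [X, eval_mono]; rfl

theorem expand_freeMul (w : Op) (a b : FreeAlg F α) :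
    expand (freeMul w a b) =
      assocMul w (expand a) (expand b) - assocMul w (expand b) (expand a) := by
  simp [expand, eval_freeMul, brackets]

theorem rename_assocMul (r : α → β) (w : Op) (a b : FreeAlg F α) :
    rename r (assocMul w a b) = assocMul w (rename r a) (rename r b) := by
  have h : (assocMul w).compr₂ (rename r) =
      ((assocMul w).compl₁₂ (rename r) (rename r) :
        FreeAlg F α →ₗ[F] FreeAlg F α →ₗ[F] FreeAlg F β) :=
    bilinear_ext fun s t => by simp [rename_mono, app_rename]
  exact LinearMap.congr_fun₂ h a b

theorem expand_rename (r : α → β) (f : FreeAlg F α) :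
    expand (rename r f) = rename r (expand f) := by
  have h : expand ∘ₗ rename r = (rename r ∘ₗ expand : FreeAlg F α →ₗ[F] FreeAlg F β) := by
    refine linearMap_ext fun t => ?_
    simp only [LinearMap.comp_apply]
    induction t with
    | var x => simp [rename_mono, Mono.rename, expand_var]
    | op w s t hs ht =>
      rw [← freeMul_mono, rename_freeMul, expand_freeMul, expand_freeMul, hs, ht, map_sub,
        rename_assocMul, rename_assocMul]
  exact LinearMap.congr_fun h f

/-- A relation between monomials and their expansions that is compatible with products holds for
all terms of an expansion. -/
theorem expand_mem_span (Q : Mono α → Mono α → Prop) (hvar : ∀ x, Q (var x) (var x))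
    (hop : ∀ w s t S T, Q S s → Q T t → Q (app w S T) (op w s t) ∧ Q (app w T S) (op w s t))
    (t : Mono α) :
    expand (monoBasis F α t) ∈ Submodule.span F (monoBasis F α '' {T | Q T t}) := by
  have key : ∀ (w : Op) (A B C : Set (Mono α)), (∀ S ∈ A, ∀ T ∈ B, app w S T ∈ C) →
      ∀ a ∈ Submodule.span F (monoBasis F α '' A), ∀ b ∈ Submodule.span F (monoBasis F α '' B),
        assocMul w a b ∈ Submodule.span F (monoBasis F α '' C) := by
    intro w A B C h a ha b hb
    have := Submodule.apply_mem_map₂ (assocMul (F := F) (α := α) w) ha hb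
    rw [Submodule.map₂_span_span] at this
    refine Submodule.span_mono ?_ this
    rintro _ ⟨_, ⟨S, hS, rfl⟩, _, ⟨T, hT, rfl⟩, rfl⟩
    exact ⟨_, h S hS T hT, by simp⟩
  induction t with
  | var x => rw [expand_var]; exact Submodule.subset_span ⟨_, hvar x, rfl⟩
  | op w s t hs ht =>
    rw [expand_op]
    refine Submodule.sub_mem _ (key w _ _ _ ?_ _ hs _ ht) (key w _ _ _ ?_ _ ht _ hs)
    · exact fun S hS T hT => (hop w s t S T hS hT).1
    · exact fun S hS T hT => (hop w s t T S hT hS).2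

/-- The coefficient of a monomial in the expansion of a polynomial in the brackets. -/
def coef (T : Mono α) : FreeAlg F α →ₗ[F] F :=
  (monoBasis F α).coord T ∘ₗ expand

theorem coef_apply (T : Mono α) (f : FreeAlg F α) :
    coef T f = (monoBasis F α).repr (expand f) T := rfl

theorem expand_eq_zero_iff (f : FreeAlg F α) : expand f = 0 ↔ ∀ T, coef T f = 0 := by
  rw [← (monoBasis F α).forall_coord_eq_zero_iff]; rfl

theorem repr_eq_zero_of_mem_span {A : Set (Mono α)} {p : FreeAlg F α}
    (hp : p ∈ Submodule.span F (monoBasis F α '' A)) {T : Mono α} (hT : T ∉ A) :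
    (monoBasis F α).repr p T = 0 := by
  have h := (Module.Basis.mem_span_image (monoBasis F α)).mp hp
  by_contra hne
  exact hT (h (Finsupp.mem_support_iff.mpr hne))

theorem coef_rename {r : α → β} (hr : Function.Injective r) (T : Mono α) (f : FreeAlg F α) :
    coef (T.rename r) (rename r f) = coef T f := by
  rw [coef_apply, coef_apply, expand_rename]
  induction expand f using freeAlg_induction with
  | zero => simp
  | mono t =>
    classical
    simp [rename_mono, Finsupp.single_apply, (rename_injective hr).eq_iff]
  | add f g hf hg => simp [hf, hg]
  | smul c f hf => simp [hf]

theorem coef_eq_zero_of_not_isNormal {T : Mono α} (hT : T.isNormal = false) (f : FreeAlg F α) :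
    coef T f = 0 := by
  have : coef T = (0 : FreeAlg F α →ₗ[F] F) := linearMap_ext fun t =>
    repr_eq_zero_of_mem_span
      (expand_mem_span (fun T _ => T.isNormal) (fun _ => rfl)
        (fun w s t S T hS hT => ⟨isNormal_app w hS hT, isNormal_app w hT hS⟩) t)
      (by simp [hT])
  simp [this]

theorem coef_mono_eq_zero_of_vars_ne {T t : Mono α} (h : T.vars ≠ t.vars) :
    coef T (monoBasis F α t) = 0 :=
  repr_eq_zero_of_mem_span
    (expand_mem_span (fun T t => T.vars = t.vars) (fun _ => rfl)
      (fun w s t S T hS hT => ⟨by rw [vars_app, hS, hT, Mono.vars],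
        by rw [vars_app, hS, hT, Mono.vars, add_comm]⟩) t) h

theorem coef_mono_eq_zero_of_circCount_ne {T t : Mono α} (h : T.circCount ≠ t.circCount) :
    coef T (monoBasis F α t) = 0 :=
  repr_eq_zero_of_mem_span
    (expand_mem_span (fun T t => T.circCount = t.circCount) (fun _ => rfl)
      (fun w s t S T hS hT => ⟨by rw [circCount_app, hS, hT, Mono.circCount],
        by rw [circCount_app, hS, hT, Mono.circCount]; ring⟩) t) h

theorem coef_eq_zero_of_vars_ne {n : ℕ} {T : Mono (Fin n)}
    (h : T.vars ≠ (Finset.univ : Finset (Fin n)).val) {f : FreeAlg F (Fin n)}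
    (hf : f ∈ multilinear F n) : coef T f = 0 := by
  have : multilinear F n ≤ LinearMap.ker (coef T) := by
    rw [multilinear, Submodule.span_le]
    rintro _ ⟨t, ht, rfl⟩
    exact coef_mono_eq_zero_of_vars_ne (fun h' => h (h'.trans ht))
  exact this hf

/-! ### The coefficients of products with few factors -/

theorem repr_assocMul_op {w : Op} {a b : Mono α} (ha : a.rooted w = false)
    (hb : b.rooted w = false) (p q : FreeAlg F α) :
    (monoBasis F α).repr (assocMul w p q) (op w a b) =
      (monoBasis F α).repr p a * (monoBasis F α).repr q b := by
  have h : (assocMul w).compr₂ ((monoBasis F α).coord (op w a b)) =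
      (LinearMap.mul F F).compl₁₂ ((monoBasis F α).coord a) ((monoBasis F α).coord b) :=
    bilinear_ext fun s t => by
      classical
      simp [Finsupp.single_apply, app_eq_op_iff ha hb, ← ite_and, and_comm]
  exact LinearMap.congr_fun₂ h p q

theorem repr_assocMul_op_op {w : Op} {a b c : Mono α} (ha : a.rooted w = false)
    (hb : b.rooted w = false) (hc : c.rooted w = false) (p q : FreeAlg F α) :
    (monoBasis F α).repr (assocMul w p q) (op w a (op w b c)) =
      (monoBasis F α).repr p a * (monoBasis F α).repr q (op w b c) +
        (monoBasis F α).repr p (op w a b) * (monoBasis F α).repr q c := by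
  have h : (assocMul w).compr₂ ((monoBasis F α).coord (op w a (op w b c))) =
      (LinearMap.mul F F).compl₁₂ ((monoBasis F α).coord a) ((monoBasis F α).coord (op w b c)) +
      (LinearMap.mul F F).compl₁₂ ((monoBasis F α).coord (op w a b)) ((monoBasis F α).coord c) :=
    bilinear_ext fun s t => by
      classical
      have hne : a ≠ op w a b := fun h => by rw [h] at ha; simp at ha
      simp only [LinearMap.compr₂_apply, assocMul_mono, Module.Basis.coord_apply,
        Module.Basis.repr_self, Finsupp.single_apply, app_eq_op_op_iff ha hb hc,
        LinearMap.add_apply, LinearMap.compl₁₂_apply, LinearMap.mul_apply']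
      by_cases h1 : s = a
      · subst h1
        simp [hne]
      · by_cases h2 : s = op w a b
        · subst h2
          simp [hne.symm]
        · simp [h1, h2]
  exact LinearMap.congr_fun₂ h p q

theorem repr_assocMul_of_not_rooted {w : Op} {T : Mono α} (hT : T.rooted w = false)
    (p q : FreeAlg F α) : (monoBasis F α).repr (assocMul w p q) T = 0 := by
  have h : (assocMul w).compr₂ ((monoBasis F α).coord T) =
      (0 : FreeAlg F α →ₗ[F] FreeAlg F α →ₗ[F] F) :=
    bilinear_ext fun s t => by
      classical
      have : app w s t ≠ T := fun h => by rw [← h] at hT; simp at hT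
      simp [this]
  exact LinearMap.congr_fun₂ h p q

theorem coef_freeMul_of_not_rooted {w : Op} {T : Mono α} (hT : T.rooted w = false)
    (a b : FreeAlg F α) : coef T (freeMul w a b) = 0 := by
  simp [coef_apply, expand_freeMul, repr_assocMul_of_not_rooted hT]

theorem coef_op_freeMul {w : Op} {a b : Mono α} (ha : a.rooted w = false)
    (hb : b.rooted w = false) (f g : FreeAlg F α) :
    coef (op w a b) (freeMul w f g) = coef a f * coef b g - coef a g * coef b f := by
  simp [coef_apply, expand_freeMul, repr_assocMul_op ha hb]

theorem coef_op_op_freeMul {w : Op} {a b c : Mono α} (ha : a.rooted w = false)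
    (hb : b.rooted w = false) (hc : c.rooted w = false) (f g : FreeAlg F α) :
    coef (op w a (op w b c)) (freeMul w f g) =
      coef a f * coef (op w b c) g + coef (op w a b) f * coef c g -
        (coef a g * coef (op w b c) f + coef (op w a b) g * coef c f) := by
  simp [coef_apply, expand_freeMul, repr_assocMul_op_op ha hb hc]

/-- Functionals on bracket monomials: a product of two factors. -/
def pair (w : Op) (a b : Mono α → F) : Mono α → F
  | .var _ => 0
  | .op w' s t => if w' = w then a s * b t - a t * b s else 0

/-- Functionals on bracket monomials: a product of three factors. -/
def triple (w : Op) (a b c : Mono α → F) : Mono α → F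
  | .var _ => 0
  | .op w' s t => if w' = w then a s * pair w b c t + pair w a b s * c t -
      (a t * pair w b c s + pair w a b t * c s) else 0

/-- The coefficients of a monomial in the expansions of monomials. -/
def coefMono (T : Mono α) (t : Mono α) : F := coef T (monoBasis F α t)

theorem coefMono_op {w : Op} {a b : Mono α} (ha : a.rooted w = false) (hb : b.rooted w = false) :
    (coefMono (op w a b) : Mono α → F) = pair w (coefMono a) (coefMono b) := by
  classical
  funext t
  cases t with
  | var x => simp [coefMono, coef_apply, expand_var, pair]
  | op w' s t =>
    rw [coefMono, ← freeMul_mono]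
    by_cases h : w' = w
    · subst h; simp [coef_op_freeMul ha hb, pair, coefMono]
    · rw [coef_freeMul_of_not_rooted (by simp [Ne.symm h])]
      simp [pair, h]

theorem coefMono_op_op {w : Op} {a b c : Mono α} (ha : a.rooted w = false)
    (hb : b.rooted w = false) (hc : c.rooted w = false) :
    (coefMono (op w a (op w b c)) : Mono α → F) =
      triple w (coefMono a) (coefMono b) (coefMono c) := by
  classical
  funext t
  cases t with
  | var x => simp [coefMono, coef_apply, expand_var, triple]
  | op w' s t =>
    rw [coefMono, ← freeMul_mono]
    by_cases h : w' = w
    · subst h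
      simp only [coef_op_op_freeMul ha hb hc, triple, if_true, ← coefMono_op hb hc,
        ← coefMono_op ha hb]
      rfl
    · rw [coef_freeMul_of_not_rooted (by simp [Ne.symm h])]
      simp [triple, h]

theorem coef_eq_lin (T : Mono α) (f : FreeAlg F α) : coef T f = lin (coefMono T) f :=
  LinearMap.congr_fun (linearMap_ext (g := coef T) (h := lin (coefMono T))
    fun t => by simp [coefMono]) f

theorem lin_neg (g : Mono α → F) (f : FreeAlg F α) : lin (-g) f = - lin g f := by
  have : lin (-g) = -lin (F := F) g := linearMap_ext fun t => by simp
  simp [this]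

theorem lin_add (g h : Mono α → F) (f : FreeAlg F α) : lin (g + h) f = lin g f + lin h f := by
  have : lin (g + h) = lin (F := F) g + lin h := linearMap_ext fun t => by simp
  simp [this]

section pair

variable (w : Op) (a b c : Mono α → F)

theorem pair_swap : pair w b a = -pair w a b := by
  funext t; cases t with
  | var x => simp [pair]
  | op w' s t => simp only [pair, Pi.neg_apply]; split <;> ring

@[simp] theorem pair_neg_left : pair w (-a) b = -pair w a b := by
  funext t; cases t with
  | var x => simp [pair]
  | op w' s t => simp only [pair, Pi.neg_apply]; split <;> ring

@[simp] theorem pair_neg_right : pair w a (-b) = -pair w a b := by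
  funext t; cases t with
  | var x => simp [pair]
  | op w' s t => simp only [pair, Pi.neg_apply]; split <;> ring

theorem pair_add_right (b' : Mono α → F) : pair w a (b + b') = pair w a b + pair w a b' := by
  funext t; cases t with
  | var x => simp [pair]
  | op w' s t => simp only [pair, Pi.add_apply]; split <;> ring

@[simp] theorem pair_zero_right : pair w a 0 = 0 := by
  funext t; cases t <;> simp [pair]

@[simp] theorem triple_neg_left : triple w (-a) b c = -triple w a b c := by
  funext t; cases t with
  | var x => simp [triple]
  | op w' s t => simp only [triple, pair_neg_left, Pi.neg_apply]; split <;> ring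

@[simp] theorem triple_neg_mid : triple w a (-b) c = -triple w a b c := by
  funext t; cases t with
  | var x => simp [triple]
  | op w' s t => simp only [triple, pair_neg_left, pair_neg_right, Pi.neg_apply]; split <;> ring

@[simp] theorem triple_neg_right : triple w a b (-c) = -triple w a b c := by
  funext t; cases t with
  | var x => simp [triple]
  | op w' s t => simp only [triple, pair_neg_right, Pi.neg_apply]; split <;> ring

/-- In a Lie element of degree `n` the coefficient of a reversed word is `(-1) ^ (n - 1)` times the
original one; three factors give the sign `+`, two factors the sign `-` of `pair_swap`. -/
theorem triple_reverse : triple w c b a = triple w a b c := by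
  funext t; cases t with
  | var x => simp [triple]
  | op w' s t =>
    simp only [triple, pair_swap w b c, pair_swap w a b, Pi.neg_apply]; split <;> ring

/-- The coefficients of a Lie element add up to zero over the shuffles of two nonempty words; here
the words are `a` and `bc`. -/
theorem triple_shuffle : triple w a b c + triple w b a c + triple w b c a = 0 := by
  funext t; cases t with
  | var x => simp [triple]
  | op w' s t =>
    simp only [triple, Pi.add_apply, Pi.zero_apply, pair_swap w a b, pair_swap w a c,
      Pi.neg_apply]
    split <;> ring

end pair

end Interchange
end

noncomputable section

namespace Interchange

variable {F : Type*} [Field F] {α : Type*}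

open Mono

/-! ### Brackets are determined by their expansions -/

/-- Each of the two operations is a Lie bracket. -/
structure IsLie {A : Type*} [AddCommGroup A] [Module F A] (m : Ops F A) : Prop where
  anticomm : ∀ w a b, m w a b + m w b a = 0
  jacobi : ∀ w a b c, m w a (m w b c) + m w b (m w c a) + m w c (m w a b) = 0

/-! ### The Dynkin operator for two operations -/

section Dynkin

variable {A : Type*} [AddCommGroup A] [Module F A] (m : Ops F A) (v : α → A)

/-- The right-normed bracketing of a monomial, divided by the number of factors at each node
(`value`), the same without the division at the root (`bracketing`), and the action on `A` by
iterated brackets (`action`). -/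
structure DynkinData (F : Type*) [Field F] (A : Type*) [AddCommGroup A] [Module F A] where
  value : A
  bracketing : Op → A
  action : Op → A →ₗ[F] A

/-- The Dynkin operator on monomials. -/
def dynkin : Mono α → DynkinData F A
  | .var x => ⟨v x, fun _ => v x, fun w => m w (v x)⟩
  | .op w s t =>
    let y : A := ((s.len w + t.len w : ℕ) : F)⁻¹ • (dynkin s).action w ((dynkin t).bracketing w)
    ⟨y, fun w' => if w' = w then (dynkin s).action w ((dynkin t).bracketing w) else y,
      fun w' => if w' = w then (dynkin s).action w ∘ₗ (dynkin t).action w else m w' y⟩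

theorem dynkin_of_not_rooted {w : Op} {t : Mono α} (h : t.rooted w = false) :
    (dynkin m v t).bracketing w = (dynkin m v t).value ∧
      (dynkin m v t).action w = m w (dynkin m v t).value := by
  cases t with
  | var x => exact ⟨rfl, rfl⟩
  | op w' s t =>
    have : w ≠ w' := fun h' => by simp [h'] at h
    simp [dynkin, this]

theorem bracketing_app (w : Op) (s t : Mono α) :
    (dynkin m v (app w s t)).bracketing w =
      (dynkin m v s).action w ((dynkin m v t).bracketing w) := by
  induction s using app_induction (w := w) with
  | base s hs => simp [app_of_not_rooted hs, dynkin]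
  | step a b hb => simp [dynkin, hb]

theorem action_app (w : Op) (s t : Mono α) :
    (dynkin m v (app w s t)).action w =
      (dynkin m v s).action w ∘ₗ (dynkin m v t).action w := by
  induction s using app_induction (w := w) with
  | base s hs => simp [app_of_not_rooted hs, dynkin]
  | step a b hb => simp [dynkin, hb, LinearMap.comp_assoc]

theorem value_app (w : Op) (s t : Mono α) :
    (dynkin m v (app w s t)).value = ((s.len w + t.len w : ℕ) : F)⁻¹ •
      (dynkin m v s).action w ((dynkin m v t).bracketing w) := by
  induction s using app_induction (w := w) with
  | base s hs => simp [app_of_not_rooted hs, dynkin]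
  | step a b hb => simp [dynkin, bracketing_app, len, len_app, add_assoc]

variable {m}

/-- Every polynomial in two Lie brackets can be recovered from its expansion. -/
theorem lin_value_expand [CharZero F] (hm : IsLie m) (f : FreeAlg F α) :
    lin (fun t => (dynkin m v t).value) (expand f) = eval m v f := by
  set val : FreeAlg F α →ₗ[F] A := lin fun t => (dynkin m v t).value with hval
  let br (w : Op) : FreeAlg F α →ₗ[F] A := lin fun t => (dynkin m v t).bracketing w
  let act (w : Op) : FreeAlg F α →ₗ[F] A →ₗ[F] A := lin fun t => (dynkin m v t).action w
  have hbr (w : Op) (p q : FreeAlg F α) : br w (assocMul w p q) = act w p (br w q) := by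
    have h : (assocMul w).compr₂ (br w) =
        ((LinearMap.lflip (R₀ := F)) (act w).flip).compl₂ (br w) :=
      bilinear_ext fun s t => by simp [br, act, bracketing_app]
    simpa using LinearMap.congr_fun₂ h p q
  have hact (w : Op) (p q : FreeAlg F α) (x : A) :
      act w (assocMul w p q) x = act w p (act w q x) := by
    induction p using freeAlg_induction with
    | zero => simp
    | add f g hf hg => simp [hf, hg]
    | smul c f hf => simp [hf]
    | mono s =>
      induction q using freeAlg_induction with
      | zero => simp
      | add f g hf hg => simp [hf, hg]
      | smul c f hf => simp [hf]
      | mono t => simp [act, action_app]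
  -- on products with a different outermost operation
  have hother {w w' : Op} (h : w' ≠ w) (p q : FreeAlg F α) :
      br w (assocMul w' p q) = val (assocMul w' p q) ∧
        act w (assocMul w' p q) = m w (val (assocMul w' p q)) := by
    have h1 : (assocMul w').compr₂ (br w) =
        ((assocMul w').compr₂ val : FreeAlg F α →ₗ[F] FreeAlg F α →ₗ[F] A) :=
      bilinear_ext fun s t => by
        simp [br, hval, (dynkin_of_not_rooted m v (w := w) (t := app w' s t) (by simp [h])).1]
    have h2 : (assocMul w').compr₂ (act w) = (assocMul w').compr₂ (m w ∘ₗ val) :=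
      bilinear_ext fun s t => by
        simp [act, hval, (dynkin_of_not_rooted m v (w := w) (t := app w' s t) (by simp [h])).2]
    exact ⟨LinearMap.congr_fun₂ h1 p q, LinearMap.congr_fun₂ h2 p q⟩
  -- The division by the number of factors is linear only on polynomials that are homogeneous in
  -- this number. Expansions of monomials are, by `hlen`.
  have hvalue (w : Op) (s t : Mono α) {p q : FreeAlg F α}
      (hp : p ∈ Submodule.span F (monoBasis F α '' {T | T.len w = s.len w}))
      (hq : q ∈ Submodule.span F (monoBasis F α '' {T | T.len w = t.len w})) :
      val (assocMul w p q) = ((s.len w + t.len w : ℕ) : F)⁻¹ • act w p (br w q) := by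
    induction hp using Submodule.span_induction with
    | zero => simp
    | add f g _ _ hf hg => simp [hf, hg]
    | smul c f _ hf => simp [hf, smul_comm c]
    | mem x hx =>
      obtain ⟨S, hS, rfl⟩ := hx
      induction hq using Submodule.span_induction with
      | zero => simp
      | add f g _ _ hf hg => simp [hf, hg]
      | smul c f _ hf => simp [hf, smul_comm c]
      | mem y hy =>
        obtain ⟨T, hT, rfl⟩ := hy
        rw [Set.mem_ofPred_eq] at hS hT
        simp only [hval, assocMul_mono, lin_mono, value_app, hS, hT, act, br]
  have hlen (w : Op) (t : Mono α) := expand_mem_span (F := F) (fun T t => T.len w = t.len w)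
    (fun _ => rfl) (fun w' s t S T hS hT => ⟨by rw [len_app, hS, hT, len],
      by rw [len_app, hS, hT, len, add_comm]⟩) t
  -- Dynkin–Specht–Wever: on the expansion of `t`, right-normed bracketing multiplies the value of
  -- `t` by the number of its factors, and iterated brackets act as the bracket with that value. The
  -- statements are proved together because each product needs both of them for its factors.
  have main (t : Mono α) : val (expand (monoBasis F α t)) = evalMono m v t ∧
      ∀ w, br w (expand (monoBasis F α t)) = (t.len w : F) • evalMono m v t ∧
        act w (expand (monoBasis F α t)) = m w (evalMono m v t) := by
    induction t with
    | var x => simp [expand_var, hval, br, act, dynkin, evalMono, len]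
    | op w s t hs ht =>
      -- The two terms are `len t` times `[s,t]` and `-len s` times `[t,s]`; by anticommutativity
      -- they combine to `(len s + len t) [s,t]`.
      have e1 : act w (expand (monoBasis F α s)) (br w (expand (monoBasis F α t))) -
          act w (expand (monoBasis F α t)) (br w (expand (monoBasis F α s))) =
          ((s.len w + t.len w : ℕ) : F) • m w (evalMono m v s) (evalMono m v t) := by
        rw [(hs.2 w).1, (hs.2 w).2, (ht.2 w).1, (ht.2 w).2, map_smul, map_smul,
          eq_neg_of_add_eq_zero_left (hm.anticomm w (evalMono m v t) (evalMono m v s))]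
        push_cast
        rw [add_smul, smul_neg, sub_neg_eq_add, add_comm]
      have hv : val (expand (monoBasis F α (op w s t))) = evalMono m v (op w s t) := by
        rw [expand_op, map_sub, hvalue w s t (hlen w s) (hlen w t),
          hvalue w t s (hlen w t) (hlen w s), add_comm (t.len w), ← smul_sub, e1, smul_smul,
          inv_mul_cancel₀, one_smul, evalMono]
        have := s.len_pos w
        exact_mod_cast (by omega : s.len w + t.len w ≠ 0)
      refine ⟨hv, fun w' => ?_⟩
      by_cases h : w = w'
      · subst h
        refine ⟨?_, ?_⟩
        · rw [expand_op, map_sub, hbr, hbr, e1, len, if_pos rfl, evalMono]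
        · ext x
          rw [expand_op, map_sub, LinearMap.sub_apply, hact, hact, (hs.2 w).2, (ht.2 w).2,
            evalMono]
          -- The Jacobi identity enters only here, in the form `[s,[t,x]] - [t,[s,x]] = [[s,t],x]`.
          have j := hm.jacobi w (evalMono m v s) (evalMono m v t) x
          rw [eq_neg_of_add_eq_zero_left (hm.anticomm w x (evalMono m v s)),
            eq_neg_of_add_eq_zero_left (hm.anticomm w x (m w (evalMono m v s) (evalMono m v t))),
            map_neg] at j
          rw [← sub_eq_zero, ← j]
          abel
      · rw [← hv, expand_op, map_sub, map_sub, map_sub, (hother h _ _).1, (hother h _ _).1,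
          (hother h _ _).2, (hother h _ _).2, ← map_sub]
        simp [len, h]
  exact LinearMap.congr_fun (linearMap_ext (g := val ∘ₗ expand) (h := eval m v) fun t => by
    simpa [eval_mono] using (main t).1) f

theorem eval_eq_zero_of_expand_eq_zero [CharZero F] (hm : IsLie m) {f : FreeAlg F α}
    (hf : expand f = 0) : eval m v f = 0 := by
  rw [← lin_value_expand v hm, hf, map_zero]

end Dynkin

/-! ### Consequences -/

theorem subst_mem_consequences {Y : Type*} {S : Set (FreeAlg F Y)} {g : FreeAlg F Y} (hg : g ∈ S)
    (v : Y → FreeAlg F α) : subst v g ∈ consequences S α := by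
  simp only [consequences, Submodule.mem_sInf]
  exact fun I hI => hI.2 g hg v

theorem eval_eval {β A : Type*} [AddCommGroup A] [Module F A] (m : Ops F A) (v : β → A)
    (v' : α → FreeAlg F β) (f : FreeAlg F α) :
    eval m v (subst v' f) = eval m (fun x => eval m v (v' x)) f := by
  refine LinearMap.congr_fun (linearMap_ext (g := eval m v ∘ₗ subst v')
    (h := eval m (fun x => eval m v (v' x))) fun t => ?_) f
  simp only [LinearMap.comp_apply, eval_mono]
  induction t with
  | var x => simp [evalMono]
  | op w s t hs ht => simp [evalMono, eval_freeMul, hs, ht]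

theorem isIdeal_ker_eval {A : Type*} [AddCommGroup A] [Module F A] (m : Ops F A) (v : α → A) :
    IsIdeal (LinearMap.ker (eval m v)) := by
  intro w a b ha
  rw [LinearMap.mem_ker] at ha
  simp [eval_freeMul, ha]

/-- An algebra that satisfies some identities satisfies their consequences. -/
theorem consequences_le_ker {Y A : Type*} [AddCommGroup A] [Module F A] {m : Ops F A}
    {S : Set (FreeAlg F Y)} (hS : ∀ g ∈ S, ∀ v : Y → A, eval m v g = 0) (v : α → A) :
    consequences S α ≤ LinearMap.ker (eval m v) :=
  sInf_le ⟨isIdeal_ker_eval m v, fun g hg v' => by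
    rw [LinearMap.mem_ker, eval_eval]; exact hS g hg _⟩

theorem evalMono_quotMul {I : Submodule F (FreeAlg F α)} (hI : IsIdeal I) {Y : Type*}
    (v : Y → FreeAlg F α) (t : Mono Y) :
    evalMono (quotMul I hI) (fun x => I.mkQ (v x)) t = I.mkQ (evalMono freeMul v t) := by
  induction t with
  | var x => rfl
  | op w s t hs ht => rw [evalMono, hs, ht, quotMul_mk]; rfl

theorem eval_quotMul {I : Submodule F (FreeAlg F α)} (hI : IsIdeal I) {Y : Type*}
    (v : Y → FreeAlg F α) (f : FreeAlg F Y) :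
    eval (quotMul I hI) (fun x => I.mkQ (v x)) f = I.mkQ (subst v f) :=
  LinearMap.congr_fun (linearMap_ext (g := eval (quotMul I hI) fun x => I.mkQ (v x))
    (h := I.mkQ ∘ₗ subst v) fun t => by
      rw [LinearMap.comp_apply, eval_mono, eval_mono, evalMono_quotMul]) f

theorem subst_X (f : FreeAlg F α) : subst X f = f := by
  refine LinearMap.congr_fun (linearMap_ext (g := subst X) (h := LinearMap.id) fun t => ?_) f
  rw [LinearMap.id_apply, eval_mono]
  induction t with
  | var x => rfl
  | op w s t hs ht => rw [evalMono, hs, ht, freeMul_mono]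

theorem subst_mem_consequences_of_mem {Y β : Type*} {S : Set (FreeAlg F Y)} {g : FreeAlg F β}
    (hg : g ∈ consequences S β) (v : β → FreeAlg F α) : subst v g ∈ consequences S α := by
  have : consequences S β ≤ (consequences S α).comap (subst v) :=
    sInf_le ⟨fun w a b ha => by
      simp only [Submodule.mem_comap, eval_freeMul] at ha ⊢
      exact isIdeal_consequences S α w _ _ ha, fun g hg v' => by
      rw [Submodule.mem_comap, eval_eval]; exact subst_mem_consequences hg _⟩
  exact this hg

theorem consequences_le {Y Z : Type*} {S : Set (FreeAlg F Y)} {S' : Set (FreeAlg F Z)}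
    (h : ∀ g ∈ S, g ∈ consequences S' Y) : consequences S α ≤ consequences S' α :=
  sInf_le ⟨isIdeal_consequences S' α, fun g hg v => subst_mem_consequences_of_mem (h g hg) v⟩

variable (F) in
/-- The identities of two Lie brackets. -/
def lieIds : Set (FreeAlg F ℕ) :=
  {anticomm F .circ, anticomm F .bullet, jacobi F .circ, jacobi F .bullet}

theorem anticomm_mem_lieIds (w : Op) : anticomm F w ∈ lieIds F := by cases w <;> simp [lieIds]

theorem jacobi_mem_lieIds (w : Op) : jacobi F w ∈ lieIds F := by cases w <;> simp [lieIds]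

theorem eval_anticomm {A : Type*} [AddCommGroup A] [Module F A] (m : Ops F A) (v : ℕ → A)
    (w : Op) : eval m v (anticomm F w) = m w (v 0) (v 1) + m w (v 1) (v 0) := by
  simp [anticomm, eval_freeMul, eval_X]

theorem eval_jacobi {A : Type*} [AddCommGroup A] [Module F A] (m : Ops F A) (v : ℕ → A)
    (w : Op) : eval m v (jacobi F w) = m w (v 0) (m w (v 1) (v 2)) +
      m w (v 1) (m w (v 2) (v 0)) + m w (v 2) (m w (v 0) (v 1)) := by
  simp [jacobi, eval_freeMul, eval_X]

theorem IsLie.eval_eq_zero {A : Type*} [AddCommGroup A] [Module F A] {m : Ops F A}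
    (hm : IsLie m) {g : FreeAlg F ℕ} (hg : g ∈ lieIds F) (v : ℕ → A) : eval m v g = 0 := by
  simp only [lieIds, Set.mem_insert_iff, Set.mem_singleton_iff] at hg
  rcases hg with rfl | rfl | rfl | rfl
  · rw [eval_anticomm, hm.anticomm]
  · rw [eval_anticomm, hm.anticomm]
  · rw [eval_jacobi, hm.jacobi]
  · rw [eval_jacobi, hm.jacobi]

/-- This quotient is the universal test algebra: a polynomial that vanishes at its generators is a
consequence of the Lie identities. -/
theorem isLie_quotMul (α : Type*) :
    IsLie (quotMul _ (isIdeal_consequences (lieIds F) α)) := by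
  have key {g : FreeAlg F ℕ} (hg : g ∈ lieIds F) (v : ℕ → FreeAlg F α) :
      eval (quotMul _ (isIdeal_consequences (lieIds F) α))
        (fun x => (consequences (lieIds F) α).mkQ (v x)) g = 0 := by
    rw [eval_quotMul, Submodule.mkQ_apply, Submodule.Quotient.mk_eq_zero]
    exact subst_mem_consequences hg v
  constructor
  · intro w a b
    obtain ⟨a, rfl⟩ := Submodule.mkQ_surjective _ a
    obtain ⟨b, rfl⟩ := Submodule.mkQ_surjective _ b
    simpa [eval_anticomm] using key (anticomm_mem_lieIds w) (fun n => if n = 0 then a else b)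
  · intro w a b c
    obtain ⟨a, rfl⟩ := Submodule.mkQ_surjective _ a
    obtain ⟨b, rfl⟩ := Submodule.mkQ_surjective _ b
    obtain ⟨c, rfl⟩ := Submodule.mkQ_surjective _ c
    simpa [eval_jacobi] using key (jacobi_mem_lieIds w)
      (fun n => if n = 0 then a else if n = 1 then b else c)

theorem isLie_brackets_of_assoc {A : Type*} [AddCommGroup A] [Module F A] {m : Ops F A}
    (hm : ∀ w a b c, m w (m w a b) c = m w a (m w b c)) : IsLie (brackets m) := by
  constructor
  · intro w a b
    simp [brackets]
  · intro w a b c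
    simp only [brackets, LinearMap.sub_apply, LinearMap.flip_apply, map_sub, hm]
    abel

theorem assocMul_assoc (w : Op) (a b c : FreeAlg F α) :
    assocMul w (assocMul w a b) c = assocMul w a (assocMul w b c) := by
  induction a using freeAlg_induction with
  | zero => simp
  | add f g hf hg => simp [hf, hg]
  | smul c f hf => simp [hf]
  | mono s =>
    induction b using freeAlg_induction with
    | zero => simp
    | add f g hf hg => simp [hf, hg]
    | smul c f hf => simp [hf]
    | mono t =>
      induction c using freeAlg_induction with
      | zero => simp
      | add f g hf hg => simp only [map_add, hf, hg]
      | smul c f hf => simp only [map_smul, hf]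
      | mono r => simp [app_assoc]

/-- A polynomial with vanishing expansion is a consequence of anticommutativity and the Jacobi
identity, and conversely. -/
theorem mem_consequences_lieIds_iff [CharZero F] (f : FreeAlg F α) :
    f ∈ consequences (lieIds F) α ↔ expand f = 0 := by
  constructor
  · intro hf
    -- `expand` is itself an evaluation, in the commutator brackets of two associative products, and
    -- such commutators are Lie brackets.
    exact consequences_le_ker (fun g hg v =>
      (isLie_brackets_of_assoc assocMul_assoc).eval_eq_zero hg v) X hf
  · intro hf
    -- At the generators of the quotient by the Lie identities the value of `f` is its own class,
    -- and the Dynkin operator makes this value depend on the expansion only.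
    have h := eval_eq_zero_of_expand_eq_zero
      (fun x => (consequences (lieIds F) α).mkQ (X x)) (isLie_quotMul α) hf
    rwa [eval_quotMul, subst_X, Submodule.mkQ_apply, Submodule.Quotient.mk_eq_zero] at h

end Interchange
end

noncomputable section

namespace Interchange

variable {F : Type*} [Field F] {α β : Type*}

open Mono

/-! ### Associative interchange algebras -/

/-- The operations of an associative interchange algebra. -/
structure IsAI {A : Type*} [AddCommGroup A] [Module F A] (m : Ops F A) : Prop where
  assoc : ∀ w a b c, m w (m w a b) c = m w a (m w b c)
  interchange : ∀ w a b c d,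
    m w (m w.swap a b) (m w.swap c d) = m w.swap (m w a c) (m w b d)

theorem eval_assoc {A : Type*} [AddCommGroup A] [Module F A] (m : Ops F A) (v : ℕ → A)
    (w : Op) : eval m v (assoc F w) =
      m w (m w (v 0) (v 1)) (v 2) - m w (v 0) (m w (v 1) (v 2)) := by
  simp [assoc, eval_freeMul, eval_X]

theorem eval_interchange {A : Type*} [AddCommGroup A] [Module F A] (m : Ops F A) (v : ℕ → A) :
    eval m v (interchange F) =
      m .bullet (m .circ (v 0) (v 1)) (m .circ (v 2) (v 3)) -
        m .circ (m .bullet (v 0) (v 2)) (m .bullet (v 1) (v 3)) := by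
  simp [interchange, eval_freeMul, eval_X]

theorem assoc_mem_assocInterchange (w : Op) : assoc F w ∈ assocInterchange F := by
  cases w <;> simp [assocInterchange]

theorem interchange_mem_assocInterchange : interchange F ∈ assocInterchange F := by
  simp [assocInterchange]

theorem isAI_mulAI (α : Type*) : IsAI (mulAI F α) := by
  have key {g : FreeAlg F ℕ} (hg : g ∈ assocInterchange F) (v : ℕ → FreeAlg F α) :
      eval (mulAI F α) (fun x => (consequences (assocInterchange F) α).mkQ (v x)) g = 0 := by
    rw [mulAI, eval_quotMul, Submodule.mkQ_apply, Submodule.Quotient.mk_eq_zero]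
    exact subst_mem_consequences hg v
  have hi (a b c d : FreeAI F α) : mulAI F α .bullet (mulAI F α .circ a b) (mulAI F α .circ c d) =
      mulAI F α .circ (mulAI F α .bullet a c) (mulAI F α .bullet b d) := by
    obtain ⟨a, rfl⟩ := Submodule.mkQ_surjective _ a
    obtain ⟨b, rfl⟩ := Submodule.mkQ_surjective _ b
    obtain ⟨c, rfl⟩ := Submodule.mkQ_surjective _ c
    obtain ⟨d, rfl⟩ := Submodule.mkQ_surjective _ d
    have := key interchange_mem_assocInterchange
      (fun n => if n = 0 then a else if n = 1 then b else if n = 2 then c else d)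
    rw [eval_interchange, sub_eq_zero] at this
    simpa using this
  constructor
  · intro w a b c
    obtain ⟨a, rfl⟩ := Submodule.mkQ_surjective _ a
    obtain ⟨b, rfl⟩ := Submodule.mkQ_surjective _ b
    obtain ⟨c, rfl⟩ := Submodule.mkQ_surjective _ c
    have := key (assoc_mem_assocInterchange w)
      (fun n => if n = 0 then a else if n = 1 then b else c)
    rw [eval_assoc, sub_eq_zero] at this
    simpa using this
  -- With the roles of the operations exchanged, the interchange law is the same equation read from
  -- right to left with the two middle letters exchanged.
  · rintro (_ | _) a b c d
    · exact (hi a c b d).symm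
    · exact hi a b c d

/-! ### Values in associative interchange algebras, and reversal of one product -/

section eval

variable {A : Type*} [AddCommGroup A] [Module F A] {m : Ops F A}

theorem IsAI.eval_eq_zero (hm : IsAI m) {g : FreeAlg F ℕ} (hg : g ∈ assocInterchange F)
    (v : ℕ → A) : eval m v g = 0 := by
  simp only [assocInterchange, Set.mem_insert_iff, Set.mem_singleton_iff] at hg
  rcases hg with rfl | rfl | rfl
  · rw [eval_assoc, hm.assoc, sub_self]
  · rw [eval_assoc, hm.assoc, sub_self]
  · rw [eval_interchange, sub_eq_zero]
    exact hm.interchange .bullet _ _ _ _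

theorem evalMono_app (hm : IsAI m) (v : α → A) (w : Op) (s t : Mono α) :
    evalMono m v (app w s t) = m w (evalMono m v s) (evalMono m v t) := by
  induction s using app_induction (w := w) with
  | base s hs => rw [app_of_not_rooted hs]; rfl
  | step a b hb => rw [app_op, evalMono, hb, evalMono, hm.assoc]

theorem eval_assocMul (hm : IsAI m) (v : α → A) (w : Op) (p q : FreeAlg F α) :
    eval m v (assocMul w p q) = m w (eval m v p) (eval m v q) := by
  have h : (assocMul w).compr₂ (eval m v) = (m w).compl₁₂ (eval m v) (eval m v) :=
    bilinear_ext fun s t => by simp [eval_mono, evalMono_app hm]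
  exact LinearMap.congr_fun₂ h p q

theorem eval_expand (hm : IsAI m) (v : α → A) (f : FreeAlg F α) :
    eval m v (expand f) = eval (brackets m) v f := by
  refine LinearMap.congr_fun (linearMap_ext (g := eval m v ∘ₗ expand)
    (h := eval (brackets m) v) fun t => ?_) f
  rw [LinearMap.comp_apply]
  induction t with
  | var x => rw [expand_var, eval_mono, eval_mono]; rfl
  | op w s t hs ht =>
    rw [eval_mono] at hs ht
    rw [expand_op, map_sub, eval_assocMul hm, eval_assocMul hm, hs, ht, eval_mono]
    simp [evalMono, brackets]

/-- The same operations with the product `∘` reversed. -/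
def revCirc (m : Ops F A) : Ops F A
  | .circ => (m .circ).flip
  | .bullet => m .bullet

/-- The interchange law says that a 2 × 2 array may be multiplied first by rows or first by columns.
Reversing `∘` reflects the array. -/
theorem isAI_revCirc (hm : IsAI m) : IsAI (revCirc m) := by
  constructor
  · rintro (_ | _) a b c
    · exact (hm.assoc .circ c b a).symm
    · exact hm.assoc .bullet a b c
  · rintro (_ | _) a b c d
    · exact hm.interchange .circ c d a b
    · exact hm.interchange .bullet b a d c

end eval

/-- A polynomial in two brackets that vanishes in all associative interchange algebras. -/
def IsBracketId (f : FreeAlg F α) : Prop :=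
  expand f ∈ consequences (assocInterchange F) α

theorem IsBracketId.eval_eq_zero {A : Type*} [AddCommGroup A] [Module F A] {m : Ops F A}
    {f : FreeAlg F α} (hf : IsBracketId f) (hm : IsAI m) (v : α → A) :
    eval (brackets m) v f = 0 := by
  rw [← eval_expand hm]
  exact consequences_le_ker (fun g hg v => hm.eval_eq_zero hg v) v hf

theorem eval_mulAI (f : FreeAlg F α) {Y : Type*} (r : α → Y) :
    eval (mulAI F Y) (fun x => (consequences (assocInterchange F) Y).mkQ (X (r x))) f =
      (consequences (assocInterchange F) Y).mkQ (rename r f) := by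
  rw [mulAI, eval_quotMul]
  congr 1
  refine LinearMap.congr_fun (linearMap_ext (g := subst fun x => X (r x))
    (h := rename r) fun t => ?_) f
  rw [eval_mono, rename_mono]
  induction t with
  | var x => rfl
  | op w s t hs ht => rw [evalMono, hs, ht, freeMul_mono]; rfl

theorem isBracketId_of_eval {f : FreeAlg F α}
    (h : eval (brackets (mulAI F α))
      (fun x => (consequences (assocInterchange F) α).mkQ (X x)) f = 0) : IsBracketId f := by
  rw [← eval_expand (isAI_mulAI α)] at h
  unfold IsBracketId
  have hid : rename (id : α → α) (expand f) = expand f :=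
    LinearMap.congr_fun (linearMap_ext (g := rename (F := F) (id : α → α))
      (h := LinearMap.id) fun t => by rw [rename_mono, Mono.rename_id]; rfl) _
  rw [← hid, ← Submodule.Quotient.mk_eq_zero, ← Submodule.mkQ_apply, ← eval_mulAI]
  exact h

/-- Countably many generators contain `n` of them, and a retraction of the indices brings the
vanishing of the generic value back to the free algebra on `n` generators. From there it passes to
all substitutions. -/
theorem mem_identities_iff {n : ℕ} (f : FreeAlg F (Fin n)) :
    f ∈ identities (brackets (mulAI F ℕ)) (Fin n) ↔ IsBracketId f := by
  simp only [identities, Submodule.mem_iInf, LinearMap.mem_ker]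
  constructor
  · intro h
    have h1 := h fun x => (consequences (assocInterchange F) ℕ).mkQ (X (x : ℕ))
    rw [← eval_expand (isAI_mulAI ℕ), eval_mulAI, Submodule.mkQ_apply,
      Submodule.Quotient.mk_eq_zero] at h1
    -- The retraction is reduction modulo `n`. For `n = 0` there is none, but then there are no
    -- monomials either.
    cases n with
    | zero =>
      have : IsEmpty (Mono (Fin 0)) := ⟨fun t => by
        induction t with
        | var x => exact x.elim0
        | op w s t hs ht => exact hs⟩
      have hz : (monoBasis F (Fin 0)).repr (expand f) = 0 := Subsingleton.elim _ _
      rw [IsBracketId, (LinearEquiv.map_eq_zero_iff _).mp hz]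
      exact Submodule.zero_mem _
    | succ n =>
      have h2 := rename_mem_consequences _ (fun k => Fin.ofNat (n + 1) k) h1
      have : rename (fun k => Fin.ofNat (n + 1) k) (rename (fun x : Fin (n + 1) => (x : ℕ))
          (expand f)) = expand f := by
        refine LinearMap.congr_fun (linearMap_ext
          (g := rename (fun k => Fin.ofNat (n + 1) k) ∘ₗ rename (fun x : Fin (n + 1) => (x : ℕ)))
          (h := LinearMap.id) fun t => ?_) (expand f)
        rw [LinearMap.comp_apply, rename_mono, rename_mono, Mono.rename_rename,
          LinearMap.id_apply]
        congr 1
        convert Mono.rename_id t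
        funext x
        simp
      rwa [this] at h2
  · exact fun h v => h.eval_eq_zero (isAI_mulAI ℕ) v

theorem mem_allIds_iff {n : ℕ} (f : FreeAlg F (Fin n)) :
    f ∈ allIds F n ↔ f ∈ multilinear F n ∧ IsBracketId f := by
  rw [allIds, Submodule.mem_inf, mem_identities_iff]

/-- Multiplication of the monomials with an odd number of `∘` by `-1`. -/
def signCirc : FreeAlg F α →ₗ[F] FreeAlg F α :=
  lin fun t => (-1 : F) ^ t.circCount • monoBasis F α t

theorem signCirc_mem_multilinear {n : ℕ} {f : FreeAlg F (Fin n)} (hf : f ∈ multilinear F n) :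
    signCirc f ∈ multilinear F n := by
  have : multilinear F n ≤ (multilinear F n).comap signCirc := by
    conv_lhs => rw [multilinear]
    rw [Submodule.span_le]
    rintro _ ⟨t, ht, rfl⟩
    simp only [SetLike.mem_coe, Submodule.mem_comap, signCirc, lin_mono]
    exact Submodule.smul_mem _ _ (Submodule.subset_span ⟨t, ht, rfl⟩)
  exact this hf

/-- Reversing `∘` changes the sign of each bracket `[-,-]_∘` and of no other. So `signCirc`
preserves the identities, which allows the parities of the number of `∘` to be separated. -/
theorem eval_signCirc {A : Type*} [AddCommGroup A] [Module F A] (m : Ops F A) (v : α → A)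
    (f : FreeAlg F α) :
    eval (brackets m) v (signCirc f) = eval (brackets (revCirc m)) v f := by
  refine LinearMap.congr_fun (linearMap_ext (g := eval (brackets m) v ∘ₗ signCirc)
    (h := eval (brackets (revCirc m)) v) fun t => ?_) f
  rw [LinearMap.comp_apply, signCirc, lin_mono, map_smul, eval_mono, eval_mono]
  induction t with
  | var x => simp [evalMono, circCount]
  | op w s t hs ht =>
    rw [evalMono, evalMono, ← hs, ← ht]
    cases w
    · simp only [circCount, if_true, pow_add, pow_one, brackets, revCirc, LinearMap.sub_apply,
        LinearMap.flip_apply, map_smul, LinearMap.smul_apply, smul_sub, smul_smul, neg_mul,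
        one_mul, neg_smul, mul_comm ((-1 : F) ^ t.circCount)]
      abel
    · simp [circCount, pow_add, brackets, revCirc, smul_sub, smul_smul,
        mul_comm ((-1 : F) ^ t.circCount)]

theorem signCirc_mem_allIds {n : ℕ} {f : FreeAlg F (Fin n)} (hf : f ∈ allIds F n) :
    signCirc f ∈ allIds F n := by
  rw [mem_allIds_iff] at hf ⊢
  refine ⟨signCirc_mem_multilinear hf.1, isBracketId_of_eval ?_⟩
  rw [eval_signCirc]
  exact hf.2.eval_eq_zero (isAI_revCirc (isAI_mulAI _)) _

theorem coef_signCirc (T : Mono α) (f : FreeAlg F α) :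
    coef T (signCirc f) = (-1 : F) ^ T.circCount * coef T f := by
  refine LinearMap.congr_fun (linearMap_ext (g := coef T ∘ₗ signCirc)
    (h := (-1 : F) ^ T.circCount • coef T) fun t => ?_) f
  simp only [LinearMap.comp_apply, signCirc, lin_mono, map_smul, LinearMap.smul_apply,
    smul_eq_mul]
  by_cases h : T.circCount = t.circCount
  · rw [h]
  · rw [coef_mono_eq_zero_of_circCount_ne h, mul_zero, mul_zero]

/-! ### Rewriting monomials by associativity and interchange -/

/-- One application of associativity or of the interchange law inside a monomial. -/
inductive Rewrite : Mono α → Mono α → Prop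
  | assoc (w a b c) : Rewrite (.op w (.op w a b) c) (.op w a (.op w b c))
  | interchange (w a b c d) : Rewrite (.op w (.op w.swap a b) (.op w.swap c d))
      (.op w.swap (.op w a c) (.op w b d))
  | left (w s s₁ t) : Rewrite s s₁ → Rewrite (.op w s t) (.op w s₁ t)
  | right (w s t t₁) : Rewrite t t₁ → Rewrite (.op w s t) (.op w s t₁)

/-- A function on monomials that is invariant under rewriting vanishes on the consequences of
associativity and interchange. -/
theorem consequences_le_ker_lin {g : Mono α → F} (hg : ∀ s t, Rewrite s t → g s = g t) :
    consequences (assocInterchange F) α ≤ LinearMap.ker (lin g) := by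
  -- The span of the differences of monomials related by one rewriting is an ideal containing all
  -- instances of the defining identities, by multilinearity of the latter. A function invariant
  -- under rewriting kills it.
  set I : Submodule F (FreeAlg F α) :=
    Submodule.span F {p | ∃ s t, Rewrite s t ∧ p = monoBasis F α s - monoBasis F α t} with hI
  have hle : I ≤ LinearMap.ker (lin g) := by
    rw [hI, Submodule.span_le]
    rintro _ ⟨s, t, h, rfl⟩
    simp [hg s t h]
  refine le_trans (sInf_le ⟨?_, ?_⟩) hle
  · intro w a b ha
    induction ha using Submodule.span_induction with
    | zero => simp
    | add f g _ _ hf hg =>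
      simp only [map_add, LinearMap.add_apply]
      exact ⟨I.add_mem hf.1 hg.1, I.add_mem hf.2 hg.2⟩
    | smul c f _ hf =>
      simp only [map_smul, LinearMap.smul_apply]
      exact ⟨I.smul_mem c hf.1, I.smul_mem c hf.2⟩
    | mem x hx =>
      obtain ⟨s, s', h, rfl⟩ := hx
      induction b using freeAlg_induction with
      | zero => simp
      | add f g hf hg =>
        simp only [map_add, LinearMap.add_apply]
        exact ⟨I.add_mem hf.1 hg.1, I.add_mem hf.2 hg.2⟩
      | smul c f hf =>
        simp only [map_smul, LinearMap.smul_apply]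
        exact ⟨I.smul_mem c hf.1, I.smul_mem c hf.2⟩
      | mono t =>
        simp only [map_sub, LinearMap.sub_apply, freeMul_mono]
        exact ⟨Submodule.subset_span ⟨_, _, .left w s s' t h, rfl⟩,
          Submodule.subset_span ⟨_, _, .right w t s s' h, rfl⟩⟩
  · intro p hp v
    have hassoc (w : Op) (a b c : FreeAlg F α) :
        freeMul w (freeMul w a b) c - freeMul w a (freeMul w b c) ∈ I := by
      induction a using freeAlg_induction with
      | zero => simp
      | add f g hf hg =>
        simpa only [map_add, LinearMap.add_apply, add_sub_add_comm] using I.add_mem hf hg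
      | smul c f hf =>
        simpa only [map_smul, LinearMap.smul_apply, ← smul_sub] using I.smul_mem c hf
      | mono s =>
        induction b using freeAlg_induction with
        | zero => simp
        | add f g hf hg =>
          simpa only [map_add, LinearMap.add_apply, add_sub_add_comm] using I.add_mem hf hg
        | smul c f hf =>
          simpa only [map_smul, LinearMap.smul_apply, ← smul_sub] using I.smul_mem c hf
        | mono t =>
          induction c using freeAlg_induction with
          | zero => simp
          | add f g hf hg =>
            simpa only [map_add, LinearMap.add_apply, add_sub_add_comm] using I.add_mem hf hg
          | smul c f hf =>
            simpa only [map_smul, LinearMap.smul_apply, ← smul_sub] using I.smul_mem c hf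
          | mono r =>
            simp only [freeMul_mono]
            exact Submodule.subset_span ⟨_, _, .assoc w s t r, rfl⟩
    have hinter (a b c d : FreeAlg F α) :
        freeMul .bullet (freeMul .circ a b) (freeMul .circ c d) -
          freeMul .circ (freeMul .bullet a c) (freeMul .bullet b d) ∈ I := by
      induction a using freeAlg_induction with
      | zero => simp
      | add f g hf hg =>
        simpa only [map_add, LinearMap.add_apply, add_sub_add_comm] using I.add_mem hf hg
      | smul c f hf =>
        simpa only [map_smul, LinearMap.smul_apply, ← smul_sub] using I.smul_mem c hf
      | mono s =>
        induction b using freeAlg_induction with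
        | zero => simp
        | add f g hf hg =>
          simpa only [map_add, LinearMap.add_apply, add_sub_add_comm] using I.add_mem hf hg
        | smul c f hf =>
          simpa only [map_smul, LinearMap.smul_apply, ← smul_sub] using I.smul_mem c hf
        | mono t =>
          induction c using freeAlg_induction with
          | zero => simp
          | add f g hf hg =>
            simpa only [map_add, LinearMap.add_apply, add_sub_add_comm] using I.add_mem hf hg
          | smul c f hf =>
            simpa only [map_smul, LinearMap.smul_apply, ← smul_sub] using I.smul_mem c hf
          | mono r =>
            induction d using freeAlg_induction with
            | zero => simp
            | add f g hf hg =>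
              simpa only [map_add, LinearMap.add_apply, add_sub_add_comm] using I.add_mem hf hg
            | smul c f hf =>
              simpa only [map_smul, LinearMap.smul_apply, ← smul_sub] using I.smul_mem c hf
            | mono q =>
              simp only [freeMul_mono]
              exact Submodule.subset_span ⟨_, _, .interchange .bullet s t r q, rfl⟩
    simp only [assocInterchange, Set.mem_insert_iff, Set.mem_singleton_iff] at hp
    rcases hp with rfl | rfl | rfl
    · rw [eval_assoc]; exact hassoc _ _ _ _
    · rw [eval_assoc]; exact hassoc _ _ _ _
    · rw [eval_interchange]; exact hinter _ _ _ _

end Interchange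
end

noncomputable section

namespace Interchange

variable {F : Type*} [Field F] {α β : Type*}

/-! ### Computation of the interchange classes of normal forms -/

namespace Mono

/-- Boolean equality of monomials. -/
def beq [DecidableEq α] : Mono α → Mono α → Bool
  | .var x, .var y => decide (x = y)
  | .op w a b, .op w' a' b' => decide (w = w') && beq a a' && beq b b'
  | _, _ => false

theorem beq_iff [DecidableEq α] (s t : Mono α) : beq s t = true ↔ s = t := by
  induction s generalizing t with
  | var x => cases t <;> simp [beq]
  | op w a b ha hb => cases t <;> simp [beq, ha, hb, and_assoc]

instance [DecidableEq α] : DecidableEq (Mono α) := fun s t =>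
  decidable_of_iff _ (beq_iff s t)

/-- The number of indeterminates of a monomial, with multiplicities. -/
def size : Mono α → ℕ
  | .var _ => 1
  | .op _ s t => s.size + t.size

theorem size_pos (t : Mono α) : 0 < t.size := by
  induction t with
  | var x => simp [size]
  | op w s t hs ht => simp only [size]; omega

theorem size_app (w : Op) (s t : Mono α) : (app w s t).size = s.size + t.size := by
  induction s using app_induction (w := w) with
  | base s hs => rw [app_of_not_rooted hs, size]
  | step a b hb => rw [app_op, size, hb, size, add_assoc]

theorem size_norm (t : Mono α) : t.norm.size = t.size := by
  induction t with
  | var x => rfl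
  | op w s t hs ht => rw [norm, size_app, hs, ht, size]

theorem card_vars (t : Mono α) : t.vars.card = t.size := by
  induction t with
  | var x => rfl
  | op w s t hs ht => rw [vars, Multiset.card_add, hs, ht, size]

/-- The decompositions of a right-associated monomial as a product of two factors. -/
def splits (w : Op) : Mono α → List (Mono α × Mono α)
  | .var _ => []
  | .op w' a b => if w' = w then (a, b) :: (splits w b).map fun p => (.op w a p.1, p.2) else []

theorem mem_splits_app (w : Op) (s t : Mono α) : (s, t) ∈ splits w (app w s t) := by
  induction s using app_induction (w := w) with
  | base s hs => simp [app_of_not_rooted hs, splits]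
  | step a b hb =>
    simp only [app_op, splits, if_true, List.mem_cons, List.mem_map]
    exact Or.inr ⟨_, hb, rfl⟩

/-- The normal forms of the monomials that arise by one application of the interchange law.
The first argument bounds the depth. -/
def nbrs : ℕ → Mono α → List (Mono α)
  | 0, _ => []
  | _ + 1, .var _ => []
  | n + 1, .op w s t => (splits w (.op w s t)).flatMap fun p =>
      (nbrs n p.1).map (app w · p.2) ++ ((nbrs n p.2).map (app w p.1 ·) ++
        (splits w.swap p.1).flatMap fun a => (splits w.swap p.2).map fun c =>
          app w.swap (app w a.1 c.1) (app w a.2 c.2))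

theorem mem_nbrs_app {n : ℕ} {w : Op} {s t r : Mono α}
    (h : r ∈ (nbrs n s).map (app w · t) ++ ((nbrs n t).map (app w s ·) ++
        (splits w.swap s).flatMap fun a => (splits w.swap t).map fun c =>
          app w.swap (app w a.1 c.1) (app w a.2 c.2))) : r ∈ nbrs (n + 1) (app w s t) := by
  have hs := mem_splits_app w s t
  generalize hp : app w s t = p at hs ⊢
  cases p with
  | var x => simp [splits] at hs
  | op w' a b =>
    have hw : w = w' := by
      have := rooted_app w w' s t
      rw [hp] at this
      simpa using this.symm
    subst hw
    rw [nbrs, List.mem_flatMap]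
    exact ⟨_, hs, h⟩

theorem swap_swap (w : Op) : w.swap.swap = w := by cases w <;> rfl

theorem size_rewrite {s t : Mono α} (h : Rewrite s t) : s.size = t.size := by
  induction h with
  | assoc w a b c => simp only [size]; omega
  | interchange w a b c d => simp only [size]; omega
  | left w s s' t _ ih => simp only [size]; omega
  | right w s t t' _ ih => simp only [size]; omega

/-- Associativity disappears in normal forms, and an interchange at any place remains visible there
in both directions. Each passage to a proper factor removes at least one letter, so the number of
letters is enough depth for `nbrs`. -/
theorem norm_rewrite {s t : Mono α} (h : Rewrite s t) (n : ℕ) (hn : s.size ≤ n) :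
    s.norm = t.norm ∨ s.norm ∈ nbrs n t.norm ∧ t.norm ∈ nbrs n s.norm := by
  induction h generalizing n with
  | assoc w a b c => exact Or.inl (by simp [norm, app_assoc])
  | interchange w a b c d =>
    right
    obtain ⟨n, rfl⟩ : ∃ k, n = k + 1 := ⟨n - 1, by
      have := a.size_pos
      simp only [size] at hn; omega⟩
    simp only [norm]
    refine ⟨mem_nbrs_app ?_, mem_nbrs_app ?_⟩
    · simp only [List.mem_append, List.mem_flatMap, List.mem_map]
      refine Or.inr (Or.inr ⟨(a.norm, c.norm), ?_, (b.norm, d.norm), ?_, ?_⟩)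
      · rw [swap_swap]; exact mem_splits_app w _ _
      · rw [swap_swap]; exact mem_splits_app w _ _
      · rw [swap_swap]
    · simp only [List.mem_append, List.mem_flatMap, List.mem_map]
      exact Or.inr (Or.inr ⟨(a.norm, b.norm), mem_splits_app _ _ _,
        (c.norm, d.norm), mem_splits_app _ _ _, rfl⟩)
  | left w s s' t _ ih =>
    obtain ⟨n, rfl⟩ : ∃ k, n = k + 1 := ⟨n - 1, by
      have := s.size_pos
      simp only [size] at hn; omega⟩
    have ht := t.size_pos
    simp only [size] at hn
    rcases ih n (by omega) with h | ⟨h1, h2⟩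
    · exact Or.inl (by rw [norm, norm, h])
    · exact Or.inr ⟨mem_nbrs_app (List.mem_append_left _ (List.mem_map_of_mem h1)),
        mem_nbrs_app (List.mem_append_left _ (List.mem_map_of_mem h2))⟩
  | right w s t t' _ ih =>
    obtain ⟨n, rfl⟩ : ∃ k, n = k + 1 := ⟨n - 1, by
      have := s.size_pos
      simp only [size] at hn; omega⟩
    have hs := s.size_pos
    simp only [size] at hn
    rcases ih n (by omega) with h | ⟨h1, h2⟩
    · exact Or.inl (by rw [norm, norm, h])
    · exact Or.inr ⟨mem_nbrs_app (List.mem_append_right _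
          (List.mem_append_left _ (List.mem_map_of_mem h1))),
        mem_nbrs_app (List.mem_append_right _
          (List.mem_append_left _ (List.mem_map_of_mem h2)))⟩

/-- The list consists of different monomials of degree `6` and is closed under interchange. -/
def closed [DecidableEq α] (L : List (Mono α)) : Bool :=
  decide L.Nodup && L.all fun T => T.size == 6 && (nbrs 6 T).all fun S => decide (S ∈ L)

/-- Closure of a list of monomials under interchange: `new` are those whose neighbours are still
to be added. -/
def close [DecidableEq α] : ℕ → List (Mono α) → List (Mono α) → List (Mono α)
  | 0, L, _ => L
  | n + 1, L, new => match ((new.flatMap (nbrs 6)).filter fun T => decide (T ∉ L)).dedup with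
    | [] => L
    | T :: new' => close n (L ++ T :: new') (T :: new')

/-- The list `K` consists of the monomials that are equivalent to its head under interchange and
have the same parity of the number of `∘`. -/
def isParityClass [DecidableEq α] : List (Mono α) → Bool
  | [] => false
  | T :: K =>
    let L := close 5 [T] [T]
    -- The test `closed L` certifies that the five rounds of closure have found the whole class.
    closed L && (L.filter fun S => S.circCount % 2 == T.circCount % 2).isPerm (T :: K)

end Mono

open Mono

theorem expand_mem_span_isNormal (f : FreeAlg F α) :
    expand f ∈ Submodule.span F (monoBasis F α '' {T | T.isNormal = true}) := by
  induction f using freeAlg_induction with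
  | zero => simp
  | mono t =>
    exact expand_mem_span (F := F) (fun T _ => T.isNormal = true) (fun _ => rfl)
      (fun w s t S T hS hT => ⟨isNormal_app w hS hT, isNormal_app w hT hS⟩) t
  | add f g hf hg => rw [map_add]; exact Submodule.add_mem _ hf hg
  | smul c f hf => rw [map_smul]; exact Submodule.smul_mem _ c hf

/-- The function that tells whether the normal form of a monomial lies in `L` is invariant under
rewriting, so its linear extension vanishes on the expansion of an identity. -/
theorem coef_closed_sum [DecidableEq α] {L : List (Mono α)} (hL : closed L = true)
    {f : FreeAlg F α} (hf : IsBracketId f) : (L.map fun T => coef T f).sum = 0 := by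
  simp only [closed, Bool.and_eq_true, decide_eq_true_eq, List.all_eq_true, beq_iff_eq] at hL
  obtain ⟨hnd, hL⟩ := hL
  have hinv : ∀ s t : Mono α, Rewrite s t →
      (if s.norm ∈ L then (1 : F) else 0) = if t.norm ∈ L then 1 else 0 := by
    intro s t h
    have : s.norm ∈ L ↔ t.norm ∈ L := by
      by_cases hs : s.size = 6
      · rcases norm_rewrite h 6 hs.le with h | ⟨h1, h2⟩
        · rw [h]
        · exact ⟨fun h => (hL _ h).2 _ h2, fun h => (hL _ h).2 _ h1⟩
      · have ht : t.size ≠ 6 := size_rewrite h ▸ hs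
        exact iff_of_false (fun h => hs (by rw [← size_norm]; exact (hL _ h).1))
          (fun h => ht (by rw [← size_norm]; exact (hL _ h).1))
    simp only [this]
  have h0 := consequences_le_ker_lin hinv hf
  rw [LinearMap.mem_ker] at h0
  rw [← h0]
  -- both sides are linear in the expansion of `f`, which consists of normal monomials
  have key : ∀ p ∈ Submodule.span F (monoBasis F α '' {T | T.isNormal = true}),
      (L.map fun T => (monoBasis F α).repr p T).sum =
        lin (fun t => if t.norm ∈ L then (1 : F) else 0) p := by
    intro p hp
    induction hp using Submodule.span_induction with
    | zero => simp
    | add f g _ _ hf hg => simp [List.sum_map_add, hf, hg]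
    | smul c f _ hf => simp [List.sum_map_mul_left, hf]
    | mem x hx =>
      obtain ⟨T, hT, rfl⟩ := hx
      rw [lin_mono, norm_of_isNormal hT]
      simp only [Module.Basis.repr_self]
      clear hL h0 hinv
      induction L with
      | nil => simp
      | cons S L ih =>
        rw [List.nodup_cons] at hnd
        rw [List.map_cons, List.sum_cons, ih hnd.2, Finsupp.single_apply]
        by_cases h : T = S
        · subst h; simp [hnd.1]
        · simp [h]
  exact key _ (expand_mem_span_isNormal f)

/-- The projection to one parity is half the sum of the identity and a signed copy of the sign
change. This is how the sums for `f` and `signCirc f` yield the sum over one parity. -/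
theorem List.sum_map_filter_parity (L : List (Mono α)) (c : Mono α → F) (k : ℕ) :
    2 * ((L.filter fun S => S.circCount % 2 == k % 2).map c).sum =
      (L.map c).sum + (-1) ^ k * (L.map fun S => (-1) ^ S.circCount * c S).sum := by
  induction L with
  | nil => simp
  | cons S L ih =>
    rw [List.filter_cons, List.map_cons, List.map_cons, List.sum_cons, List.sum_cons]
    have hk : (-1 : F) ^ k * (-1) ^ S.circCount = if S.circCount % 2 == k % 2 then 1 else -1 := by
      rw [← pow_add]
      rcases Nat.mod_two_eq_zero_or_one k with h | h <;>
        rcases Nat.mod_two_eq_zero_or_one S.circCount with h' | h' <;> rw [h, h']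
      · exact (Even.neg_one_pow (by rw [Nat.even_iff]; omega)).trans (by simp)
      · exact (Odd.neg_one_pow (by rw [Nat.odd_iff]; omega)).trans (by simp)
      · exact (Odd.neg_one_pow (by rw [Nat.odd_iff]; omega)).trans (by simp)
      · exact (Even.neg_one_pow (by rw [Nat.even_iff]; omega)).trans (by simp)
    rw [mul_add, ← mul_assoc, hk]
    split
    · rw [List.map_cons, List.sum_cons, mul_add, ih]; ring
    · rw [ih]; ring

theorem coef_rename_perm {n : ℕ} (g : Equiv.Perm (Fin n)) (T : Mono (Fin n))
    (f : FreeAlg F (Fin n)) : coef (T.rename g) f = coef T (rename g.symm f) := by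
  rw [← coef_rename g.symm.injective, Mono.rename_rename]
  congr 1
  rw [show g.symm ∘ g = id from funext fun x => g.symm_apply_apply x, Mono.rename_id]

/-- A monomial in which a letter is missing does not occur in a multilinear expansion. Thanks to
this the later relations hold for arbitrary, possibly repeated, letters. -/
theorem coef_rename_of_not_bijective {n : ℕ} {g : Fin n → Fin n} (hg : ¬ Function.Bijective g)
    (T : Mono (Fin n)) {f : FreeAlg F (Fin n)} (hf : f ∈ multilinear F n) :
    coef (T.rename g) f = 0 := by
  refine coef_eq_zero_of_vars_ne (fun h => hg ?_) hf
  rw [← Finite.surjective_iff_bijective]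
  intro x
  have : x ∈ (T.rename g).vars := by rw [h]; exact Finset.mem_univ x
  rw [vars_rename, Multiset.mem_map] at this
  exact ⟨_, this.choose_spec.2⟩

/-- The coefficients of an identity over the monomials of a parity class add up to zero. -/
theorem coef_parity_sum [CharZero F] {K : List (Mono (Fin 6))} (hK : isParityClass K = true)
    {f : FreeAlg F (Fin 6)} (hf : f ∈ allIds F 6) (g : Fin 6 → Fin 6) :
    (K.map fun T => coef (T.rename g) f).sum = 0 := by
  by_cases hg : Function.Bijective g
  · have hr : ∀ T : Mono (Fin 6), coef (T.rename g) f =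
        coef T (rename (Equiv.ofBijective g hg).symm f) :=
      fun T => coef_rename_perm (Equiv.ofBijective g hg) T f
    simp only [hr]
    have hf' := rename_mem_allIds (Equiv.ofBijective g hg).symm hf
    generalize rename (Equiv.ofBijective g hg).symm f = f' at hf'
    cases K with
    | nil => simp [isParityClass] at hK
    | cons T K =>
      simp only [isParityClass, Bool.and_eq_true, List.isPerm_iff] at hK
      rw [← (hK.2.map _).sum_eq]
      -- The full class sum vanishes for `f'` and for its sign change; half of a signed sum of the
      -- two is the sum over the parity of `T`.
      have h1 := coef_closed_sum hK.1 ((mem_allIds_iff _).mp hf').2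
      have h2 := coef_closed_sum hK.1 ((mem_allIds_iff _).mp (signCirc_mem_allIds hf')).2
      simp only [coef_signCirc] at h2
      have h3 := List.sum_map_filter_parity (close 5 [T] [T]) (fun S => coef S f') T.circCount
      rw [h1, h2, mul_zero, add_zero] at h3
      exact (mul_eq_zero.mp h3).resolve_left two_ne_zero
  · refine List.sum_eq_zero fun x hx => ?_
    obtain ⟨T, -, rfl⟩ := List.mem_map.mp hx
    exact coef_rename_of_not_bijective hg T ((mem_allIds_iff _).mp hf).1

namespace Mono

/-! ### Enumeration of the monomials of degree six -/

/-- The monomials obtained by reversing products with two or three factors; none if there is a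
product with more factors. -/
def variants : Mono α → List (Mono α)
  | .var x => [.var x]
  | .op w a (.op w' b c) =>
    if w' = w then
      if c.rooted w then [] else
        (variants a).flatMap fun x => (variants b).flatMap fun y => (variants c).flatMap fun z =>
          [.op w x (.op w y z), .op w z (.op w y x)]
    else (variants a).flatMap fun x => (variants (.op w' b c)).flatMap fun y =>
      [.op w x y, .op w y x]
  | .op w a (.var y) => (variants a).flatMap fun x => [.op w x (.var y), .op w (.var y) x]

/-- The list of indeterminates of a monomial, from left to right. -/
def leaves : Mono α → List α
  | .var x => [x]
  | .op _ s t => s.leaves ++ t.leaves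

theorem length_leaves (t : Mono α) : t.leaves.length = t.size := by
  induction t with
  | var x => rfl
  | op w s t hs ht => simp [leaves, size, hs, ht]

/-- The monomial with its indeterminates replaced by `k, k + 1, …`, from left to right. -/
def standard (k : ℕ) : Mono α → Mono (Fin 6)
  | .var _ => .var (Fin.ofNat 6 k)
  | .op w s t => .op w (s.standard k) (t.standard (k + s.size))

/-- All monomials of degree `n` in the indeterminates `k, k + 1, …`, in this order. -/
def standards : ℕ → ℕ → ℕ → List (Mono (Fin 6))
  | 0, _, _ => []
  | m + 1, n, k => if n = 1 then [.var (Fin.ofNat 6 k)] else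
      (List.range (n - 1)).flatMap fun i => (standards m (i + 1) k).flatMap fun s =>
        (standards m (n - 1 - i) (k + (i + 1))).flatMap fun t =>
          [.op .circ s t, .op .bullet s t]

theorem standard_mem (t : Mono α) (m k : ℕ) (hm : t.size ≤ m) :
    t.standard k ∈ standards m t.size k := by
  induction t generalizing m k with
  | var x =>
    obtain ⟨m, rfl⟩ : ∃ j, m = j + 1 := ⟨m - 1, by simp only [size] at hm; omega⟩
    simp [standards, size, standard]
  | op w s t hs ht =>
    have h1 := s.size_pos
    have h2 := t.size_pos
    simp only [size] at hm
    obtain ⟨m, rfl⟩ : ∃ j, m = j + 1 := ⟨m - 1, by omega⟩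
    rw [standards, if_neg (by simp only [size]; omega), List.mem_flatMap]
    refine ⟨s.size - 1, by simp only [size, List.mem_range]; omega, ?_⟩
    have e1 : s.size - 1 + 1 = s.size := by omega
    have e2 : (op w s t).size - 1 - (s.size - 1) = t.size := by simp only [size]; omega
    rw [e1, e2, List.mem_flatMap]
    refine ⟨_, hs m k (by omega), ?_⟩
    rw [List.mem_flatMap]
    refine ⟨_, ht m (k + s.size) (by omega), ?_⟩
    cases w <;> simp [standard]

theorem rename_standard (t : Mono (Fin 6)) (k : ℕ) (g : Fin 6 → Fin 6)
    (hg : ∀ i < t.size, g (Fin.ofNat 6 (k + i)) = t.leaves.getD i 0) :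
    (t.standard k).rename g = t := by
  induction t generalizing k with
  | var x => simpa [standard, rename, leaves, size] using hg 0
  | op w s t hs ht =>
    simp only [size, leaves] at hg
    rw [standard, rename, hs k, ht (k + s.size)]
    · intro i hi
      rw [add_assoc, hg (s.size + i) (by omega), List.getD_append_right _ _ _ _
        (by rw [length_leaves]; omega), length_leaves, Nat.add_sub_cancel_left]
    · intro i hi
      rw [hg i (by omega), List.getD_append _ _ _ _ (by rw [length_leaves]; omega)]

theorem rooted_standard (t : Mono α) (k : ℕ) (w : Op) :
    (t.standard k).rooted w = t.rooted w := by
  cases t <;> rfl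

theorem isNormal_standard (t : Mono α) (k : ℕ) : (t.standard k).isNormal = t.isNormal := by
  induction t generalizing k with
  | var x => rfl
  | op w s t hs ht => simp only [standard, isNormal, hs, ht, rooted_standard]

theorem rooted_of_mem_variants {s t : Mono α} (h : s ∈ t.variants) (w : Op) :
    s.rooted w = t.rooted w := by
  cases t with
  | var x => simp only [variants, List.mem_singleton] at h; rw [h]
  | op w' a b =>
    cases b with
    | var y =>
      simp only [variants, List.mem_flatMap, List.mem_cons, List.not_mem_nil, or_false] at h
      obtain ⟨x, -, rfl | rfl⟩ := h <;> rfl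
    | op w'' b c =>
      rw [variants] at h
      split at h
      · split at h
        · simp at h
        · simp only [List.mem_flatMap, List.mem_cons, List.not_mem_nil, or_false] at h
          obtain ⟨x, -, y, -, z, -, rfl | rfl⟩ := h <;> rfl
      · simp only [List.mem_flatMap, List.mem_cons, List.not_mem_nil, or_false] at h
        obtain ⟨x, -, y, -, rfl | rfl⟩ := h <;> rfl

end Mono

/-- Each reversal of a product multiplies the coefficients by `-1` for two factors and by `1` for
three, at every level of the monomial. -/
theorem coefMono_of_mem_variants {s t : Mono α} (h : s ∈ t.variants) (ht : t.isNormal = true) :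
    (coefMono s : Mono α → F) = coefMono t ∨ (coefMono s : Mono α → F) = -coefMono t := by
  induction t using variants.induct generalizing s with
  | case1 x => simp only [variants, List.mem_singleton] at h; exact Or.inl (by rw [h])
  | case2 a w b c hc => simp [variants, hc] at h
  | case3 a w b c hc ihc ihb iha =>
    rw [Bool.not_eq_true] at hc
    simp only [isNormal, Bool.and_eq_true, Bool.not_eq_true'] at ht
    simp only [variants, hc, if_true, Bool.false_eq_true, if_false, List.mem_flatMap,
      List.mem_cons, List.not_mem_nil, or_false] at h
    obtain ⟨x, hx, y, hy, z, hz, h⟩ := h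
    have rx := (rooted_of_mem_variants hx w).trans ht.1.1
    have ry := (rooted_of_mem_variants hy w).trans ht.2.1.1
    have rz := (rooted_of_mem_variants hz w).trans hc
    have : (coefMono s : Mono α → F) = triple w (coefMono x) (coefMono y) (coefMono z) := by
      rcases h with rfl | rfl
      · exact coefMono_op_op rx ry rz
      · rw [coefMono_op_op rz ry rx, triple_reverse]
    rw [this, coefMono_op_op ht.1.1 ht.2.1.1 hc]
    rcases iha hx ht.1.2 with e1 | e1 <;> rcases ihb hy ht.2.1.2 with e2 | e2 <;>
      rcases ihc hz ht.2.2 with e3 | e3 <;> simp [e1, e2, e3]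
  | case4 w a w' b c hw ihb iha =>
    rw [isNormal] at ht
    simp only [Bool.and_eq_true, Bool.not_eq_true'] at ht
    rw [variants, if_neg hw] at h
    simp only [List.mem_flatMap, List.mem_cons, List.not_mem_nil, or_false] at h
    obtain ⟨x, hx, y, hy, h⟩ := h
    have hb : (op w' b c).rooted w = false := by simp [hw]
    have rx := (rooted_of_mem_variants hx w).trans ht.1.1
    have ry := (rooted_of_mem_variants hy w).trans hb
    rw [coefMono_op ht.1.1 hb]
    rcases iha hx ht.1.2 with e1 | e1 <;> rcases ihb hy ht.2 with e2 | e2 <;>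
      rcases h with rfl | rfl <;>
      simp [coefMono_op rx ry, coefMono_op ry rx, e1, e2,
        pair_swap w (coefMono a) (coefMono (op w' b c))]
  | case5 w a y iha =>
    simp only [isNormal, Bool.and_eq_true, Bool.not_eq_true'] at ht
    simp only [variants, List.mem_flatMap, List.mem_cons, List.not_mem_nil, or_false] at h
    obtain ⟨x, hx, h⟩ := h
    have hb : (var y : Mono α).rooted w = false := rfl
    have rx := (rooted_of_mem_variants hx w).trans ht.1.1
    rw [coefMono_op ht.1.1 hb]
    rcases iha hx ht.1.2 with e1 | e1 <;> rcases h with rfl | rfl <;>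
      simp [coefMono_op rx hb, coefMono_op hb rx, e1, pair_swap w (coefMono a) (coefMono (var y))]

namespace Mono

/-- The monomials to which the others can be reduced. -/
def representatives (u : Op) : List (Mono (Fin 6)) :=
  let w := u.swap
  [op u (var 0) (op w (op u (var 1) (op w (var 2) (var 3))) (op u (var 4) (var 5))),
   op u (op w (var 0) (op u (var 1) (var 2))) (op u (op w (var 3) (var 4)) (var 5)),
   op u (op w (var 0) (var 1)) (op u (op w (var 2) (op u (var 3) (var 4))) (var 5)),
   op u (op w (var 0) (var 1)) (op u (op w (var 2) (var 3)) (op w (var 4) (var 5))),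
   op w (op u (var 0) (op u (var 1) (var 2))) (op u (var 3) (op u (var 4) (var 5))),
   op u (op w (var 0) (op u (var 1) (var 2))) (op w (var 3) (op u (var 4) (var 5))),
   op u (op w (op u (var 0) (var 1)) (op u (var 2) (var 3))) (op w (var 4) (var 5)),
   op u (op w (var 0) (var 1)) (op w (var 2) (op u (var 3) (op u (var 4) (var 5)))),
   op w (op u (var 0) (var 1)) (op u (var 2) (op u (var 3) (op w (var 4) (var 5)))),
   op w (op u (var 0) (op w (var 1) (var 2))) (op u (var 3) (op u (var 4) (var 5))),
   op w (op u (var 0) (var 1)) (op u (var 2) (op w (var 3) (op u (var 4) (var 5))))]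

/-- The monomial is alone in its parity class, or is a variant of a representative. -/
def covered (s : Mono (Fin 6)) : Bool :=
  isParityClass [s] || s.variants.any fun T =>
    (representatives .circ ++ representatives .bullet).any fun r =>
      beq T (r.rename fun i : Fin 6 => T.leaves.getD i 0)

/-- A finite check of the `42 * 32` monomials of degree six with letters in increasing order: 42
bracketings and two operations at each of five nodes. Those not in normal form are exempt, as they
have no coefficients. -/
theorem covered_standards :
    ((standards 6 6 0).all fun s => !s.isNormal || covered s) = true := by
  decide +kernel

end Mono

/-- An identity of degree `6` vanishes under expansion if its coefficients at the representatives
do, for all choices of indeterminates. -/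
theorem expand_eq_zero_of_representatives [CharZero F] {f : FreeAlg F (Fin 6)}
    (hf : f ∈ allIds F 6)
    (h : ∀ u, ∀ r ∈ representatives u, ∀ g : Fin 6 → Fin 6, coef (r.rename g) f = 0) :
    expand f = 0 := by
  have key : ∀ s : Mono (Fin 6), s.isNormal = true → covered s = true →
      ∀ f' ∈ allIds F 6, (∀ u, ∀ r ∈ representatives u, ∀ g : Fin 6 → Fin 6,
        coef (r.rename g) f' = 0) → coef s f' = 0 := by
    intro s hn hs f' hf' h'
    rw [covered, Bool.or_eq_true] at hs
    rcases hs with hs | hs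
    -- The sum over a parity class with one member is the coefficient itself.
    · simpa [Mono.rename_id] using coef_parity_sum hs hf' id
    · obtain ⟨T, hT, hr⟩ := List.any_eq_true.mp hs
      obtain ⟨r, hr, e⟩ := List.any_eq_true.mp hr
      rw [beq_iff] at e
      have h0 : coef T f' = 0 := by
        rw [e]
        rcases List.mem_append.mp hr with hr | hr
        · exact h' .circ r hr _
        · exact h' .bullet r hr _
      rw [coef_eq_lin] at h0 ⊢
      rcases coefMono_of_mem_variants (F := F) hT hn with e | e
      · rwa [e] at h0
      · rwa [e, lin_neg, neg_eq_zero] at h0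
  rw [expand_eq_zero_iff]
  intro T
  by_cases hv : T.vars = (Finset.univ : Finset (Fin 6)).val
  · by_cases hn : T.isNormal = true
    · have hsize : T.size = 6 := by rw [← card_vars, hv]; rfl
      -- The monomial has six leaves, so the default value is never taken.
      set g : Fin 6 → Fin 6 := fun i => T.leaves.getD i 0 with hg
      have hT : (T.standard 0).rename g = T := by
        refine rename_standard T 0 g fun i hi => ?_
        rw [hg]
        simp [Nat.mod_eq_of_lt (hsize ▸ hi)]
      have hcov : covered (T.standard 0) = true := by
        have := List.all_eq_true.mp covered_standards _
          (hsize ▸ standard_mem T 6 0 hsize.le)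
        rwa [isNormal_standard, hn, Bool.not_true, Bool.false_or] at this
      rw [← hT]
      by_cases hb : Function.Bijective g
      · have hr : ∀ S : Mono (Fin 6), coef (S.rename g) f =
            coef S (rename (Equiv.ofBijective g hb).symm f) :=
          fun S => coef_rename_perm (Equiv.ofBijective g hb) S f
        rw [hr]
        refine key _ (by rw [isNormal_standard, hn]) hcov _ (rename_mem_allIds _ hf) ?_
        intro u r hr' g'
        rw [← hr, Mono.rename_rename]
        exact h u r hr' _
      · exact coef_rename_of_not_bijective hb _ ((mem_allIds_iff _).mp hf).1
    · exact coef_eq_zero_of_not_isNormal (by simpa using hn) f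
  · exact coef_eq_zero_of_vars_ne hv ((mem_allIds_iff _).mp hf).1

end Interchange
end

noncomputable section

namespace Interchange

variable {F : Type*} [Field F] {α β : Type*}

/-! ### Functions of several letters with symmetries

Each of the following lemmas is about functions that satisfy a few linear relations for all values
of their arguments. -/

section Letters

/-- Each hypothesis says that a permutation of the places acts on `R` by a sign. The cube of the
permutation in `h3` is the transposition of the first and third places, which thus acts trivially.
It is conjugate to the transposition in `h1` within the group they generate, so that one also acts
trivially and `R = -R`. -/
theorem eq_zero_of_five_letters [CharZero F] {R : α → α → α → α → α → F}
    (h1 : ∀ a b c d e, R b a c d e = -R a b c d e)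
    (h2 : ∀ a b c d e, R a b c e d = -R a b c d e)
    (h3 : ∀ a b c d e, R c e a b d = R a b c d e) (a b c d e : α) : R a b c d e = 0 := by
  linear_combination 1/2 * h3 b e d a c - 1/2 * h1 c d b e a + 1/2 * h2 c d b a e - 1/2 * h3
    b a c e d - 1/2 * h1 a b c e d + h2 a b c d e - 1/2 * h3 e b d c a + 1/2 * h1 a d e b c
    - 1/2 * h1 b e d c a + 1/2 * h2 b e d a c + 1/2 * h3 a d e b c - 1/2 * h1 c e a d b -
    1/2 * h3 c e a d b

/-- Two transpositions with a common place are conjugate in the group they generate, but one acts on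
`S` by `1` and the other by `-1`. -/
theorem eq_zero_of_column_swap [CharZero F] {S : α → α → α → α → α → α → F}
    (hS1 : ∀ a b c d e f, S c b a d e f = S a b c d e f)
    (hN : ∀ a b c d e f, S a b c d e f + S d b c a e f = 0) (a b c d e f : α) :
    S a b c d e f = 0 := by
  linear_combination 1/2 * hN c b a d e f - 1/2 * hS1 a b c d e f - 1/2 * hS1 a b d c e f +
    1/2 * hN d b c a e f - 1/2 * hS1 c b d a e f - 1/2 * hN a b d c e f

section

variable {U Y W : α → α → α → α → α → α → F}

theorem eq_zero_of_pair_triple [CharZero F]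
    (hU2 : ∀ a b c d e f, U a b c d f e = -U a b c d e f)
    (hU3 : ∀ a b c d e f, U d e f a b c = -U a b c d e f)
    (hY1 : ∀ a b c d e f, Y b a c d e f = -Y a b c d e f)
    (hY2 : ∀ a b c d e f, Y a b c f e d = Y a b c d e f)
    (hY3 : ∀ a b c d e f, Y a b c d e f + Y a b c e d f + Y a b c e f d = 0)
    (h2 : ∀ a b c d e f, U a b d c e f + Y a b c d e f - Y c f a b d e = 0)
    (a b c e d f : α) : Y a b c e d f = 0 := by
  -- Two instances of `h2` contain the same value of `U` up to its symmetries. Eliminating it leaves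
  -- a relation in `Y` alone; instances of that relation, with the symmetries of `Y`, then add up to
  -- `Y`.
  have hM (a b c e d f : α) : Y a b c e d f + Y c f a b d e + Y c e a b d f = 0 := by
    linear_combination h2 c e a f d b - hU2 c e f a b d + hU3 a b d c e f - hY2 c e a b d f -
      h2 a b c d e f + hY3 a b c e f d - hY2 a b c d e f - hY2 a b c e d f
  linear_combination 1/2 * hM c e a b d f - 1/2 * hY2 a f c b d e - 1/2 * hM a f c b d e +
    1/2 * hY2 c e a b d f + 1/2 * hY1 b c a f d e - 1/2 * hM a f b c d e - 1/2 * hM c f b a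
    d e + 1/2 * hY1 a b c f d e - 1/2 * hY2 a b c e d f + 1/2 * hM b e c f d a - 1/2 * hY1 a
    c b e d f - 1/2 * hY2 c f b a d e + 1/2 * hM b e a f d c - 1/2 * hY2 a f b c d e

/-- All hypotheses say that a permutation of the places acts by a sign. Conjugates of the
transpositions under the two 3-cycles of `h1` generate the full symmetric group, so it would act by
the sign character. By `hW4`, however, an even permutation acts by `-1`. -/
theorem eq_zero_of_three_pairs [CharZero F]
    (hW1 : ∀ a b c d e f, W b a c d e f = -W a b c d e f)
    (hW2 : ∀ a b c d e f, W a b d c e f = -W a b c d e f)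
    (hW3 : ∀ a b c d e f, W a b c d f e = -W a b c d e f)
    (hW4 : ∀ a b c d e f, W c d a b e f = -W a b c d e f)
    (h1 : ∀ a b c d e f, W a c b d e f - W c e d f a b = 0) (a b c d e f : α) :
    W a b c d e f = 0 := by
  linear_combination -h1 c b d a f e + hW2 c d a b f e - hW3 c d a b e f + hW4 a b c d e f -
    hW3 d f a e b c + hW4 a e d f b c - 1/2 * h1 e d a f c b + 1/2 * hW1 a e d f c b - 1/2 *
    hW3 a e d f b c - 1/2 * hW2 a c b f e d + 1/2 * hW3 a c b f d e - 1/2 * h1 b c e d a f -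
    1/2 * hW1 a e d f b c + 1/2 * h1 a f c b d e - 1/2 * hW2 a c b f d e + 1/2 * hW4 b e c d
    a f

end

variable {A B D : α → α → α → α → α → α → F}

/-- The exchange of the pairs `x, y` and `z, u` conjugates the transposition of the first pair into
that of the second. -/
theorem antisymm_of_exchange
    (hD1 : ∀ x y z u v w, D y x z u v w = -D x y z u v w)
    (h2 : ∀ x y z u v w, D x y z u v w + D z u x y v w = 0)
    (x y z u v w : α) : D x y u z v w = -D x y z u v w := by
  linear_combination h2 x y u z v w + h2 x y z u v w - hD1 z u x y v w

theorem antisymm_first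
    (hA1 : ∀ x y z v u w, A y x z v u w = -A x y z v u w)
    (hD1 : ∀ x y z u v w, D y x z u v w = -D x y z u v w)
    (h1 : ∀ x y z u v w, D x y z u v w + A x y z v u w + B x y u z v w = 0)
    (x y u z v w : α) : B y x u z v w = -B x y u z v w := by
  linear_combination h1 x y z u v w + h1 y x z u v w - hA1 x y z v u w - hD1 x y z u v w

/-- The auxiliary relations `hG` and `hJ` involve `B` only: `A` and `D` have been eliminated from
instances of `h1` and `h2` by their antisymmetries. The claim is then a combination of `hG`, `hJ`
and the reversal and shuffle relations of `B`. -/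
theorem antisymm_mid [CharZero F]
    (hA1 : ∀ x y z v u w, A y x z v u w = -A x y z v u w)
    (hA2 : ∀ x y z v u w, A x y v z u w = -A x y z v u w)
    (hA3 : ∀ x y z v u w, A x y z v w u = -A x y z v u w)
    (hD1 : ∀ x y z u v w, D y x z u v w = -D x y z u v w)
    (hD2 : ∀ x y z u v w, D x y z u w v = -D x y z u v w)
    (hB1 : ∀ x y u z v w, B x u y z v w = -B x y u z v w)
    (hB3 : ∀ x y u z v w, B x y u w v z = B x y u z v w)
    (hB4 : ∀ x y u z v w, B x y u z v w + B x y u v z w + B x y u v w z = 0)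
    (h1 : ∀ x y z u v w, D x y z u v w + A x y z v u w + B x y u z v w = 0)
    (h2 : ∀ x y z u v w, D x y z u v w + D z u x y v w = 0)
    (y u v z w x : α) : B y u w z v x = -B y u v z w x := by
  have hB2 := antisymm_first hA1 hD1 h1
  have hD3 := antisymm_of_exchange hD1 h2
  have hG (x y z u v w : α) : B x y u z v w + B x y w z v u + B x y z w v u = 0 := by
    linear_combination hB4 x y w v z u - hB1 x w y v z u + hB3 x w y u z v - h1 x y u w z v +
      hD2 x y u w v z + hB1 x w y u z v - h1 y x w z v u + hD1 x y w z v u - hD2 x y w z u v +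
      hA1 x y w v z u - hA2 x y v w z u + hA3 x y v w u z + hB3 y x z u v w + hB2 x y z u v w
      - h1 y x w u v z + hD1 x y w u v z - hD3 x y u w v z + hA1 x y w v u z - hA2 x y v w u z
      + hB1 y u x w v z - hB2 u y x w v z + hB1 u x y w v z - h1 x y z w u v + hD3 x y w z u v
      + hA2 x y u z w v + hB1 x u y z v w - hB3 x u y w v z - hB2 u x y w v z + hB3 x y z u v
      w
  have hJ (x y z u v w : α) :
      B y u v z w x + B y u w z v x + B y u x v z w + B y u z v x w = 0 := by
    linear_combination hB4 y u x z w v - hB3 y u x v w z - hB3 y u x v z w + h2 u w y x v z -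
      hD3 u w x y v z - hD1 x y u w v z + h1 y x w u v z - hD1 x y w u v z + hD3 x y u w v z -
      hA1 x y w v u z + hA2 x y v w u z - hB1 y u x w v z + h1 y x v u w z - hD1 x y v u w z +
      hD3 x y u v w z - hA1 x y v w u z - hB1 y u x v w z + h2 u v y x w z - hD3 u v x y w z -
      hD1 x y u v w z + h1 v u x y z w - hD1 u v x y z w + hD2 u v x y w z - hA1 u v x z y w -
      hB3 v u y w z x - hB2 u v y w z x + h1 v u z y x w - hA1 u v z x y w + hA2 u v x z y w -
      hB3 v u y w x z - hB2 u v y w x z - h2 z y v u x w + hD1 y z v u x w - hD2 y z v u w x +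
      hB4 y u v z w x - hB2 u y v w z x + hB1 u v y w z x - hB2 u y v w x z + hB1 u v y w x z
      - h2 w u z y x v + hD1 u w z y x v + hD1 y z w u x v - hD2 y z w u v x - hB4 y z u x w v
      + hB1 y u z x w v - hB3 y u z v w x + hB1 y u z w x v - hB3 y u z v x w + hB1 y u z w v
      x - hB2 u y z w v x - h1 z y w u v x + hD1 y z w u v x + hA1 y z w v u x - hA2 y z v w u
      x + hB1 z u y w v x - hB2 u z y w v x + hB1 u y z w v x + h1 y z v u w x - hB1 y u z v w
      x + h1 w u x y z v - hD1 u w x y z v + hD2 u w x y v z - hA1 u w x z y v - hB3 w u y v z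
      x - hB4 w u y x v z + hB2 u w y x v z + hB2 u w y v x z - h1 u w z y x v + hA2 u w x z y
      v + hB3 u w y v x z + hB3 y u w x v z + hB2 u y w x v z - hB1 u w y x v z
  linear_combination -1/2 * hB4 y u z v x w + 1/2 * hB3 y u z w v x + 1/2 * hB3 y u z v w x
    + 1/2 * hJ z y x u v w - 1/2 * hB4 y u x w v z + 1/2 * hG y u z x v w - 1/2 * hB3 y u x
    w v z + 1/2 * hB3 y u w x v z + 1/2 * hG y u z x w v - 1/2 * hB3 y u x v w z + 1/2 * hB3
    y u v x w z

/-- Without `B`, `A` is `-D` up to an exchange of two places, so the antisymmetries of `A` become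
antisymmetries of `D`. Together with those of `D` they make `D` transform by the sign character of
all six places. The exchange of two pairs in `h2` is an even permutation but acts by `-1`. -/
theorem eq_zero_of_B_eq_zero [CharZero F]
    (hA1 : ∀ x y z v u w, A y x z v u w = -A x y z v u w)
    (hA2 : ∀ x y z v u w, A x y v z u w = -A x y z v u w)
    (hA3 : ∀ x y z v u w, A x y z v w u = -A x y z v u w)
    (hD1 : ∀ x y z u v w, D y x z u v w = -D x y z u v w)
    (hD2 : ∀ x y z u v w, D x y z u w v = -D x y z u v w)
    (h1 : ∀ x y z u v w, D x y z u v w + A x y z v u w + B x y u z v w = 0)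
    (h2 : ∀ x y z u v w, D x y z u v w + D z u x y v w = 0)
    (hB : ∀ x y u z v w, B x y u z v w = 0)
    (x y z u v w : α) : D x y z u v w = 0 := by
  have hD3 := antisymm_of_exchange hD1 h2
  have h1 (x y z u v w : α) : D x y z u v w + A x y z v u w = 0 := by
    linear_combination h1 x y z u v w - hB x y u z v w
  linear_combination 1/2 * h1 u z y x w v - 1/2 * hD2 u z y x v w + 1/2 * hD3 u z x y v w -
    1/2 * hA2 u z w y x v + 1/2 * hA3 u z w y v x + 1/2 * h2 x y z u v w + 1/2 * hD3 x y u z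
    v w - 1/2 * hD1 u z x y v w + 1/2 * h1 z u w v y x - 1/2 * hD1 u z w v y x + 1/2 * hD2 u
    z w v x y - 1/2 * hD3 u z v w x y - 1/2 * hA1 u z w y v x + 1/2 * h2 v w z u y x - 1/2 *
    hD1 u z v w y x + 1/2 * hD2 u z v w x y + 1/2 * h1 w v z u y x - 1/2 * hD1 v w z u y x -
    1/2 * hA1 v w z y u x + 1/2 * hA2 v w y z u x - 1/2 * h1 w v y x z u + 1/2 * hD1 v w y x
    z u - 1/2 * hD2 v w y x u z + 1/2 * hD3 v w x y u z + 1/2 * hA1 v w y z x u - 1/2 * hA3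
    v w y z u x - 1/2 * h2 x y v w u z - 1/2 * h1 y x u z w v + 1/2 * hD1 x y u z w v - 1/2
    * hD2 x y u z v w + 1/2 * hA1 x y u w z v - 1/2 * hA3 x y u w v z - 1/2 * h1 x y w v u z
    + 1/2 * hD3 x y v w u z + 1/2 * hA2 x y u w v z

end Letters

end Interchange
end

noncomputable section

namespace Interchange

variable {F : Type*} [Field F]

open Mono

/-! ### The coefficients of the identities of degree six -/

/-! ### Coefficients at monomials whose products have two or three factors -/

section Functionals

variable {α : Type*}

/-- The monomial is normal and has only products of two or three factors. -/
def Mono.isShort : Mono α → Bool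
  | .var _ => true
  | .op w a (.op w' b c) =>
    if w' = w then
      !a.rooted w && a.isShort && (!b.rooted w && b.isShort && (!c.rooted w && c.isShort))
    else !a.rooted w && a.isShort && (op w' b c).isShort
  | .op w a (.var _) => !a.rooted w && a.isShort

/-- The coefficients of a monomial in expansions, in terms of those of its factors. -/
def functional : Mono α → Mono α → F
  | .var x => coefMono (var x)
  | .op w a (.op w' b c) =>
    if w' = w then triple w (functional a) (functional b) (functional c)
    else pair w (functional a) (functional (op w' b c))
  | .op w a (.var y) => pair w (functional a) (coefMono (var y))

theorem coefMono_eq_functional {t : Mono α} (h : t.isShort = true) :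
    coefMono t = (functional t : Mono α → F) := by
  induction t using isShort.induct with
  | case1 x => rfl
  | case2 w a b c iha ihb ihc =>
    simp only [isShort, if_true, Bool.and_eq_true, Bool.not_eq_true'] at h
    rw [functional, if_pos rfl, ← iha h.1.2, ← ihb h.2.1.2, ← ihc h.2.2.2,
      coefMono_op_op h.1.1 h.2.1.1 h.2.2.1]
  | case3 w a w' b c hw iha ihb =>
    rw [isShort, if_neg hw, Bool.and_eq_true, Bool.and_eq_true, Bool.not_eq_true'] at h
    rw [functional, if_neg hw, ← iha h.1.2, ← ihb h.2, coefMono_op h.1.1 (by simp [hw])]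
  | case4 w a y iha =>
    simp only [isShort, Bool.and_eq_true, Bool.not_eq_true'] at h
    rw [functional, ← iha h.2, coefMono_op h.1 rfl]

theorem coef_eq_functional {t : Mono α} (h : t.isShort = true) (p : FreeAlg F α) :
    coef t p = lin (functional t) p := by
  rw [coef_eq_lin, coefMono_eq_functional h]

theorem coef_op_swap {w : Op} {s t : Mono α} (hs : s.rooted w = false) (ht : t.rooted w = false)
    (p : FreeAlg F α) : coef (op w s t) p = -coef (op w t s) p := by
  rw [coef_eq_lin, coef_eq_lin, coefMono_op hs ht, coefMono_op ht hs, pair_swap, lin_neg]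

end Functionals

/-! ### The eleven types of monomials -/

section Trees

variable {α : Type*} (u : Op) (a b c d e f : α)

/-- The monomial `a ∘ ((b ∘ (c • d)) • (e ∘ f))`, `∘` being `u`. -/
def treeR : Mono α :=
  op u (var a) (op u.swap (op u (var b) (op u.swap (var c) (var d))) (op u (var e) (var f)))

/-- The monomial `(a • (b ∘ c)) ∘ (d • e) ∘ f`, `∘` being `u`. -/
def treeQ : Mono α :=
  op u (op u.swap (var a) (op u (var b) (var c))) (op u (op u.swap (var d) (var e)) (var f))

/-- The monomial `(a • b) ∘ (c • (d ∘ e)) ∘ f`, `∘` being `u`. -/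
def treeQ' : Mono α :=
  op u (op u.swap (var a) (var b)) (op u (op u.swap (var c) (op u (var d) (var e))) (var f))

/-- The monomial `(a • b) ∘ (c • d) ∘ (e • f)`, `∘` being `u`. -/
def treeN : Mono α :=
  op u (op u.swap (var a) (var b)) (op u (op u.swap (var c) (var d)) (op u.swap (var e) (var
    f)))

/-- The monomial `(a ∘ b ∘ c) • (d ∘ e ∘ f)`, `∘` being `u`. -/
def treeS : Mono α :=
  op u.swap (op u (var a) (op u (var b) (var c))) (op u (var d) (op u (var e) (var f)))

/-- The monomial `(a • (b ∘ c)) ∘ (d • (e ∘ f))`, `∘` being `u`. -/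
def treeU : Mono α :=
  op u (op u.swap (var a) (op u (var b) (var c))) (op u.swap (var d) (op u (var e) (var f)))

/-- The monomial `((a ∘ b) • (c ∘ d)) ∘ (e • f)`, `∘` being `u`. -/
def treeW : Mono α :=
  op u (op u.swap (op u (var a) (var b)) (op u (var c) (var d))) (op u.swap (var e) (var f))

/-- The monomial `(a • b) ∘ (c • (d ∘ e ∘ f))`, `∘` being `u`. -/
def treeY : Mono α :=
  op u (op u.swap (var a) (var b)) (op u.swap (var c) (op u (var d) (op u (var e) (var f))))

/-- The monomial `(a ∘ b) • (c ∘ d ∘ (e • f))`, `∘` being `u`. -/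
def treeA : Mono α :=
  op u.swap (op u (var a) (var b)) (op u (var c) (op u (var d) (op u.swap (var e) (var f))))

/-- The monomial `(a ∘ (b • c)) • (d ∘ e ∘ f)`, `∘` being `u`. -/
def treeB : Mono α :=
  op u.swap (op u (var a) (op u.swap (var b) (var c))) (op u (var d) (op u (var e) (var f)))

/-- The monomial `(a ∘ b) • (c ∘ (d • (e ∘ f)))`, `∘` being `u`. -/
def treeD : Mono α :=
  op u.swap (op u (var a) (var b)) (op u (var c) (op u.swap (var d) (op u (var e) (var f))))

end Trees

section Coefficients

variable {α : Type*} (u : Op) (a b c d e f : α) (p : FreeAlg F α)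

/-- As nested products of functionals, these coefficients show their symmetries directly. The case
distinction on `u` lets the operations be compared by computation. -/
theorem coef_treeR : coef (treeR u a b c d e f) p =
    lin (pair u (coefMono (var a)) (pair u.swap (pair u (coefMono (var b)) (pair u.swap
      (coefMono (var c)) (coefMono (var d)))) (pair u (coefMono (var e)) (coefMono (var f)))))
      p := by
  cases u <;> exact coef_eq_functional rfl p

theorem coef_treeQ : coef (treeQ u a b c d e f) p =
    lin (triple u (pair u.swap (coefMono (var a)) (pair u (coefMono (var b)) (coefMono (var
      c)))) (pair u.swap (coefMono (var d)) (coefMono (var e))) (coefMono (var f))) p := by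
  cases u <;> exact coef_eq_functional rfl p

theorem coef_treeQ' : coef (treeQ' u a b c d e f) p =
    lin (triple u (pair u.swap (coefMono (var a)) (coefMono (var b))) (pair u.swap (coefMono
      (var c)) (pair u (coefMono (var d)) (coefMono (var e)))) (coefMono (var f))) p := by
  cases u <;> exact coef_eq_functional rfl p

theorem coef_treeN : coef (treeN u a b c d e f) p =
    lin (triple u (pair u.swap (coefMono (var a)) (coefMono (var b))) (pair u.swap (coefMono
      (var c)) (coefMono (var d))) (pair u.swap (coefMono (var e)) (coefMono (var f)))) p :=
      by
  cases u <;> exact coef_eq_functional rfl p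

theorem coef_treeS : coef (treeS u a b c d e f) p =
    lin (pair u.swap (triple u (coefMono (var a)) (coefMono (var b)) (coefMono (var c)))
      (triple u (coefMono (var d)) (coefMono (var e)) (coefMono (var f)))) p := by
  cases u <;> exact coef_eq_functional rfl p

theorem coef_treeU : coef (treeU u a b c d e f) p =
    lin (pair u (pair u.swap (coefMono (var a)) (pair u (coefMono (var b)) (coefMono (var
      c)))) (pair u.swap (coefMono (var d)) (pair u (coefMono (var e)) (coefMono (var f))))) p
      := by
  cases u <;> exact coef_eq_functional rfl p

theorem coef_treeW : coef (treeW u a b c d e f) p =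
    lin (pair u (pair u.swap (pair u (coefMono (var a)) (coefMono (var b))) (pair u (coefMono
      (var c)) (coefMono (var d)))) (pair u.swap (coefMono (var e)) (coefMono (var f)))) p :=
      by
  cases u <;> exact coef_eq_functional rfl p

theorem coef_treeY : coef (treeY u a b c d e f) p =
    lin (pair u (pair u.swap (coefMono (var a)) (coefMono (var b))) (pair u.swap (coefMono
      (var c)) (triple u (coefMono (var d)) (coefMono (var e)) (coefMono (var f))))) p := by
  cases u <;> exact coef_eq_functional rfl p

theorem coef_treeA : coef (treeA u a b c d e f) p =
    lin (pair u.swap (pair u (coefMono (var a)) (coefMono (var b))) (triple u (coefMono (var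
      c)) (coefMono (var d)) (pair u.swap (coefMono (var e)) (coefMono (var f))))) p := by
  cases u <;> exact coef_eq_functional rfl p

theorem coef_treeB : coef (treeB u a b c d e f) p =
    lin (pair u.swap (pair u (coefMono (var a)) (pair u.swap (coefMono (var b)) (coefMono (var
      c)))) (triple u (coefMono (var d)) (coefMono (var e)) (coefMono (var f)))) p := by
  cases u <;> exact coef_eq_functional rfl p

theorem coef_treeD : coef (treeD u a b c d e f) p =
    lin (pair u.swap (pair u (coefMono (var a)) (coefMono (var b))) (pair u (coefMono (var c))
      (pair u.swap (coefMono (var d)) (pair u (coefMono (var e)) (coefMono (var f)))))) p :=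
      by
  cases u <;> exact coef_eq_functional rfl p

end Coefficients

/-! ### Relations that hold for all polynomials in the brackets -/

section Symmetries

variable {α : Type*} (u : Op) (p : FreeAlg F α)

theorem treeR_swap_right (a b c d e f : α) :
    coef (treeR u a b c d f e) p = -coef (treeR u a b c d e f) p := by
  rw [coef_treeR, coef_treeR, pair_swap u (coefMono (var e)) (coefMono (var f))]
  simp [lin_neg]

theorem treeR_swap_mid (a b c d e f : α) :
    coef (treeR u a b d c e f) p = -coef (treeR u a b c d e f) p := by
  rw [coef_treeR, coef_treeR, pair_swap u.swap (coefMono (var c)) (coefMono (var d))]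
  simp [lin_neg]

theorem treeQ_swap_left (a b c d e f : α) :
    coef (treeQ u a c b d e f) p = -coef (treeQ u a b c d e f) p := by
  rw [coef_treeQ, coef_treeQ, pair_swap u (coefMono (var b)) (coefMono (var c))]
  simp [lin_neg]

theorem treeQ_swap_right (a b c d e f : α) :
    coef (treeQ u a b c e d f) p = -coef (treeQ u a b c d e f) p := by
  rw [coef_treeQ, coef_treeQ, pair_swap u.swap (coefMono (var d)) (coefMono (var e))]
  simp [lin_neg]

theorem treeN_swap (a b c d e f : α) :
    coef (treeN u b a c d e f) p = -coef (treeN u a b c d e f) p := by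
  rw [coef_treeN, coef_treeN, pair_swap u.swap (coefMono (var a)) (coefMono (var b))]
  simp [lin_neg]

theorem treeS_reverse (a b c d e f : α) :
    coef (treeS u c b a d e f) p = coef (treeS u a b c d e f) p := by
  rw [coef_treeS, coef_treeS, triple_reverse u (coefMono (var a))]

theorem treeU_swap_right (a b c d e f : α) :
    coef (treeU u a b c d f e) p = -coef (treeU u a b c d e f) p := by
  rw [coef_treeU, coef_treeU, pair_swap u (coefMono (var e)) (coefMono (var f))]
  simp [lin_neg]

theorem treeU_swap (a b c d e f : α) :
    coef (treeU u d e f a b c) p = -coef (treeU u a b c d e f) p := by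
  rw [coef_treeU, coef_treeU, pair_swap u (pair u.swap (coefMono (var a)) _), lin_neg]

theorem treeY_swap (a b c d e f : α) :
    coef (treeY u b a c d e f) p = -coef (treeY u a b c d e f) p := by
  rw [coef_treeY, coef_treeY, pair_swap u.swap (coefMono (var a)) (coefMono (var b))]
  simp [lin_neg]

theorem treeY_reverse (a b c d e f : α) :
    coef (treeY u a b c f e d) p = coef (treeY u a b c d e f) p := by
  rw [coef_treeY, coef_treeY, triple_reverse u (coefMono (var d))]

theorem treeY_shuffle (a b c d e f : α) :
    coef (treeY u a b c d e f) p + coef (treeY u a b c e d f) p +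
      coef (treeY u a b c e f d) p = 0 := by
  simp only [coef_treeY, ← lin_add, ← pair_add_right, triple_shuffle, pair_zero_right]
  simp [lin]

theorem treeW_swap_left (a b c d e f : α) :
    coef (treeW u b a c d e f) p = -coef (treeW u a b c d e f) p := by
  rw [coef_treeW, coef_treeW, pair_swap u (coefMono (var a)) (coefMono (var b))]
  simp [lin_neg]

theorem treeW_swap_mid (a b c d e f : α) :
    coef (treeW u a b d c e f) p = -coef (treeW u a b c d e f) p := by
  rw [coef_treeW, coef_treeW, pair_swap u (coefMono (var c)) (coefMono (var d))]
  simp [lin_neg]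

theorem treeW_swap_right (a b c d e f : α) :
    coef (treeW u a b c d f e) p = -coef (treeW u a b c d e f) p := by
  rw [coef_treeW, coef_treeW, pair_swap u.swap (coefMono (var e)) (coefMono (var f))]
  simp [lin_neg]

theorem treeW_swap_factors (a b c d e f : α) :
    coef (treeW u c d a b e f) p = -coef (treeW u a b c d e f) p := by
  rw [coef_treeW, coef_treeW, pair_swap u.swap (pair u (coefMono (var a)) _)]
  simp [lin_neg]

theorem treeA_swap_left (a b c d e f : α) :
    coef (treeA u b a c d e f) p = -coef (treeA u a b c d e f) p := by
  rw [coef_treeA, coef_treeA, pair_swap u (coefMono (var a)) (coefMono (var b))]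
  simp [lin_neg]

theorem treeA_swap_right (a b c d e f : α) :
    coef (treeA u a b c d f e) p = -coef (treeA u a b c d e f) p := by
  rw [coef_treeA, coef_treeA, pair_swap u.swap (coefMono (var e)) (coefMono (var f))]
  simp [lin_neg]

theorem treeD_swap_left (a b c d e f : α) :
    coef (treeD u b a c d e f) p = -coef (treeD u a b c d e f) p := by
  rw [coef_treeD, coef_treeD, pair_swap u (coefMono (var a)) (coefMono (var b))]
  simp [lin_neg]

theorem treeD_swap_right (a b c d e f : α) :
    coef (treeD u a b c d f e) p = -coef (treeD u a b c d e f) p := by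
  rw [coef_treeD, coef_treeD, pair_swap u (coefMono (var e)) (coefMono (var f))]
  simp [lin_neg]

theorem treeB_swap_left (a b c d e f : α) :
    coef (treeB u a c b d e f) p = -coef (treeB u a b c d e f) p := by
  rw [coef_treeB, coef_treeB, pair_swap u.swap (coefMono (var b)) (coefMono (var c))]
  simp [lin_neg]

theorem treeB_reverse (a b c d e f : α) :
    coef (treeB u a b c f e d) p = coef (treeB u a b c d e f) p := by
  rw [coef_treeB, coef_treeB, triple_reverse u (coefMono (var d))]

theorem treeB_shuffle (a b c d e f : α) :
    coef (treeB u a b c d e f) p + coef (treeB u a b c e d f) p +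
      coef (treeB u a b c e f d) p = 0 := by
  simp only [coef_treeB, ← lin_add, ← pair_add_right, triple_shuffle, pair_zero_right]
  simp [lin]

/-- The shuffle relation for `z` and `xy`. It is applied when the monomial with the factor `y` in
the middle is alone in its parity class, so that the right side vanishes. -/
theorem triple_add_of_mid (w : Op) (x y z : Mono α → F) :
    triple w x z y + triple w z x y = -triple w x y z := by
  have h := triple_shuffle w x y z
  rw [← triple_reverse w y x z, ← triple_reverse w y z x] at h
  rw [eq_neg_iff_add_eq_zero, ← h]
  abel

end Symmetries

/-! ### Relations that hold for identities of associative interchange algebras -/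

section Identities

variable [CharZero F] {p : FreeAlg F (Fin 6)} (u : Op)

/-- Two interchanges relate `(b ∘ d) • (c ∘ (e • f))` to `(b ∘ (d • e)) • (c ∘ f)` through `(b • c)
∘ (d • e • f)`. The first of these becomes a tree of type R after its two factors are exchanged,
which gives the sign. -/
theorem treeR_exchange (hp : p ∈ allIds F 6) (a b c d e f : Fin 6) :
    coef (treeR u a b d e c f) p = coef (treeR u a c e f b d) p := by
  have h := coef_parity_sum (K :=
      [op u (var 0) (op u.swap (op u (var 1) (var 3)) (op u (var 2) (op u.swap (var 4) (var
         5)))),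
       op u (var 0) (op u.swap (op u (var 1) (op u.swap (var 3) (var 4))) (op u (var 2) (var
         5)))])
    (by cases u <;> decide +kernel) hp ![a, b, c, d, e, f]
  change coef (op u (var a) (op u.swap (op u (var b) (var d)) (op u (var c) (op u.swap (var e)
    (var f))))) p + (coef (treeR u a b d e c f) p + 0) = 0 at h
  rw [coef_eq_functional (by cases u <;> rfl), show
    functional (op u (var a) (op u.swap (op u (var b) (var d))
      (op u (var c) (op u.swap (var e) (var f))))) =
      pair u (coefMono (var a)) (pair u.swap (pair u (coefMono (var b)) (coefMono (var d)))
        (pair u (coefMono (var c)) (pair u.swap (coefMono (var e)) (coefMono (var f)))))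
          by cases u <;> rfl,
    pair_swap u.swap _ (pair u (coefMono (var b)) _), pair_neg_right, lin_neg, ← coef_treeR] at h
  linear_combination h

/-- The first two factors of both trees multiply to `(a ∘ c) • (b ∘ d ∘ e)`. -/
theorem treeQ_add (hp : p ∈ allIds F 6) (a b c d e f : Fin 6) :
    coef (treeQ u a b d c e f) p + coef (treeQ' u a b c d e f) p = 0 := by
  have h := coef_parity_sum (K :=
      [op u (op u.swap (var 0) (op u (var 1) (var 3))) (op u (op u.swap (var 2) (var 4)) (var
         5)),
       op u (op u.swap (var 0) (var 1)) (op u (op u.swap (var 2) (op u (var 3) (var 4))) (var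
         5))])
    (by cases u <;> decide +kernel) hp ![a, b, c, d, e, f]
  simpa [Mono.rename, treeQ, treeQ'] using h

/-- With the single letter `f` in the middle the monomial is alone in its parity class. The shuffle
relation turns its vanishing into a relation between the orders with `f` at the end. -/
theorem treeQ_add_comm (hp : p ∈ allIds F 6) (a b c d e f : Fin 6) :
    coef (treeQ u c d e a b f) p + coef (treeQ' u a b c d e f) p = 0 := by
  have h := coef_parity_sum (K :=
      [op u (op u.swap (var 2) (op u (var 3) (var 4))) (op u (var 5) (op u.swap (var 0) (var
         1)))])
    (by cases u <;> decide +kernel) hp ![a, b, c, d, e, f]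
  change coef (op u (op u.swap (var c) (op u (var d) (var e))) (op u (var f) (op u.swap (var a)
    (var b)))) p + 0 = 0 at h
  rw [coef_eq_functional (by cases u <;> rfl), show
    functional (op u (op u.swap (var c) (op u (var d) (var e)))
      (op u (var f) (op u.swap (var a) (var b)))) =
      triple u (pair u.swap (coefMono (var c)) (pair u (coefMono (var d)) (coefMono (var e))))
        (coefMono (var f))
        (pair u.swap (coefMono (var a)) (coefMono (var b))) by cases u <;> rfl] at h
  rw [coef_treeQ, coef_treeQ', ← lin_add, triple_add_of_mid, lin_neg]
  linear_combination -h

/-- A 3 × 2 array multiplied first by its rows or first by its columns; this takes two interchanges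
and so preserves the parity. -/
theorem treeN_add (hp : p ∈ allIds F 6) (a b c d e f : Fin 6) :
    coef (treeN u a b c d e f) p + coef (treeS u a c e b d f) p = 0 := by
  have h := coef_parity_sum (K :=
      [op u (op u.swap (var 0) (var 1)) (op u (op u.swap (var 2) (var 3)) (op u.swap (var 4)
         (var 5))),
       op u.swap (op u (var 0) (op u (var 2) (var 4))) (op u (var 1) (op u (var 3) (var 5)))])
    (by cases u <;> decide +kernel) hp ![a, b, c, d, e, f]
  simpa [Mono.rename, treeN, treeS] using h

/-- The three monomials come from `(a ∘ c) • (b ∘ d ∘ e ∘ f)` by cutting the second factor in its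
three possible places. -/
theorem treeU_add (hp : p ∈ allIds F 6) (a b c d e f : Fin 6) :
    coef (treeU u a b d c e f) p + coef (treeY u a b c d e f) p - coef (treeY u c f a b d e) p
      = 0 := by
  have h := coef_parity_sum (K :=
      [op u (op u.swap (var 0) (op u (var 1) (var 3))) (op u.swap (var 2) (op u (var 4) (var
         5))),
       op u (op u.swap (var 0) (var 1)) (op u.swap (var 2) (op u (var 3) (op u (var 4) (var
         5)))),
       op u (op u.swap (var 0) (op u (var 1) (op u (var 3) (var 4)))) (op u.swap (var 2) (var
         5))])
    (by cases u <;> decide +kernel) hp ![a, b, c, d, e, f]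
  change coef (treeU u a b d c e f) p + (coef (treeY u a b c d e f) p + (coef (op u (op u.swap
    (var a) (op u (var b) (op u (var d) (var e)))) (op u.swap (var c) (var f))) p + 0)) = 0 at h
  rw [coef_op_swap (by simp [Op.swap_ne]) (by simp [Op.swap_ne])] at h
  change _ + (_ + (-coef (treeY u c f a b d e) p + 0)) = 0 at h
  linear_combination h

/-- The four monomials come from `(a ∘ c ∘ e) • (b ∘ d ∘ f)` by cutting each factor in one of its
two places. They have the parity opposite to that of the trees N and S in the same interchange
class. -/
theorem treeW_add (hp : p ∈ allIds F 6) (a b c d e f : Fin 6) :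
    coef (treeW u a c b d e f) p - coef (treeW u c e d f a b) p = coef (treeU u b a c e d f) p
      + coef (treeU u a b d f c e) p := by
  have h := coef_parity_sum (K :=
      [op u (op u.swap (op u (var 0) (var 2)) (var 1)) (op u.swap (var 4) (op u (var 3) (var
         5))),
       op u (op u.swap (var 0) (op u (var 1) (var 3))) (op u.swap (op u (var 2) (var 4)) (var
         5)),
       op u (op u.swap (op u (var 0) (var 2)) (op u (var 1) (var 3))) (op u.swap (var 4) (var
         5)),
       op u (op u.swap (var 0) (var 1)) (op u.swap (op u (var 2) (var 4)) (op u (var 3) (var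
         5)))])
    (by cases u <;> decide +kernel) hp ![a, b, c, d, e, f]
  change coef (op u (op u.swap (op u (var a) (var c)) (var b)) (op u.swap (var e) (op u (var d)
    (var f)))) p + (coef (op u (op u.swap (var a) (op u (var b) (var d))) (op u.swap (op u (var
    c) (var e)) (var f))) p + (coef (treeW u a c b d e f) p + (coef (op u (op u.swap (var a)
    (var b)) (op u.swap (op u (var c) (var e)) (op u (var d) (var f)))) p + 0))) = 0 at h
  rw [coef_eq_functional (t := op u (op u.swap (op u (var a) (var c)) (var b))
    (op u.swap (var e) (op u (var d) (var f))))
      (by cases u <;> rfl), show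
    functional (op u (op u.swap (op u (var a) (var c)) (var b))
      (op u.swap (var e) (op u (var d) (var f)))) =
      pair u (pair u.swap (pair u (coefMono (var a)) (coefMono (var c))) (coefMono (var b)))
        (pair u.swap (coefMono (var e)) (pair u (coefMono (var d)) (coefMono (var f))))
          by cases u <;> rfl,
    pair_swap u.swap (coefMono (var b)), pair_neg_left, lin_neg, ← coef_treeU,
    coef_eq_functional (t := op u (op u.swap (var a) (op u (var b) (var d)))
      (op u.swap (op u (var c) (var e)) (var f)))
      (by cases u <;> rfl), show
    functional (op u (op u.swap (var a) (op u (var b) (var d)))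
      (op u.swap (op u (var c) (var e)) (var f))) =
      pair u (pair u.swap (coefMono (var a)) (pair u (coefMono (var b)) (coefMono (var d))))
        (pair u.swap (pair u (coefMono (var c)) (coefMono (var e))) (coefMono (var f)))
          by cases u <;> rfl,
    pair_swap u.swap (coefMono (var f)), pair_neg_right, lin_neg, ← coef_treeU,
    coef_op_swap (s := op u.swap (var a) (var b)) (by simp [Op.swap_ne])
      (by simp [Op.swap_ne])] at h
  change _ + (_ + (_ + (-coef (treeW u c e d f a b) p + 0))) = 0 at h
  linear_combination h

/-- The monomial with `e • f` between `c` and `d` is alone in its parity class; the rest is the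
shuffle relation. -/
theorem treeA_swap_mid (hp : p ∈ allIds F 6) (a b c d e f : Fin 6) :
    coef (treeA u a b d c e f) p = -coef (treeA u a b c d e f) p := by
  have h := coef_parity_sum (K :=
      [op u.swap (op u (var 0) (var 1)) (op u (var 2) (op u (op u.swap (var 4) (var 5)) (var
         3)))])
    (by cases u <;> decide +kernel) hp ![a, b, c, d, e, f]
  change coef (op u.swap (op u (var a) (var b)) (op u (var c) (op u (op u.swap (var e) (var f))
    (var d)))) p + 0 = 0 at h
  rw [coef_eq_functional (by cases u <;> rfl), show
    functional (op u.swap (op u (var a) (var b)) (op u (var c)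
      (op u (op u.swap (var e) (var f)) (var d)))) =
      pair u.swap (pair u (coefMono (var a)) (coefMono (var b)))
        (triple u (coefMono (var c)) (pair u.swap (coefMono (var e)) (coefMono (var f)))
          (coefMono (var d))) by cases u <;> rfl] at h
  have h' := triple_add_of_mid (F := F) u (coefMono (var c))
    (pair u.swap (coefMono (var e)) (coefMono (var f))) (coefMono (var d))
  rw [eq_neg_iff_add_eq_zero, coef_treeA, coef_treeA, ← lin_add, ← pair_add_right,
    add_comm (triple u (coefMono (var d)) _ _), h', pair_neg_right, lin_neg]
  linear_combination -h

/-- The tree B can cut its second factor as `b ∘ (e ∘ f)` or as `(b ∘ e) ∘ f`. Moving `d` across in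
the first case gives D, in the second case A. -/
theorem treeD_add (hp : p ∈ allIds F 6) (a b c d e f : Fin 6) :
    coef (treeD u a c b d e f) p + coef (treeA u a c b e d f) p + coef (treeB u a c d b e f) p
      = 0 := by
  have h := coef_parity_sum (K :=
      [op u.swap (op u (var 0) (var 2)) (op u (var 1) (op u.swap (var 3) (op u (var 4) (var
         5)))),
       op u.swap (op u (var 0) (var 2)) (op u (var 1) (op u (var 4) (op u.swap (var 3) (var
         5)))),
       op u.swap (op u (var 0) (op u.swap (var 2) (var 3))) (op u (var 1) (op u (var 4) (var
         5)))])
    (by cases u <;> decide +kernel) hp ![a, b, c, d, e, f]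
  simpa [Mono.rename, treeD, treeA, treeB, add_assoc] using h

/-- Both monomials equal `(a • b) ∘ (c • (d ∘ e) • f)`; the middle factor can be given to either
side. -/
theorem treeD_add_comm (hp : p ∈ allIds F 6) (a b c d e f : Fin 6) :
    coef (treeD u a c b f d e) p + coef (treeD u b f a c d e) p = 0 := by
  have h := coef_parity_sum (K :=
      [op u.swap (op u (var 0) (var 2)) (op u (var 1) (op u.swap (op u (var 3) (var 4)) (var
         5))),
       op u.swap (op u (var 0) (op u.swap (var 2) (op u (var 3) (var 4)))) (op u (var 1) (var
         5))])
    (by cases u <;> decide +kernel) hp ![a, b, c, d, e, f]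
  change coef (op u.swap (op u (var a) (var c)) (op u (var b) (op u.swap (op u (var d) (var e))
    (var f)))) p + (coef (op u.swap (op u (var a) (op u.swap (var c) (op u (var d) (var e))))
    (op u (var b) (var f))) p + 0) = 0 at h
  rw [coef_eq_functional (t := op u.swap (op u (var a) (var c))
    (op u (var b) (op u.swap (op u (var d) (var e)) (var f))))
      (by cases u <;> rfl), show
    functional (op u.swap (op u (var a) (var c)) (op u (var b)
      (op u.swap (op u (var d) (var e)) (var f)))) =
      pair u.swap (pair u (coefMono (var a)) (coefMono (var c)))
        (pair u (coefMono (var b)) (pair u.swap (pair u (coefMono (var d)) (coefMono (var e)))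
          (coefMono (var f)))) by cases u <;> rfl,
    pair_swap u.swap (coefMono (var f)), pair_neg_right, pair_neg_right, lin_neg, ← coef_treeD,
    coef_op_swap (by simp [Op.ne_swap]) (by simp [Op.ne_swap])] at h
  change _ + (-coef (treeD u b f a c d e) p + 0) = 0 at h
  linear_combination -h

theorem treeR_eq_zero (hp : p ∈ allIds F 6) (a b c d e f : Fin 6) :
    coef (treeR u a b c d e f) p = 0 :=
  eq_zero_of_five_letters (R := fun x y z v w => coef (treeR u a z v w x y) p)
    (fun x y z v w => treeR_swap_right u p a z v w x y)
    (fun x y z v w => treeR_swap_mid u p a z v w x y)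
    (fun x y z v w => treeR_exchange u hp a x z y v w) e f b c d

theorem treeQ_eq_zero (hp : p ∈ allIds F 6) (a b c d e f : Fin 6) :
    coef (treeQ u a b c d e f) p = 0 :=
  eq_zero_of_five_letters (R := fun x y z v w => coef (treeQ u z v w x y f) p)
    (fun x y z v w => treeQ_swap_right u p z v w x y f)
    (fun x y z v w => treeQ_swap_left u p z v w x y f)
    (fun x y z v w => by
      linear_combination treeQ_add u hp x y z v w f - treeQ_add_comm u hp x y z v w f) d e a b c

theorem treeQ'_eq_zero (hp : p ∈ allIds F 6) (a b c d e f : Fin 6) :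
    coef (treeQ' u a b c d e f) p = 0 := by
  linear_combination treeQ_add u hp a b c d e f - treeQ_eq_zero u hp a b d c e f

theorem treeS_eq_zero (hp : p ∈ allIds F 6) (a b c d e f : Fin 6) :
    coef (treeS u a b c d e f) p = 0 :=
  eq_zero_of_column_swap (S := fun a b c d e f => coef (treeS u a b c d e f) p)
    (fun a b c d e f => treeS_reverse u p a b c d e f)
    (fun a b c d e f => by
      linear_combination treeN_add u hp a d b e c f + treeN_add u hp d a b e c f -
        treeN_swap u p a d b e c f) a b c d e f

theorem treeN_eq_zero (hp : p ∈ allIds F 6) (a b c d e f : Fin 6) :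
    coef (treeN u a b c d e f) p = 0 := by
  linear_combination treeN_add u hp a b c d e f - treeS_eq_zero u hp a c e b d f

theorem treeY_eq_zero (hp : p ∈ allIds F 6) (a b c d e f : Fin 6) :
    coef (treeY u a b c d e f) p = 0 :=
  eq_zero_of_pair_triple (U := fun a b c d e f => coef (treeU u a b c d e f) p)
    (Y := fun a b c d e f => coef (treeY u a b c d e f) p)
    (treeU_swap_right u p) (treeU_swap u p) (treeY_swap u p) (treeY_reverse u p)
    (treeY_shuffle u p) (treeU_add u hp) a b c d e f

theorem treeU_eq_zero (hp : p ∈ allIds F 6) (a b c d e f : Fin 6) :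
    coef (treeU u a b c d e f) p = 0 := by
  linear_combination treeU_add u hp a b d c e f - treeY_eq_zero u hp a b d c e f +
    treeY_eq_zero u hp d f a b c e

theorem treeW_eq_zero (hp : p ∈ allIds F 6) (a b c d e f : Fin 6) :
    coef (treeW u a b c d e f) p = 0 :=
  eq_zero_of_three_pairs (W := fun a b c d e f => coef (treeW u a b c d e f) p)
    (treeW_swap_left u p) (treeW_swap_mid u p) (treeW_swap_right u p) (treeW_swap_factors u p)
    (fun a b c d e f => by
      linear_combination treeW_add u hp a b c d e f + treeU_eq_zero u hp b a c e d f +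
        treeU_eq_zero u hp a b d f c e) a b c d e f

theorem treeB_swap_first (hp : p ∈ allIds F 6) (a b c d e f : Fin 6) :
    coef (treeB u b a c d e f) p = -coef (treeB u a b c d e f) p :=
  antisymm_first (A := fun a b c d e f => coef (treeA u a b c d e f) p)
    (B := fun a b c d e f => coef (treeB u a b c d e f) p)
    (D := fun a b c d e f => coef (treeD u a b c d e f) p)
    (treeA_swap_left u p) (treeD_swap_left u p)
    (fun x y z u' v w => treeD_add u hp x z y u' v w) a b c d e f

theorem treeB_swap_mid (hp : p ∈ allIds F 6) (a b c d e f : Fin 6) :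
    coef (treeB u a b e d c f) p = -coef (treeB u a b c d e f) p :=
  antisymm_mid (A := fun a b c d e f => coef (treeA u a b c d e f) p)
    (B := fun a b c d e f => coef (treeB u a b c d e f) p)
    (D := fun a b c d e f => coef (treeD u a b c d e f) p)
    (treeA_swap_left u p) (fun a b c d e f => treeA_swap_mid u hp a b c d e f)
    (treeA_swap_right u p) (treeD_swap_left u p)
    (treeD_swap_right u p) (treeB_swap_left u p) (treeB_reverse u p) (treeB_shuffle u p)
    (fun x y z u' v w => treeD_add u hp x z y u' v w)
    (fun x y z u' v w => treeD_add_comm u hp x z y v w u') a b c d e f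

theorem treeD_eq_zero (hp : p ∈ allIds F 6)
    (hB : ∀ a b c d e f, coef (treeB u a b c d e f) p = 0) (a b c d e f : Fin 6) :
    coef (treeD u a b c d e f) p = 0 :=
  eq_zero_of_B_eq_zero (A := fun a b c d e f => coef (treeA u a b c d e f) p)
    (B := fun a b c d e f => coef (treeB u a b c d e f) p)
    (D := fun a b c d e f => coef (treeD u a b c d e f) p)
    (treeA_swap_left u p) (fun a b c d e f => treeA_swap_mid u hp a b c d e f)
    (treeA_swap_right u p) (treeD_swap_left u p) (treeD_swap_right u p)
    (fun x y z u' v w => treeD_add u hp x z y u' v w)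
    (fun x y z u' v w => treeD_add_comm u hp x z y v w u') hB a b c d e f

/-- The expansion of an identity of degree `6` is determined by its coefficients at the monomials
`(a ∘ (b • c)) • (d ∘ e ∘ f)` and `(a • (b ∘ c)) ∘ (d • e • f)`. -/
theorem expand_eq_zero_of_treeB (hp : p ∈ allIds F 6)
    (hB : ∀ u a b c d e f, coef (treeB u a b c d e f) p = 0) : expand p = 0 := by
  refine expand_eq_zero_of_representatives hp fun u r hr g => ?_
  have hA (a b c d e f : Fin 6) : coef (treeA u a b c d e f) p = 0 := by
    linear_combination treeD_add u hp a c b e d f - treeD_eq_zero u hp (hB u) a b c e d f -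
      hB u a b e c d f
  simp only [representatives, List.mem_cons, List.not_mem_nil, or_false] at hr
  rcases hr with rfl | rfl | rfl | rfl | rfl | rfl | rfl | rfl | rfl | rfl | rfl
  · exact treeR_eq_zero u hp ..
  · exact treeQ_eq_zero u hp ..
  · exact treeQ'_eq_zero u hp ..
  · exact treeN_eq_zero u hp ..
  · exact treeS_eq_zero u hp ..
  · exact treeU_eq_zero u hp ..
  · exact treeW_eq_zero u hp ..
  · exact treeY_eq_zero u hp ..
  · exact hA ..
  · exact hB u ..
  · exact treeD_eq_zero u hp (hB u) ..

end Identities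

end Interchange
end

noncomputable section

namespace Interchange

variable {F : Type*} [Field F]

open Mono

/-! ### Identities of lower degree -/

theorem mono_mem_multilinear {n : ℕ} {t : Mono (Fin n)}
    (h : t.vars = (Finset.univ : Finset (Fin n)).val) : monoBasis F (Fin n) t ∈ multilinear F n :=
  Submodule.subset_span ⟨t, h, rfl⟩

/-- The product of a polynomial with a new indeterminate. -/
def mulLast (u : Op) {n : ℕ} (f : FreeAlg F (Fin n)) : FreeAlg F (Fin (n + 1)) :=
  freeMul u (rename Fin.castSucc f) (X (Fin.last n))

theorem mulLast_mem_allIds (u : Op) {n : ℕ} {f : FreeAlg F (Fin n)} (hf : f ∈ allIds F n) :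
    mulLast u f ∈ allIds F (n + 1) := by
  rw [mem_allIds_iff] at hf ⊢
  refine ⟨?_, isBracketId_of_eval ?_⟩
  · have hle : multilinear F n ≤ (multilinear F (n + 1)).comap
        ((freeMul u).flip (X (Fin.last n)) ∘ₗ rename Fin.castSucc) := by
      rw [multilinear, Submodule.span_le]
      rintro _ ⟨t, ht, rfl⟩
      simp only [SetLike.mem_coe, Submodule.mem_comap, LinearMap.comp_apply, rename_mono, X,
        LinearMap.flip_apply, freeMul_mono]
      refine mono_mem_multilinear ?_
      rw [Set.mem_ofPred_eq] at ht
      rw [Mono.vars, vars_rename, ht, Mono.vars, Fin.univ_castSuccEmb, Finset.cons_val,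
        Finset.map_val, ← Multiset.singleton_add]
      exact add_comm _ _
    exact hle hf.1
  · rw [mulLast, eval_freeMul, eval_rename, hf.2.eval_eq_zero (isAI_mulAI _), map_zero,
      LinearMap.zero_apply]

theorem coef_X_of_ne {α : Type*} {T : Mono α} {x : α} (h : T.vars ≠ {x}) :
    coef T (X x : FreeAlg F α) = 0 :=
  coef_mono_eq_zero_of_vars_ne h

theorem coef_X_self {α : Type*} (x : α) : coef (var x) (X x : FreeAlg F α) = 1 := by
  rw [coef_apply, X, expand_var]
  simp

/-- For each monomial choose an operation `u` different from its outermost one. Its product by `u`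
with the new letter then has exactly two factors, and the coefficient there in the bracket of `f`
with that letter is the original coefficient. -/
theorem expand_eq_zero_of_mulLast {n : ℕ} {f : FreeAlg F (Fin n)}
    (h : ∀ u, expand (mulLast u f) = 0) : expand f = 0 := by
  rw [expand_eq_zero_iff]
  intro T
  obtain ⟨u, hu⟩ : ∃ u, T.rooted u = false := by
    cases T with
    | var x => exact ⟨.circ, rfl⟩
    | op w s t => exact ⟨w.swap, by simp [Op.ne_swap]⟩
  have hu' : (T.rename Fin.castSucc).rooted u = false := by cases T <;> exact hu
  have hT : (T.rename Fin.castSucc).vars ≠ {Fin.last n} := by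
    rw [vars_rename]
    intro h
    have : Fin.last n ∈ T.vars.map Fin.castSucc := by rw [h]; simp
    obtain ⟨i, -, hi⟩ := Multiset.mem_map.mp this
    exact Fin.castSucc_ne_last i hi
  have := (expand_eq_zero_iff _).mp (h u) (op u (T.rename Fin.castSucc) (var (Fin.last n)))
  rwa [mulLast, coef_op_freeMul hu' rfl, coef_X_self, coef_X_of_ne hT, zero_mul, sub_zero,
    mul_one, coef_rename (Fin.castSucc_injective n)] at this

/-- A tree of type B is a product of exactly two factors, neither of them a letter, whereas one
factor of the bracket is a letter. -/
theorem coef_treeB_mulLast {n : ℕ} (u w : Op) (f : FreeAlg F (Fin n)) (a b c d e g : Fin (n + 1)) :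
    coef (treeB w a b c d e g) (mulLast u f) = 0 := by
  by_cases h : w.swap = u
  · subst h
    have hcard (s t : Mono (Fin (n + 1))) : (op w s t).vars ≠ {Fin.last n} := by
      intro h
      have := congrArg Multiset.card h
      have h1 := s.size_pos
      have h2 := t.size_pos
      rw [card_vars, Multiset.card_singleton, size] at this
      omega
    rw [treeB, mulLast, coef_op_freeMul (by simp [Op.ne_swap]) (by simp [Op.ne_swap]),
      coef_X_of_ne (hcard _ _), coef_X_of_ne (hcard _ _), mul_zero, zero_mul, sub_zero]
  · exact coef_freeMul_of_not_rooted (by simp [treeB, h]) _ _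

/-- In degree less than `6` the brackets satisfy only the consequences of anticommutativity and
the Jacobi identities. -/
theorem expand_eq_zero_of_lt [CharZero F] {k : ℕ} (hk : k ≤ 5) {f : FreeAlg F (Fin k)}
    (hf : f ∈ allIds F k) : expand f = 0 := by
  -- Each bracket with a new letter raises the degree by one, so the descent starts in degree 5,
  -- where the criterion for degree 6 applies.
  induction hk using Nat.decreasingInduction with
  | self =>
    exact expand_eq_zero_of_mulLast fun u => expand_eq_zero_of_treeB (mulLast_mem_allIds u hf)
      fun w a b c d e g => coef_treeB_mulLast u w f a b c d e g
  | of_succ k _ ih => exact expand_eq_zero_of_mulLast fun u => ih (mulLast_mem_allIds u hf)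

theorem lieIds_subset_lowerIds : lieIds F ⊆ lowerIds F 6 := by
  have key {k : ℕ} (hk : k < 6) {f : FreeAlg F (Fin k)} (h1 : f ∈ multilinear F k)
      (h2 : rename (fun i : Fin k => (i : ℕ)) f ∈ lieIds F) :
      rename (fun i : Fin k => (i : ℕ)) f ∈ lowerIds F 6 := by
    refine ⟨k, hk, f, (mem_allIds_iff f).mpr ⟨h1, isBracketId_of_eval ?_⟩, rfl⟩
    have := (isLie_brackets_of_assoc (isAI_mulAI (F := F) (Fin k)).assoc).eval_eq_zero h2
      fun i => if h : i < k then (consequences (assocInterchange F) (Fin k)).mkQ (X ⟨i, h⟩) else 0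
    rw [eval_rename] at this
    simpa [Function.comp_def] using this
  have hanti (w : Op) : anticomm F w ∈ lowerIds F 6 := by
    have e : rename (fun i : Fin 2 => (i : ℕ))
        (freeMul w (X 0) (X 1) + freeMul w (X 1) (X 0) : FreeAlg F (Fin 2)) = anticomm F w := by
      simp only [map_add, rename_freeMul, X, rename_mono, Mono.rename, anticomm]
      rfl
    rw [← e]
    refine key (by norm_num) (add_mem ?_ ?_) (e ▸ anticomm_mem_lieIds w) <;>
    · simp only [X, freeMul_mono]
      exact mono_mem_multilinear (by simp only [Mono.vars]; decide)
  have hjac (w : Op) : jacobi F w ∈ lowerIds F 6 := by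
    have e : rename (fun i : Fin 3 => (i : ℕ))
        (freeMul w (X 0) (freeMul w (X 1) (X 2)) + freeMul w (X 1) (freeMul w (X 2) (X 0)) +
          freeMul w (X 2) (freeMul w (X 0) (X 1)) : FreeAlg F (Fin 3)) = jacobi F w := by
      simp only [map_add, rename_freeMul, X, rename_mono, Mono.rename, jacobi]
      rfl
    rw [← e]
    refine key (by norm_num) (add_mem (add_mem ?_ ?_) ?_) (e ▸ jacobi_mem_lieIds w) <;>
    · simp only [X, freeMul_mono]
      exact mono_mem_multilinear (by simp only [Mono.vars]; decide)
  intro g hg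
  simp only [lieIds, Set.mem_insert_iff, Set.mem_singleton_iff] at hg
  rcases hg with rfl | rfl | rfl | rfl
  exacts [hanti _, hanti _, hjac _, hjac _]

/-- Identities of lower degree have vanishing expansion and are thus Lie consequences. Conversely,
the Lie identities have degrees 2 and 3. -/
theorem mem_oldIds_iff [CharZero F] (f : FreeAlg F (Fin 6)) :
    f ∈ oldIds F 6 ↔ f ∈ multilinear F 6 ∧ expand f = 0 := by
  rw [oldIds, Submodule.mem_inf, ← mem_consequences_lieIds_iff]
  have h : consequences (lowerIds F 6) (Fin 6) = consequences (lieIds F) (Fin 6) := by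
    refine le_antisymm (consequences_le ?_) (consequences_le fun g hg => ?_)
    · rintro _ ⟨k, hk, f, hf, rfl⟩
      rw [mem_consequences_lieIds_iff, expand_rename, expand_eq_zero_of_lt (by omega) hf, map_zero]
    · rw [← subst_X g]
      exact subst_mem_consequences (lieIds_subset_lowerIds hg) _
  rw [h]

end Interchange
end

noncomputable section

namespace Interchange

variable {F : Type*} [Field F] {α : Type*}

open Mono

/-! ### Polynomials with integer coefficients as lists -/

/-- The polynomial with the given list of coefficients and monomials. -/
def toPoly (L : List (ℤ × Mono α)) : FreeAlg F α :=
  (L.map fun p => (p.1 : F) • monoBasis F α p.2).sum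

@[simp] theorem toPoly_nil : toPoly ([] : List (ℤ × Mono α)) = (0 : FreeAlg F α) := rfl

@[simp] theorem toPoly_cons (c : ℤ) (t : Mono α) (L : List (ℤ × Mono α)) :
    toPoly ((c, t) :: L) = (c : F) • monoBasis F α t + toPoly L := by simp [toPoly]

@[simp] theorem toPoly_append (L L' : List (ℤ × Mono α)) :
    toPoly (L ++ L') = (toPoly L + toPoly L' : FreeAlg F α) := by simp [toPoly]

/-- The multiples of a list. -/
def scaleList (c : ℤ) (L : List (ℤ × Mono α)) : List (ℤ × Mono α) :=
  L.map fun p => (c * p.1, p.2)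

theorem toPoly_scaleList (c : ℤ) (L : List (ℤ × Mono α)) :
    toPoly (scaleList c L) = ((c : F) • toPoly L : FreeAlg F α) := by
  induction L with
  | nil => simp [scaleList]
  | cons p L ih =>
    rw [scaleList, List.map_cons, toPoly_cons, ← scaleList, ih, toPoly_cons, smul_add, smul_smul,
      Int.cast_mul]

/-- The product of lists. -/
def mulList (w : Op) (L L' : List (ℤ × Mono α)) : List (ℤ × Mono α) :=
  L.flatMap fun p => L'.map fun q => (p.1 * q.1, app w p.2 q.2)

theorem toPoly_mulList (w : Op) (L L' : List (ℤ × Mono α)) :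
    (toPoly (mulList w L L') : FreeAlg F α) = assocMul w (toPoly L) (toPoly L') := by
  induction L with
  | nil => simp [mulList]
  | cons p L ih =>
    have h : (toPoly (L'.map fun q => (p.1 * q.1, app w p.2 q.2)) : FreeAlg F α) =
        (p.1 : F) • assocMul w (monoBasis F α p.2) (toPoly L') := by
      clear ih
      induction L' with
      | nil => simp
      | cons q L' ih =>
        rw [List.map_cons, toPoly_cons, ih, toPoly_cons, map_add, map_smul, assocMul_mono, smul_add,
          smul_smul, Int.cast_mul]
    rw [mulList, List.flatMap_cons, toPoly_append, h, ← mulList, ih, toPoly_cons, map_add,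
      map_smul, LinearMap.add_apply, LinearMap.smul_apply]

/-- The expansion of a monomial in the brackets. -/
def expandList : Mono α → List (ℤ × Mono α)
  | .var x => [(1, .var x)]
  | .op w s t => mulList w (expandList s) (expandList t) ++
      scaleList (-1) (mulList w (expandList t) (expandList s))

theorem expand_mono (t : Mono α) : expand (monoBasis F α t) = toPoly (expandList t) := by
  induction t with
  | var x => simp [expand_var, expandList]
  | op w s t hs ht =>
    rw [expand_op, expandList, toPoly_append, toPoly_scaleList, toPoly_mulList, toPoly_mulList, hs,
      ht]
    simp [sub_eq_add_neg]

/-- The expansion of a polynomial in the brackets. -/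
def expandAll (L : List (ℤ × Mono α)) : List (ℤ × Mono α) :=
  L.flatMap fun p => scaleList p.1 (expandList p.2)

theorem expand_toPoly (L : List (ℤ × Mono α)) :
    expand (toPoly L : FreeAlg F α) = toPoly (expandAll L) := by
  induction L with
  | nil => simp [expandAll]
  | cons p L ih =>
    rw [toPoly_cons, map_add, map_smul, expand_mono, ih, expandAll, expandAll, List.flatMap_cons,
      toPoly_append, toPoly_scaleList]

/-! ### Equivalent monomials have equal values -/

section Values

variable {A : Type*} [AddCommGroup A] [Module F A] {m : Ops F A}

theorem evalMono_of_mem_splits (hm : IsAI m) (v : α → A) {w : Op} {t : Mono α}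
    {p : Mono α × Mono α} (h : p ∈ splits w t) :
    evalMono m v t = m w (evalMono m v p.1) (evalMono m v p.2) := by
  induction t generalizing p with
  | var x => simp [splits] at h
  | op w' a b _ hb =>
    rw [splits] at h
    split at h
    next hw =>
      subst hw
      rcases List.mem_cons.mp h with rfl | h
      · rfl
      · obtain ⟨q, hq, rfl⟩ := List.mem_map.mp h
        rw [evalMono, hb hq, evalMono, hm.assoc]
    · simp at h

theorem evalMono_of_mem_nbrs (hm : IsAI m) (v : α → A) {n : ℕ} {s t : Mono α}
    (h : s ∈ nbrs n t) : evalMono m v s = evalMono m v t := by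
  induction n generalizing s t with
  | zero => simp [nbrs] at h
  | succ n ih =>
    cases t with
    | var x => simp [nbrs] at h
    | op w a b =>
      simp only [nbrs, List.mem_flatMap, List.mem_append, List.mem_map] at h
      obtain ⟨p, hp, ⟨r, hr, rfl⟩ | ⟨r, hr, rfl⟩ | ⟨x, hx, y, hy, rfl⟩⟩ := h <;>
        rw [evalMono_of_mem_splits hm v hp, evalMono_app hm]
      · rw [ih hr]
      · rw [ih hr]
      · rw [evalMono_app hm, evalMono_app hm, evalMono_of_mem_splits hm v hx,
          evalMono_of_mem_splits hm v hy, hm.interchange]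

/-- This makes the closure computation a certificate that two monomials agree in all associative
interchange algebras, as the reduction rules require. -/
theorem evalMono_of_mem_close [DecidableEq α] (hm : IsAI m) (v : α → A) (x : A) (n : ℕ)
    (L new : List (Mono α)) (hL : ∀ s ∈ L, evalMono m v s = x)
    (hnew : ∀ s ∈ new, evalMono m v s = x) : ∀ s ∈ close n L new, evalMono m v s = x := by
  induction n generalizing L new with
  | zero => exact hL
  | succ n ih =>
    rw [close]
    split
    · exact hL
    next T new' hT =>
      have h : ∀ s ∈ T :: new', evalMono m v s = x := by
        intro s hs
        rw [← hT, List.mem_dedup, List.mem_filter, List.mem_flatMap] at hs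
        obtain ⟨⟨r, hr, hs⟩, -⟩ := hs
        rw [evalMono_of_mem_nbrs hm v hs, hnew r hr]
      refine ih _ _ (fun s hs => ?_) h
      rcases List.mem_append.mp hs with hs | hs
      exacts [hL s hs, h s hs]

end Values

/-! ### Alternating sums -/

/-- Evaluation of all indeterminates and operations of a monomial, for efficient computations. -/
def force {β : Type} : Mono ℕ → (Mono ℕ → β) → β
  | .var n, k => match n with
    | 0 => k (.var 0)
    | 1 => k (.var 1)
    | 2 => k (.var 2)
    | 3 => k (.var 3)
    | 4 => k (.var 4)
    | n => k (.var n)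
  | .op .circ s t, k => force s fun s => force t fun t => k (.op .circ s t)
  | .op .bullet s t, k => force s fun s => force t fun t => k (.op .bullet s t)

theorem force_eq {β : Type} (t : Mono ℕ) (k : Mono ℕ → β) : force t k = k t := by
  induction t generalizing k with
  | var n => unfold force; split <;> rfl
  | op w s t hs ht => cases w <;> simp only [force, hs, ht]

/-- Equivalences of monomials, in the direction of canonical forms. -/
def rules : List (Mono ℕ × Mono ℕ) :=
  let c := op .circ
  let b := op .bullet
  let x := var
  [(b (c (x 0) (x 1)) (c (x 2) (c (x 3) (b (x 4) (x 5)))),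
    b (c (x 0) (x 1)) (c (x 2) (b (x 4) (c (x 3) (x 5))))),
   (b (c (x 0) (b (x 1) (x 2))) (c (x 3) (c (x 4) (x 5))),
    b (c (x 0) (x 1)) (c (x 3) (b (x 2) (c (x 4) (x 5))))),
   (b (c (x 0) (c (x 1) (b (x 2) (x 3)))) (c (x 4) (x 5)),
    b (c (x 0) (c (x 1) (x 2))) (c (x 4) (b (x 3) (x 5)))),
   (b (c (x 0) (b (c (x 1) (x 2)) (x 3))) (c (x 4) (x 5)),
    b (c (x 0) (c (x 1) (x 2))) (c (x 4) (b (x 3) (x 5)))),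
   (b (c (x 0) (x 1)) (c (b (x 2) (x 3)) (c (x 4) (x 5))),
    b (c (b (x 0) (x 2)) (x 1)) (c (x 3) (c (x 4) (x 5)))),
   (b (c (x 0) (x 1)) (c (b (x 2) (c (x 3) (x 4))) (x 5)),
    b (c (b (x 0) (x 2)) (x 1)) (c (x 3) (c (x 4) (x 5)))),
   (b (c (b (c (x 0) (x 1)) (x 2)) (x 3)) (c (x 4) (x 5)),
    b (c (b (x 0) (x 2)) (c (x 1) (x 3))) (c (x 4) (x 5))),
   (b (c (x 0) (c (x 1) (x 2))) (c (b (x 3) (x 4)) (x 5)),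
    b (c (b (x 0) (x 3)) (c (x 1) (x 2))) (c (x 4) (x 5))),
   (b (c (x 0) (b (x 1) (c (x 2) (x 3)))) (c (x 4) (x 5)),
    b (c (x 0) (x 1)) (c (x 4) (b (c (x 2) (x 3)) (x 5)))),
   (b (c (b (x 0) (c (x 1) (x 2))) (x 3)) (c (x 4) (x 5)),
    b (c (x 0) (x 3)) (c (b (c (x 1) (x 2)) (x 4)) (x 5)))]


/-- The canonical form of a monomial. -/
def reduce (t : Mono ℕ) : Mono ℕ :=
  match rules.find? fun r => beq (r.1.rename fun i => t.leaves.getD i 0) t with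
  | some r => r.2.rename fun i => t.leaves.getD i 0
  | none => t

/-- Only soundness of the rules matters. Uniqueness of the canonical forms is not needed, since they
serve to show that a sum vanishes. -/
theorem rules_mem_close : ∀ r ∈ rules, r.2 ∈ close 5 [r.1] [r.1] := by decide +kernel

/-- The exchange of two indeterminates. -/
def exchange (x y i : ℕ) : ℕ := if i = x then y else if i = y then x else i

/-- Exchange the indeterminate at the `k`-th place among those different from `0` with `y`. -/
def sortStep (k y : ℕ) (p : ℤ × Mono ℕ) : ℤ × Mono ℕ :=
  let x := (p.2.leaves.filter fun i => !(i == 0)).getD k 0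
  if x = y then p else
  if x = 1 then (-p.1, p.2.rename (exchange 1 y)) else
  if x = 2 then (-p.1, p.2.rename (exchange 2 y)) else
  if x = 3 then (-p.1, p.2.rename (exchange 3 y)) else
  if x = 4 then (-p.1, p.2.rename (exchange 4 y)) else p

/-- Reduce a monomial and sort its indeterminates different from `0`. -/
def canonical (p : ℤ × Mono ℕ) : ℤ × Mono ℕ :=
  force p.2 fun t => force (reduce t) fun t => sortStep 2 3 (sortStep 1 2 (sortStep 0 1 (p.1, t)))

/-- Add a signed monomial to a list. -/
def insertTerm (p : ℤ × Mono ℕ) : List (ℤ × Mono ℕ) → List (ℤ × Mono ℕ)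
  | [] => [p]
  | q :: L => if beq q.2 p.2 then (q.1 + p.1, q.2) :: L else q :: insertTerm p L

/-- The sum of the canonical forms of the terms of a polynomial. -/
def collect (L : List (ℤ × Mono ℕ)) : List (ℤ × Mono ℕ) :=
  L.foldr (fun p L => let q := canonical p; force q.2 fun t => insertTerm (q.1, t) L) []

theorem toPoly_insertTerm (p : ℤ × Mono ℕ) (L : List (ℤ × Mono ℕ)) :
    (toPoly (insertTerm p L) : FreeAlg F ℕ) = (p.1 : F) • monoBasis F _ p.2 + toPoly L := by
  induction L with
  | nil => exact toPoly_cons p.1 p.2 []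
  | cons q L ih =>
    rw [insertTerm]
    split
    next h =>
      rw [beq_iff] at h
      rw [toPoly_cons, toPoly_cons, h, Int.cast_add, add_smul]; abel
    · rw [toPoly_cons, ih, toPoly_cons]; abel

theorem toPoly_eq_zero {L : List (ℤ × Mono α)} (h : ∀ p ∈ L, p.1 = 0) :
    (toPoly L : FreeAlg F α) = 0 := by
  refine List.sum_eq_zero fun x hx => ?_
  obtain ⟨p, hp, rfl⟩ := List.mem_map.mp hx
  rw [h p hp, Int.cast_zero, zero_smul]

section Alternating

variable {A : Type*} [AddCommGroup A] [Module F A] (m : Ops F A) (v : ℕ → A)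

/-- The action of a permutation on the indeterminates `1, 2, 3, 4`. -/
def permute (s : Equiv.Perm (Fin 4)) (i : ℕ) : ℕ :=
  if h : i ≠ 0 ∧ i - 1 < 4 then s ⟨i - 1, h.2⟩ + 1 else i

@[simp] theorem permute_zero (s : Equiv.Perm (Fin 4)) : permute s 0 = 0 := rfl

@[simp] theorem permute_succ (s : Equiv.Perm (Fin 4)) (i : Fin 4) :
    permute s (i + 1) = s i + 1 := by
  rw [permute, dif_pos ⟨Nat.succ_ne_zero _, by simp⟩]
  rfl

theorem permute_exchange (s : Equiv.Perm (Fin 4)) (i j : Fin 4) :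
    permute s ∘ exchange (i + 1) (j + 1) = permute (s * Equiv.swap i j) := by
  funext k
  rw [Function.comp_apply]
  by_cases hk : k ≠ 0 ∧ k - 1 < 4
  · obtain ⟨l, rfl⟩ : ∃ l : Fin 4, k = l + 1 := ⟨⟨k - 1, hk.2⟩, by simp only; omega⟩
    rw [permute_succ, exchange, Equiv.Perm.mul_apply, Equiv.swap_apply_def]
    simp only [Nat.add_right_cancel_iff, Fin.val_inj]
    split
    · rw [permute_succ]
    · split <;> rw [permute_succ]
  · have h1 : k ≠ i + 1 := fun h => hk (by omega)
    have h2 : k ≠ j + 1 := fun h => hk (by omega)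
    rw [exchange, if_neg h1, if_neg h2, permute, permute, dif_neg hk, dif_neg hk]

/-- The alternating sum of the values of a polynomial over the permutations of the
indeterminates `1, 2, 3, 4`. -/
def alternate : FreeAlg F ℕ →ₗ[F] A :=
  ∑ s : Equiv.Perm (Fin 4), ((Equiv.Perm.sign s : ℤ) : F) • eval m (v ∘ permute s)

theorem alternate_mono (t : Mono ℕ) : alternate m v (monoBasis F ℕ t) =
    ∑ s : Equiv.Perm (Fin 4), ((Equiv.Perm.sign s : ℤ) : F) • evalMono m (v ∘ permute s) t := by
  simp [alternate, eval_mono]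

/-- Replace the summation variable `s` by its product with the transposition. -/
theorem alternate_exchange {i j : Fin 4} (hij : i ≠ j) (t : Mono ℕ) :
    alternate m v (monoBasis F _ (t.rename (exchange (i + 1) (j + 1)))) =
      -alternate m v (monoBasis F _ t) := by
  simp only [alternate_mono, evalMono_rename]
  rw [← Finset.sum_neg_distrib]
  refine Fintype.sum_equiv (Equiv.mulRight (Equiv.swap i j)) _ _ fun s => ?_
  rw [Function.comp_assoc, permute_exchange, Equiv.coe_mulRight, Equiv.Perm.sign_mul,
    Equiv.Perm.sign_swap hij]
  simp

theorem alternate_sortStep (k : ℕ) (y : Fin 4) (p : ℤ × Mono ℕ) :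
    ((sortStep k (y + 1) p).1 : F) • alternate m v (monoBasis F _ (sortStep k (y + 1) p).2) =
      (p.1 : F) • alternate m v (monoBasis F _ p.2) := by
  have key (i : Fin 4) (hi : (i : ℕ) + 1 ≠ y + 1) : ((-p.1 : ℤ) : F) •
      alternate m v (monoBasis F _ (p.2.rename (exchange (i + 1) (y + 1)))) =
        (p.1 : F) • alternate m v (monoBasis F _ p.2) := by
    rw [alternate_exchange m v (fun h => hi (by rw [h]))]
    simp
  simp only [sortStep]
  split
  · rfl
  next hy =>
    split
    next h => exact key 0 fun e => hy (h.trans e)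
    · split
      next h => exact key 1 fun e => hy (h.trans e)
      · split
        next h => exact key 2 fun e => hy (h.trans e)
        · split
          next h => exact key 3 fun e => hy (h.trans e)
          · rfl

theorem evalMono_reduce {m : Ops F A} (hm : IsAI m) (t : Mono ℕ) :
    evalMono m v (reduce t) = evalMono m v t := by
  rw [reduce]
  split
  next r hr =>
    have h1 := List.find?_some hr
    have h2 := rules_mem_close r (List.mem_of_find?_eq_some hr)
    rw [beq_iff] at h1
    conv_rhs => rw [← h1]
    rw [evalMono_rename, evalMono_rename]
    exact evalMono_of_mem_close hm _ _ 5 [r.1] [r.1] (by simp) (by simp) _ h2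
  · rfl

theorem alternate_canonical {m : Ops F A} (hm : IsAI m) (p : ℤ × Mono ℕ) :
    ((canonical p).1 : F) • alternate m v (monoBasis F _ (canonical p).2) =
      (p.1 : F) • alternate m v (monoBasis F _ p.2) := by
  rw [canonical, force_eq, force_eq]
  have h0 := alternate_sortStep m v 0 0
  have h1 := alternate_sortStep m v 1 1
  have h2 := alternate_sortStep m v 2 2
  refine (h2 _).trans ((h1 _).trans ((h0 _).trans ?_))
  simp only [alternate_mono, evalMono_reduce _ hm]

theorem alternate_collect {m : Ops F A} (hm : IsAI m) (L : List (ℤ × Mono ℕ)) :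
    alternate m v (toPoly (collect L) : FreeAlg F ℕ) = alternate m v (toPoly L) := by
  induction L with
  | nil => rfl
  | cons p L ih =>
    rw [collect, List.foldr_cons, ← collect]
    simp only [force_eq]
    rw [toPoly_insertTerm, map_add, ih, map_smul, alternate_canonical v hm, toPoly_cons, map_add,
      map_smul]

end Alternating

/-! ### The new identity -/

/-- The terms of the new identity, with `a, b, c, d, e` the indeterminates `0, 1, 2, 3, 4`. -/
def newMonos (u w : Op) : List (ℤ × Mono ℕ) :=
  let a := var 0
  let b := var 1
  let c := var 2
  let d := var 3
  let e := var 4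
  [(2, op w (op u a b) (op u a (op w c (op u d e)))),
   (-2, op w (op u a b) (op u c (op w a (op u d e)))),
   (2, op w (op u a b) (op u c (op w d (op u a e)))),
   (-1, op w (op u b c) (op u a (op w d (op u a e)))),
   (1, op w (op u b c) (op u d (op w a (op u a e)))),
   (1, op w (op u a b) (op u (op u a c) (op w d e))),
   (2, op w (op u a b) (op u (op u c d) (op w a e))),
   (1, op w (op u b c) (op u (op u a d) (op w a e))),
   (1, op w (op u a (op u a b)) (op u c (op w d e))),
   (-1, op w (op u a (op u b c)) (op u d (op w a e))),
   (1, op w (op u b (op u a c)) (op u a (op w d e)))]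

/-- The computational proof of the new identity: once the monomials are reduced by interchange and
their letters `1` to `4` sorted with signs, all terms cancel. -/
theorem collect_newMonos :
    ((collect (expandAll (newMonos .circ .bullet))).all fun p => decide (p.1 = 0)) = true := by
  decide +kernel

theorem alternate_expand_newMonos {A : Type*} [AddCommGroup A] [Module F A] {m : Ops F A}
    (hm : IsAI m) (v : ℕ → A) :
    alternate m v (expand (toPoly (newMonos .circ .bullet) : FreeAlg F ℕ)) = 0 := by
  rw [expand_toPoly, ← alternate_collect v hm, toPoly_eq_zero, map_zero]
  simpa using collect_newMonos

theorem newLL6_eq (u w : Op) : newLL6 F u w = ∑ s : Equiv.Perm (Fin 4),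
    ((Equiv.Perm.sign s : ℤ) : F) • rename (permute s) (toPoly (newMonos u w)) := by
  refine Finset.sum_congr rfl fun s _ => ?_
  have h0 := permute_succ s 0
  have h1 := permute_succ s 1
  have h2 := permute_succ s 2
  have h3 := permute_succ s 3
  simp only [Fin.val_zero, Fin.val_one, Fin.val_two, zero_add, show ((3 : Fin 4) : ℕ) = 3 from rfl]
    at h0 h1 h2 h3
  simp only [newMonos, newTerm, toPoly_cons, toPoly_nil, map_add, map_smul, rename_mono,
    Mono.rename,
    permute_zero, h0, h1, h2, h3, X, freeMul_mono, add_zero]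
  simp only [Int.cast_neg, Int.cast_ofNat, Int.cast_one, neg_smul, one_smul,
    Nat.reduceAdd] at h1 h2 h3 ⊢
  abel_nf

theorem eval_newLL6_circ {A : Type*} [AddCommGroup A] [Module F A] {m : Ops F A}
    (hm : IsAI m) (v : ℕ → A) : eval (brackets m) v (newLL6 F .circ .bullet) = 0 := by
  rw [newLL6_eq, map_sum, ← alternate_expand_newMonos hm v, alternate, LinearMap.sum_apply]
  refine Finset.sum_congr rfl fun s _ => ?_
  rw [map_smul, eval_rename, LinearMap.smul_apply, eval_expand hm]

theorem eval_newTerm {A : Type*} [AddCommGroup A] [Module F A] (m : Ops F A) (v : α → A)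
    (u w : Op) (a b c d e : FreeAlg F α) :
    eval m v (newTerm F (freeMul u) (freeMul w) a b c d e) =
      newTerm F (m u) (m w) (eval m v a) (eval m v b) (eval m v c) (eval m v d) (eval m v e) := by
  simp [newTerm, eval_freeMul]

/-- The new identity is satisfied by the brackets of all associative interchange algebras. -/
theorem eval_newLL6 {A : Type*} [AddCommGroup A] [Module F A] {m : Ops F A}
    (hm : IsAI m) (v : ℕ → A) (u : Op) : eval (brackets m) v (newLL6 F u u.swap) = 0 := by
  cases u with
  | circ => exact eval_newLL6_circ hm v
  | bullet =>
    -- The axioms are symmetric in the two operations, and so the second identity is the first one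
    -- for the exchanged operations.
    have hm' : IsAI fun w => m w.swap :=
      ⟨fun w => hm.assoc w.swap, fun w a b c d => hm.interchange w.swap a b c d⟩
    have := eval_newLL6_circ hm' v
    simp only [newLL6, map_sum, map_smul, eval_newTerm, eval_X] at this ⊢
    exact this

end Interchange
end

noncomputable section

namespace Interchange

variable {F : Type*} [Field F] {α : Type*}

open Mono

/-! ### The linearization of the new identity -/

theorem linearize_newLL6_isBracketId (u : Op) : IsBracketId (linearize (newLL6 F u u.swap)) := by
  refine isBracketId_of_eval ?_
  simp only [linearize, map_sub, eval_eval, eval_newLL6 (isAI_mulAI _), sub_zero]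

/-- The terms of the linearization, with `a` replaced by the indeterminates `0, 1` and
`b, c, d, e` by `2, 3, 4, 5`. -/
def polarMonos (u w : Op) : List (ℤ × Mono (Fin 6)) :=
  let x := var 0
  let y := var 1
  let b := var 2
  let c := var 3
  let d := var 4
  let e := var 5
  [(2, op w (op u x b) (op u y (op w c (op u d e)))),
   (2, op w (op u y b) (op u x (op w c (op u d e)))),
   (-2, op w (op u x b) (op u c (op w y (op u d e)))),
   (-2, op w (op u y b) (op u c (op w x (op u d e)))),
   (2, op w (op u x b) (op u c (op w d (op u y e)))),
   (2, op w (op u y b) (op u c (op w d (op u x e)))),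
   (-1, op w (op u b c) (op u x (op w d (op u y e)))),
   (-1, op w (op u b c) (op u y (op w d (op u x e)))),
   (1, op w (op u b c) (op u d (op w x (op u y e)))),
   (1, op w (op u b c) (op u d (op w y (op u x e)))),
   (1, op w (op u x b) (op u (op u y c) (op w d e))),
   (1, op w (op u y b) (op u (op u x c) (op w d e))),
   (2, op w (op u x b) (op u (op u c d) (op w y e))),
   (2, op w (op u y b) (op u (op u c d) (op w x e))),
   (1, op w (op u b c) (op u (op u x d) (op w y e))),
   (1, op w (op u b c) (op u (op u y d) (op w x e))),
   (1, op w (op u x (op u y b)) (op u c (op w d e))),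
   (1, op w (op u y (op u x b)) (op u c (op w d e))),
   (-1, op w (op u x (op u b c)) (op u d (op w y e))),
   (-1, op w (op u y (op u b c)) (op u d (op w x e))),
   (1, op w (op u b (op u x c)) (op u y (op w d e))),
   (1, op w (op u b (op u y c)) (op u x (op w d e)))]


/-- The action of a permutation on the indeterminates `2, 3, 4, 5`. -/
def shift (s : Equiv.Perm (Fin 4)) : Equiv.Perm (Fin 6) :=
  finSumFinEquiv.permCongr (Equiv.sumCongr (1 : Equiv.Perm (Fin 2)) s)

theorem newTerm_polar (u w : Op) (r : Fin 6 → α) :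
    newTerm F (freeMul u) (freeMul w) (X (r 0) + X (r 1)) (X (r 2)) (X (r 3)) (X (r 4)) (X (r 5)) -
      newTerm F (freeMul u) (freeMul w) (X (r 0)) (X (r 2)) (X (r 3)) (X (r 4)) (X (r 5)) -
      newTerm F (freeMul u) (freeMul w) (X (r 1)) (X (r 2)) (X (r 3)) (X (r 4)) (X (r 5)) =
    rename r (toPoly (polarMonos u w)) := by
  simp only [polarMonos, newTerm, toPoly_cons, toPoly_nil, map_add, map_smul, rename_mono,
    Mono.rename, X, freeMul_mono, add_zero, LinearMap.add_apply, smul_add]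
  simp only [Int.cast_neg, Int.cast_ofNat, Int.cast_one, neg_smul, one_smul]
  abel_nf

theorem linearize_newLL6 (u w : Op) : linearize (newLL6 F u w) =
    ∑ s : Equiv.Perm (Fin 4), ((Equiv.Perm.sign s : ℤ) : F) •
      rename (shift s) (toPoly (polarMonos u w)) := by
  simp only [linearize, newLL6, map_sum, map_smul, eval_newTerm, eval_X, ← Finset.sum_sub_distrib,
    ← smul_sub]
  refine Finset.sum_congr rfl fun s _ => ?_
  rw [← newTerm_polar]
  -- One shift by one comes from the indeterminate `a` in front of `b, c, d, e`, the other from its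
  -- replacement by two indeterminates.
  have h (i : Fin 4) : (X (Fin.ofNat 6 ((s i : ℕ) + 1 + 1)) : FreeAlg F (Fin 6)) =
      X (shift s (Fin.natAdd 2 i)) := by
    congr 1
    simp only [shift, Equiv.permCongr_apply, Equiv.sumCongr_apply]
    rw [show (Fin.natAdd 2 i : Fin 6) = finSumFinEquiv (Sum.inr i) from rfl,
      Equiv.symm_apply_apply, Sum.map_inr, finSumFinEquiv_apply_right]
    ext
    simp only [Fin.val_ofNat, Fin.val_natAdd]
    omega
  have e2 := h 0
  have e3 := h 1
  have e4 := h 2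
  have e5 := h 3
  simp only [Nat.add_eq_zero_iff, one_ne_zero, and_false, if_false, if_true]
  rw [e2, e3, e4, e5]
  rfl

theorem toPoly_mem {L : List (ℤ × Mono α)} {I : Submodule F (FreeAlg F α)}
    (h : ∀ p ∈ L, monoBasis F α p.2 ∈ I) : toPoly L ∈ I := by
  refine list_sum_mem fun x hx => ?_
  obtain ⟨p, hp, rfl⟩ := List.mem_map.mp hx
  exact I.smul_mem _ (h p hp)

theorem linearize_newLL6_mem_allIds (u : Op) : linearize (newLL6 F u u.swap) ∈ allIds F 6 := by
  rw [mem_allIds_iff]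
  refine ⟨?_, linearize_newLL6_isBracketId u⟩
  rw [linearize_newLL6]
  refine Submodule.sum_mem _ fun s _ => Submodule.smul_mem _ _ (rename_mem_multilinear _ ?_)
  refine toPoly_mem fun p hp => mono_mem_multilinear ?_
  revert p
  cases u <;> decide +kernel

/-- The number of occurrences, with signs, of a monomial in an expansion. -/
def count (T t : Mono (Fin 6)) : ℤ :=
  -- The test of the degrees avoids useless expansions; in different degrees the coefficient is zero
  -- anyway.
  if T.size == t.size then ((expandList t).map fun p => if beq p.2 T then p.1 else 0).sum else 0

theorem coef_mono (T t : Mono (Fin 6)) : coef T (monoBasis F _ t) = (count T t : F) := by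
  rw [count]
  split
  · rw [coef_apply, expand_mono]
    generalize expandList t = L
    induction L with
    | nil => simp
    | cons p L ih =>
      rw [toPoly_cons, map_add, Finsupp.add_apply, ih, List.map_cons, List.sum_cons, Int.cast_add,
        map_smul, Module.Basis.repr_self, Finsupp.smul_apply, Finsupp.single_apply]
      by_cases h : p.2 = T
      · rw [if_pos h, if_pos ((beq_iff _ _).mpr h), smul_eq_mul, mul_one]
      · rw [if_neg h, if_neg (fun h' => h ((beq_iff _ _).mp h')), smul_zero, Int.cast_zero]
  next h =>
    rw [Int.cast_zero]
    refine coef_mono_eq_zero_of_vars_ne fun hv => h ?_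
    rw [beq_iff_eq, ← card_vars, ← card_vars, hv]

/-- The coefficient of a product of two factors in an expansion. -/
def countPair (w : Op) (S T : Mono (Fin 6)) : Mono (Fin 6) → ℤ
  | .var _ => 0
  | .op w' s t => if w' = w then count S s * count T t - count S t * count T s else 0

theorem coef_op_mono {w : Op} {S T : Mono (Fin 6)} (hS : S.rooted w = false)
    (hT : T.rooted w = false) (t : Mono (Fin 6)) :
    coef (op w S T) (monoBasis F _ t) = (countPair w S T t : F) := by
  have := congrFun (coefMono_op (F := F) hS hT) t
  rw [coefMono] at this
  rw [this]
  cases t with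
  | var x => simp [pair, countPair]
  | op w' s t =>
    rw [pair, countPair]
    split
    · simp [coefMono, coef_mono]
    · simp

/-- The coefficient of a product of two factors in the linearization. -/
def countAll (u w : Op) (S T : Mono (Fin 6)) : ℤ :=
  ∑ s : Equiv.Perm (Fin 4), (Equiv.Perm.sign s : ℤ) *
    ((polarMonos u w).map fun p => p.1 * countPair w S T (p.2.rename (shift s))).sum

theorem coef_linearize_newLL6 (u w : Op) {S T : Mono (Fin 6)} (hS : S.rooted w = false)
    (hT : T.rooted w = false) :
    coef (op w S T) (linearize (newLL6 F u w)) = (countAll u w S T : F) := by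
  rw [linearize_newLL6, map_sum, countAll, Int.cast_sum]
  refine Finset.sum_congr rfl fun s _ => ?_
  rw [map_smul, smul_eq_mul, Int.cast_mul]
  congr 1
  generalize polarMonos u w = L
  induction L with
  | nil => simp
  | cons p L ih =>
    rw [toPoly_cons, map_add, map_add, ih, map_smul, map_smul, rename_mono,
      coef_op_mono hS hT, List.map_cons, List.sum_cons, Int.cast_add, Int.cast_mul, smul_eq_mul]

end Interchange
end

noncomputable section

namespace Interchange

variable {F : Type*} [Field F]

open Mono Equiv

/-! ### Functions on permutations of six letters -/

/-- A function on permutations of six letters that is invariant under permutations of the places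
`0, 1, 2, 4` and satisfies the relations of an alternating cocycle in the places `3, 5` is a
coboundary. -/
theorem exists_potential {φ : Perm (Fin 6) → F}
    (hswap : ∀ i j : Fin 6, i ≠ 3 → i ≠ 5 → j ≠ 3 → j ≠ 5 → ∀ π, φ (π * swap i j) = φ π)
    (hneg : ∀ π, φ (π * swap 3 5) = -φ π)
    (hadd : ∀ π, φ π - φ (π * swap 3 4) + φ (π * (swap 3 4 * swap 4 5)) = 0) :
    ∃ h : Fin 6 → F, ∀ π, φ π = h (π 5) - h (π 3) := by
  have hfix (σ : Perm (Fin 6)) (h3 : σ 3 = 3) (h5 : σ 5 = 5) (π : Perm (Fin 6)) :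
      φ (π * σ) = φ π := by
    have hσ : ∀ x, (σ x ≠ 3 ∧ σ x ≠ 5) ↔ (x ≠ 3 ∧ x ≠ 5) := by
      intro x
      rw [ne_eq, ne_eq, ne_eq, ne_eq, ← σ.injective.eq_iff (a := x) (b := 3), h3,
        ← σ.injective.eq_iff (a := x) (b := 5), h5]
    have key (τ : Perm {x : Fin 6 // x ≠ 3 ∧ x ≠ 5}) : ∀ π, φ (π * Perm.ofSubtype τ) = φ π := by
      induction τ using Perm.swap_induction_on with
      | one => simp
      | swap_mul τ x y hxy ih =>
        intro π
        rw [map_mul, Perm.ofSubtype_swap_eq, ← mul_assoc, ih,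
          hswap x y x.2.1 x.2.2 y.2.1 y.2.2]
    have := key (σ.subtypePerm hσ) π
    rwa [Perm.ofSubtype_subtypePerm] at this
    intro x hx
    constructor
    · rintro rfl; exact hx h3
    · rintro rfl; exact hx h5
  -- Permutations fixing the places `3` and `5` are products of the transpositions in `hswap`, so
  -- `φ` is a function of the two letters at these places.
  have hwd (π π' : Perm (Fin 6)) (h3 : π 3 = π' 3) (h5 : π 5 = π' 5) : φ π = φ π' := by
    rw [← hfix (π⁻¹ * π') (by simp [← h3]) (by simp [← h5]) π, mul_inv_cancel_left]
  -- The potential is normalized by `h 0 = 0`; at other letters it is the value of `φ` with `0` at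
  -- place `3` and `x` at place `5`.
  refine ⟨fun x => if x = 0 then 0 else φ (swap 5 x * swap 3 0), fun π => ?_⟩
  have hq (x : Fin 6) (hx : x ≠ 0) (π : Perm (Fin 6)) (h3 : π 3 = 0) (h5 : π 5 = x) :
      φ (swap 5 x * swap 3 0) = φ π := by
    refine hwd _ _ ?_ ?_
    · rw [h3, Perm.mul_apply, swap_apply_left, swap_apply_of_ne_of_ne (by decide) hx.symm]
    · rw [h5, Perm.mul_apply, show swap 3 0 (5 : Fin 6) = 5 by decide, swap_apply_left]
  have h35 : π 3 ≠ π 5 := π.injective.ne (by decide)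
  by_cases hx : π 3 = 0
  · have hy : π 5 ≠ 0 := hx ▸ h35.symm
    simp only [hx, hy, if_true, if_false, sub_zero]
    exact (hq _ hy π hx rfl).symm
  · by_cases hy : π 5 = 0
    · simp only [hx, hy, if_true, if_false, zero_sub]
      rw [hq _ hx (π * swap 3 5) (by simpa using hy) (by simp), hneg, neg_neg]
    · simp only [hx, hy, if_false]
      -- The letter `0` can be moved from its place `k` to place `4` without changing `φ`. The
      -- three-term relation for the letters at `3, 4, 5` then expresses `φ` by the values with `0`
      -- at place `3`.
      set k := π.symm 0 with hk
      have k3 : k ≠ 3 := fun h => hx (by rw [← h, hk, apply_symm_apply])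
      have k5 : k ≠ 5 := fun h => hy (by rw [← h, hk, apply_symm_apply])
      set ρ := π * swap 4 k with hρ
      have e3 : ρ 3 = π 3 := by
        rw [hρ, Perm.mul_apply, swap_apply_of_ne_of_ne (by decide) k3.symm]
      have e5 : ρ 5 = π 5 := by
        rw [hρ, Perm.mul_apply, swap_apply_of_ne_of_ne (by decide) k5.symm]
      have e4 : ρ 4 = 0 := by rw [hρ, Perm.mul_apply, swap_apply_left, hk, apply_symm_apply]
      rw [hwd π ρ e3.symm e5.symm,
        hq _ hy (ρ * swap 3 4) (by simpa using e4) e5,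
        hq _ hx (ρ * (swap 3 4 * swap 4 5)) e4 e3]
      linear_combination hadd ρ

/-- The coefficients at `(a ∘ (b • c)) • (d ∘ e ∘ f)`, as a function of the permutation of the
indeterminates. -/
def coefB (u : Op) (f : FreeAlg F (Fin 6)) (π : Perm (Fin 6)) : F :=
  coef (treeB u (π 0) (π 1) (π 2) (π 3) (π 4) (π 5)) f

/-- The B coefficients are antisymmetric in the places `0, 1, 2, 4`. Multiplication by the sign
turns this into invariance, the reversal of the last three letters into antisymmetry in `3, 5`, and
the shuffle relation into the cocycle relation. -/
theorem exists_potential_coefB [CharZero F] (u : Op) {f : FreeAlg F (Fin 6)}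
    (hf : f ∈ allIds F 6) : ∃ h : Fin 6 → F, ∀ π,
      ((Perm.sign π : ℤ) : F) * coefB u f π = h (π 5) - h (π 3) := by
  set B : Fin 6 → Fin 6 → Fin 6 → Fin 6 → Fin 6 → Fin 6 → F :=
    fun a b c d e g => coef (treeB u a b c d e g) f with hB
  have h01 (a b c d e g) : B b a c d e g = -B a b c d e g := treeB_swap_first u hf a b c d e g
  have h12 (a b c d e g) : B a c b d e g = -B a b c d e g := treeB_swap_left u f a b c d e g
  have h24 (a b c d e g) : B a b e d c g = -B a b c d e g := treeB_swap_mid u hf a b c d e g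
  have h02 (a b c d e g) : B c b a d e g = -B a b c d e g := by rw [h01, h12, h01, neg_neg]
  have h14 (a b c d e g) : B a e c d b g = -B a b c d e g := by rw [h12, h24, h12, neg_neg]
  have h04 (a b c d e g) : B e b c d a g = -B a b c d e g := by rw [h01, h14, h01, neg_neg]
  have key (i j : Fin 6) (π : Perm (Fin 6)) (hij : i ≠ j)
      (h : coefB u f (π * swap i j) = -coefB u f π) :
      ((Perm.sign (π * swap i j) : ℤ) : F) * coefB u f (π * swap i j) =
        ((Perm.sign π : ℤ) : F) * coefB u f π := by
    rw [h, Perm.sign_mul, Perm.sign_swap hij]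
    simp
  refine exists_potential ?_ ?_ ?_
  · intro i j hi3 hi5 hj3 hj5 π
    by_cases hij : i = j
    · rw [hij, swap_self, ← Perm.one_def, mul_one]
    refine key i j π hij ?_
    fin_cases i <;> fin_cases j <;> first
      | exact absurd rfl hi3
      | exact absurd rfl hi5
      | exact absurd rfl hj3
      | exact absurd rfl hj5
      | exact absurd rfl hij
      | exact h01 _ _ _ _ _ _
      | exact h02 _ _ _ _ _ _
      | exact h04 _ _ _ _ _ _
      | exact h12 _ _ _ _ _ _
      | exact h14 _ _ _ _ _ _
      | exact h24 _ _ _ _ _ _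
  · intro π
    have h : coefB u f (π * swap 3 5) = coefB u f π := treeB_reverse u f _ _ _ _ _ _
    rw [h, Perm.sign_mul, Perm.sign_swap (by decide)]
    simp
  · intro π
    have h : coefB u f π + coefB u f (π * swap 3 4) + coefB u f (π * (swap 3 4 * swap 4 5)) = 0 :=
      treeB_shuffle u f _ _ _ _ _ _
    rw [Perm.sign_mul, Perm.sign_mul, Perm.sign_mul, Perm.sign_swap (by decide),
      Perm.sign_swap (by decide)]
    push_cast
    linear_combination ((Perm.sign π : ℤ) : F) * h

end Interchange
end

noncomputable section

namespace Interchange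

variable {F : Type*} [Field F]

open Mono Equiv

/-! ### The coefficients of the new identity -/

theorem shift_mul (s t : Perm (Fin 4)) : shift (s * t) = shift s * shift t := by
  ext x
  simp only [shift, permCongr_apply, Perm.mul_apply, symm_apply_apply]
  rcases (finSumFinEquiv (m := 2) (n := 4)).symm x with x | x <;> rfl

theorem swap_mul_shift (s : Perm (Fin 4)) : swap 0 1 * shift s = shift s * swap 0 1 := by
  revert s
  decide +kernel

theorem rename_mul {n : ℕ} (s t : Perm (Fin n)) (f : FreeAlg F (Fin n)) :
    rename s (rename t f) = rename (s * t : Perm (Fin n)) f :=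
  (LinearMap.congr_fun ((permRep F n).map_mul s t) f).symm

theorem rename_shift_linearize (u w : Op) (t : Perm (Fin 4)) :
    rename (shift t) (linearize (newLL6 F u w)) =
      ((Perm.sign t : ℤ) : F) • linearize (newLL6 F u w) := by
  simp only [linearize_newLL6, map_sum, map_smul, Finset.smul_sum, rename_mul, ← shift_mul,
    smul_smul]
  refine Fintype.sum_equiv (Equiv.mulLeft t) _ _ fun s => ?_
  rw [Equiv.coe_mulLeft, Perm.sign_mul]
  rcases Int.units_eq_one_or (Perm.sign t) with h | h <;> simp [h]

theorem rename_swap_linearize (u w : Op) :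
    rename (swap 0 1 : Perm (Fin 6)) (linearize (newLL6 F u w)) = linearize (newLL6 F u w) := by
  have h : rename (swap 0 1 : Perm (Fin 6)) (toPoly (polarMonos u w) : FreeAlg F (Fin 6)) =
      rename (1 : Perm (Fin 6)) (toPoly (polarMonos u w)) := by
    rw [← newTerm_polar, ← newTerm_polar, sub_right_comm, add_comm (X (swap 0 1 0))]
    rfl
  simp only [linearize_newLL6, map_sum, map_smul, rename_mul, swap_mul_shift]
  refine Finset.sum_congr rfl fun s _ => ?_
  rw [← rename_mul, h, rename_mul, mul_one]

theorem coefB_rename (u : Op) (s : Perm (Fin 6)) (f : FreeAlg F (Fin 6)) (π : Perm (Fin 6)) :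
    coefB u (rename s f) π = coefB u f (s⁻¹ * π) :=
  (coef_rename_perm s⁻¹ _ f).symm

/-- All terms of the new identity have outermost operation `u.swap`, whereas the trees of type B for
`u.swap` have outermost operation `u`. -/
theorem coefB_linearize_of_ne (u : Op) (π : Perm (Fin 6)) :
    coefB u.swap (linearize (newLL6 F u u.swap)) π = 0 := by
  rw [linearize_newLL6, coefB, map_sum]
  refine Finset.sum_eq_zero fun s _ => ?_
  have h : toPoly (polarMonos u u.swap) ∈ LinearMap.ker (coef
      (treeB u.swap (π 0) (π 1) (π 2) (π 3) (π 4) (π 5)) ∘ₗ rename (F := F) (shift s)) := by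
    have hroot : ∀ p ∈ polarMonos u u.swap, p.2.rooted u.swap = true := by
      cases u <;> decide +kernel
    refine toPoly_mem fun p hp => ?_
    have := hroot p hp
    generalize p.2 = t at this
    cases t with
    | var x => simp at this
    | op w a b =>
      rw [rooted_op, decide_eq_true_eq] at this
      rw [LinearMap.mem_ker, LinearMap.comp_apply, rename_mono, Mono.rename, this, ← freeMul_mono]
      exact coef_freeMul_of_not_rooted (by cases u <;> rfl) _ _
  rw [map_smul]
  exact (congrArg _ (LinearMap.mem_ker.mp h)).trans (smul_zero _)

/-- A single coefficient fixes the scale of the potential of the new identity; its shape follows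
from symmetry. -/
theorem countAll_eq (u : Op) : countAll u u.swap (op u (var 3) (op u.swap (var 5) (var 2)))
    (op u (var 0) (op u (var 4) (var 1))) = 4 := by
  cases u <;> decide +kernel

variable (F) in
/-- The difference of the first two unit vectors. -/
def rootVector : Fin 6 → F := Pi.single 1 1 - Pi.single 0 1

/-- The identity is alternating in the letters `2, 3, 4, 5`, so the potential is constant there; it
is symmetric in `0, 1`, so their values lie opposite with respect to that constant. The coefficient
`4` of `countAll_eq` is the difference of the values at `1` and `0`. -/
theorem coefB_linearize [CharZero F] (u : Op) (π : Perm (Fin 6)) :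
    ((Perm.sign π : ℤ) : F) * coefB u (linearize (newLL6 F u u.swap)) π =
      2 * (rootVector F (π 5) - rootVector F (π 3)) := by
  obtain ⟨h, hh⟩ := exists_potential_coefB (F := F) u (linearize_newLL6_mem_allIds u)
  set g := linearize (newLL6 F u u.swap) with hg
  have hsym (s : Perm (Fin 6)) (c : F) (hs : rename s g = c • g) (π : Perm (Fin 6)) :
      c * (h (π 5) - h (π 3)) =
        ((Perm.sign s : ℤ) : F) * (h (s⁻¹ (π 5)) - h (s⁻¹ (π 3))) := by
    have h1 := coefB_rename u s g π
    rw [hs, coefB, map_smul, smul_eq_mul, ← coefB] at h1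
    have h2 := hh (s⁻¹ * π)
    rw [← h1, Perm.sign_mul, Perm.sign_inv, Perm.mul_apply, Perm.mul_apply] at h2
    rw [← h2, ← hh π]
    rcases Int.units_eq_one_or (Perm.sign s) with e | e <;> rw [e] <;> push_cast <;> ring
  have heq (i j : Fin 6) (t : Perm (Fin 4)) (ht : shift t = swap i j) (hij : i ≠ j)
      (π : Perm (Fin 6)) (hi : π 5 = i) (hj : π 3 = j) : h i = h j := by
    have ht' : Perm.sign t = -1 := by
      rw [← Perm.sign_swap hij, ← ht, shift, Perm.sign_permCongr]
      simp
    have := hsym (shift t) _ (rename_shift_linearize u u.swap t) π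
    rw [ht, Perm.sign_swap hij, hi, hj, swap_inv, swap_apply_left, swap_apply_right, ht'] at this
    push_cast at this
    linear_combination -1/2 * this
  have h23 : h 2 = h 3 := heq 2 3 (swap 0 1) (by decide) (by decide) (swap 5 2) rfl rfl
  have h24 : h 2 = h 4 := heq 2 4 (swap 0 2) (by decide) (by decide) (swap 5 2 * swap 3 4) rfl rfl
  have h25 : h 5 = h 2 := heq 5 2 (swap 3 0) (by decide) (by decide) (swap 3 2) rfl rfl
  have h01 : h 0 - h 2 = -(h 1 - h 2) := by
    have := hsym (swap 0 1) 1 (by rw [one_smul]; exact rename_swap_linearize u u.swap)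
      (swap 5 0 * swap 3 2)
    rw [Perm.sign_swap (by decide), one_mul] at this
    rw [Units.val_neg, Units.val_one, Int.cast_neg, Int.cast_one, neg_one_mul] at this
    exact this
  have hval : h 1 - h 0 = 4 := by
    have h1 := hh (swap 3 0 * swap 5 1)
    have h2 : coefB u g (swap 3 0 * swap 5 1) = ((4 : ℤ) : F) := by
      rw [← countAll_eq u, hg]
      exact coef_linearize_newLL6 u u.swap (by simp [Op.ne_swap]) (by simp [Op.ne_swap])
    rw [h2, Perm.sign_mul, Perm.sign_swap (by decide), Perm.sign_swap (by decide)] at h1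
    push_cast at h1
    rw [one_mul] at h1
    exact h1.symm
  have hx (x : Fin 6) : h x = h 2 + 2 * rootVector F x := by
    have h0 : h 0 = h 2 - 2 := by linear_combination 1/2 * h01 - 1/2 * hval
    have h1 : h 1 = h 2 + 2 := by linear_combination 1/2 * h01 + 1/2 * hval
    fin_cases x <;> simp [rootVector, h0, h1, ← h23, ← h24, h25, sub_eq_add_neg]
  rw [hh, hx (π 5), hx (π 3)]
  ring

end Interchange
end

noncomputable section

namespace Interchange

variable {F : Type*} [Field F]

open Equiv

/-! ### The representation for the partition `21⁴` -/

variable (F) in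
/-- The permutation representation of the symmetric group on six letters, tensored with the sign
representation. -/
def signedRep : Representation F (Perm (Fin 6)) (Fin 6 → F) where
  toFun s := ((Perm.sign s : ℤ) : F) • LinearMap.funLeft F F ⇑s⁻¹
  map_one' := by
    ext v x
    simp
  map_mul' s t := by
    ext v x
    simp [mul_assoc, mul_left_comm]

theorem signedRep_apply (s : Perm (Fin 6)) (v : Fin 6 → F) (x : Fin 6) :
    signedRep F s v x = ((Perm.sign s : ℤ) : F) * v (s⁻¹ x) := rfl

/-- The action of the group algebra on vectors. -/
abbrev actVec (r : F[Perm (Fin 6)]) (v : Fin 6 → F) : Fin 6 → F := (signedRep F).asAlgebraHom r v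

theorem sum_actVec (r : F[Perm (Fin 6)]) {v : Fin 6 → F} (hv : ∑ x, v x = 0) :
    ∑ x, actVec r v x = 0 := by
  unfold actVec
  induction r using MonoidAlgebra.induction_linear with
  | zero => simp
  | add r s hr hs =>
    simp only [map_add, LinearMap.add_apply, Pi.add_apply, Finset.sum_add_distrib]
    rw [hr, hs, add_zero]
  | single s c =>
    simp only [Representation.asAlgebraHom_single, LinearMap.smul_apply, Pi.smul_apply,
      signedRep_apply, smul_eq_mul, ← Finset.mul_sum]
    rw [Equiv.sum_comp s⁻¹ v, hv, mul_zero, mul_zero]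

theorem sum_rootVector : ∑ x, rootVector F x = 0 := by
  simp [rootVector]

/-- The transposition of `1` and `x` carries `e₁ - e₀` to `eₓ - e₀` up to sign, and these vectors
span the vectors of sum zero. -/
theorem exists_actVec_eq {v : Fin 6 → F} (hv : ∑ x, v x = 0) :
    ∃ r, actVec r (rootVector F) = v := by
  set I : Submodule F (Fin 6 → F) := LinearMap.range
    ((LinearMap.applyₗ (rootVector F)) ∘ₗ (signedRep F).asAlgebraHom.toLinearMap) with hI
  have key (x : Fin 6) : (Pi.single x 1 - Pi.single 0 1 : Fin 6 → F) ∈ I := by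
    by_cases hx : x = 0
    · rw [hx, sub_self]; exact I.zero_mem
    refine ⟨MonoidAlgebra.single (swap 1 x) ((Perm.sign (swap 1 x) : ℤ) : F), ?_⟩
    ext y
    have h1 : ((Perm.sign (swap 1 x) : ℤ) : F) * ((Perm.sign (swap 1 x) : ℤ) : F) = 1 := by
      rcases Int.units_eq_one_or (Perm.sign (swap 1 x)) with h | h <;> simp [h]
    simp only [LinearMap.comp_apply, AlgHom.toLinearMap_apply, LinearMap.applyₗ_apply_apply,
      Representation.asAlgebraHom_single, LinearMap.smul_apply, Pi.smul_apply, signedRep_apply,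
      smul_eq_mul, ← mul_assoc, h1, one_mul, swap_inv, rootVector, Pi.sub_apply, Pi.single_apply]
    have e1 : swap 1 x y = 1 ↔ y = x := by rw [swap_apply_eq_iff, swap_apply_left]
    have e0 : swap 1 x y = 0 ↔ y = 0 := by
      rw [swap_apply_eq_iff, swap_apply_of_ne_of_ne (by decide) (Ne.symm hx)]
    simp only [e1, e0]
  have hsum : v = ∑ x, v x • (Pi.single x 1 - Pi.single 0 1 : Fin 6 → F) := by
    simp only [smul_sub, Finset.sum_sub_distrib, ← Finset.sum_smul, hv, zero_smul, sub_zero]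
    exact pi_eq_sum_univ' v
  have : v ∈ I := by
    rw [hsum]
    exact Submodule.sum_mem _ fun x _ => I.smul_mem _ (key x)
  obtain ⟨r, hr⟩ := this
  exact ⟨r, hr⟩

/-- This is the simplicity of the module of vectors of sum zero. If `v i ≠ v j`, the element `1 + (i
j)` acts, because of the sign twist, as `v ↦ (v i - v j) (eᵢ - eⱼ)`. A permutation and a scalar then
give `e₁ - e₀`. -/
theorem exists_actVec_eq_rootVector [CharZero F] {v : Fin 6 → F} (hv : ∑ x, v x = 0)
    (h0 : v ≠ 0) : ∃ r, actVec r v = rootVector F := by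
  obtain ⟨i, j, hij⟩ : ∃ i j, v i ≠ v j := by
    by_contra! h
    refine h0 (funext fun x => ?_)
    rw [Finset.sum_congr rfl fun y _ => h y x] at hv
    simpa using hv
  have hne : i ≠ j := fun h => hij (by rw [h])
  obtain ⟨τ, hi, hj⟩ : ∃ τ : Perm (Fin 6), τ i = 1 ∧ τ j = 0 := by
    refine ⟨swap 0 (swap 1 i j) * swap 1 i, ?_, ?_⟩
    · rw [Perm.mul_apply, swap_apply_right, swap_apply_of_ne_of_ne (by decide)]
      intro h
      rw [eq_comm, swap_apply_eq_iff, swap_apply_left] at h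
      exact hne h.symm
    · rw [Perm.mul_apply, swap_apply_right]
  refine ⟨MonoidAlgebra.single τ (((Perm.sign τ : ℤ) : F) * (v i - v j)⁻¹) *
    (1 + MonoidAlgebra.single (swap i j) 1), ?_⟩
  have h1 : actVec (1 + MonoidAlgebra.single (swap i j) 1) v =
      (v i - v j) • (Pi.single i 1 - Pi.single j 1 : Fin 6 → F) := by
    ext x
    simp only [actVec, map_add, map_one, LinearMap.add_apply, Module.End.one_apply, Pi.add_apply,
      Representation.asAlgebraHom_single_one, signedRep_apply, Perm.sign_swap hne, swap_inv,
      Pi.smul_apply, Pi.sub_apply, Pi.single_apply, smul_eq_mul]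
    by_cases hxi : x = i
    · subst hxi; simp [hne]; ring
    · by_cases hxj : x = j
      · subst hxj; simp [hne.symm]; ring
      · simp [swap_apply_of_ne_of_ne hxi hxj, hxi, hxj]
  rw [actVec, map_mul, Module.End.mul_apply]
  change actVec _ (actVec _ v) = _
  rw [h1]
  ext x
  have h2 : ((Perm.sign τ : ℤ) : F) * ((Perm.sign τ : ℤ) : F) = 1 := by
    rcases Int.units_eq_one_or (Perm.sign τ) with h | h <;> simp [h]
  have h3 : (v i - v j)⁻¹ * (v i - v j) = 1 := inv_mul_cancel₀ (sub_ne_zero.mpr hij)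
  have e1 : τ⁻¹ x = i ↔ x = 1 := by rw [Perm.inv_eq_iff_eq, hi]
  have e0 : τ⁻¹ x = j ↔ x = 0 := by rw [Perm.inv_eq_iff_eq, hj]
  simp only [actVec, Representation.asAlgebraHom_single, LinearMap.smul_apply, Pi.smul_apply,
    map_smul, signedRep_apply, smul_eq_mul, rootVector, Pi.sub_apply, Pi.single_apply, e1, e0]
  linear_combination (((if x = 1 then 1 else 0) - if x = 0 then 1 else 0 : F)) *
    ((v i - v j)⁻¹ * (v i - v j) * h2 + h3)

/-! ### Cyclic modules whose generator has the annihilator of the root vector -/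

section Cyclic

variable {M N : Type*} [AddCommGroup M] [Module F[Perm (Fin 6)] M] [AddCommGroup N]
  [Module F[Perm (Fin 6)] N]

/-- A cyclic module whose generator has the annihilator of the root vector is simple. -/
theorem isSimpleModule_span [CharZero F] {x : M}
    (hx : ∀ r : F[Perm (Fin 6)], r • x = 0 ↔ actVec r (rootVector F) = 0) :
    IsSimpleModule F[Perm (Fin 6)] (Submodule.span F[Perm (Fin 6)] {x}) := by
  rw [isSimpleModule_iff_toSpanSingleton_surjective]
  have hx0 : x ≠ 0 := by
    intro h
    have := (hx 1).mp (by rw [h, smul_zero])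
    have h1 := congrFun this 1
    simp [actVec, rootVector] at h1
  refine ⟨⟨⟨⟨x, Submodule.mem_span_singleton_self x⟩, 0, fun h => hx0 (congrArg Subtype.val h)⟩⟩,
    ?_⟩
  rintro ⟨y, hy⟩ hne ⟨z, hz⟩
  obtain ⟨r, rfl⟩ := Submodule.mem_span_singleton.mp hy
  obtain ⟨t, rfl⟩ := Submodule.mem_span_singleton.mp hz
  have hr : actVec r (rootVector F) ≠ 0 := fun h => hne (Subtype.ext ((hx r).mpr h))
  obtain ⟨s, hs⟩ := exists_actVec_eq_rootVector (sum_actVec r sum_rootVector) hr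
  refine ⟨t * s, Subtype.ext ?_⟩
  -- The choice of `s` makes `s * r - 1` annihilate the root vector, hence also `x`.
  have : (s * r - 1) • x = 0 := by
    rw [hx, actVec, map_sub, map_mul, map_one, LinearMap.sub_apply, Module.End.mul_apply,
      Module.End.one_apply, sub_eq_zero]
    exact hs
  rw [sub_smul, one_smul, sub_eq_zero] at this
  change (t * s) • r • x = t • x
  rw [mul_smul, smul_smul s r x, this]

/-- Both modules are the quotient of the group algebra by the same annihilator. -/
theorem nonempty_equiv_span {x : M} {y : N}
    (hx : ∀ r : F[Perm (Fin 6)], r • x = 0 ↔ actVec r (rootVector F) = 0)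
    (hy : ∀ r : F[Perm (Fin 6)], r • y = 0 ↔ actVec r (rootVector F) = 0) :
    Nonempty (Submodule.span F[Perm (Fin 6)] {x} ≃ₗ[F[Perm (Fin 6)]]
      Submodule.span F[Perm (Fin 6)] {y}) := by
  have h : LinearMap.ker (LinearMap.toSpanSingleton F[Perm (Fin 6)] M x) =
      LinearMap.ker (LinearMap.toSpanSingleton F[Perm (Fin 6)] N y) := by
    ext r
    simp [hx, hy]
  exact ⟨(LinearEquiv.ofEq _ _ (LinearMap.range_toSpanSingleton x)).symm ≪≫ₗ
    (LinearMap.quotKerEquivRange _).symm ≪≫ₗ Submodule.quotEquivOfEq _ _ h ≪≫ₗ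
    LinearMap.quotKerEquivRange _ ≪≫ₗ LinearEquiv.ofEq _ _ (LinearMap.range_toSpanSingleton y)⟩

end Cyclic

variable (F) in
/-- The Young symmetrizer that generates the module `[21⁴]`. -/
abbrev youngElement : F[Perm (Fin 6)] :=
  youngSymmetrizer F ![0, 0, 1, 2, 3, 4] ![0, 1, 0, 0, 0, 0]

/-- The column group is the stabilizer of `1` and the row group is generated by the transposition of
`0` and `1`. So `π` occurs once if `π 1` is `1` or `0`, with opposite signs relative to the sign of
`π`, and not otherwise. -/
theorem coeff_youngElement (π : Perm (Fin 6)) :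
    (youngElement F).coeff π = ((Perm.sign π : ℤ) : F) * rootVector F (π 1) := by
  classical
  have hcol (g : Perm (Fin 6)) : (∀ i, ![0, 1, 0, 0, 0, 0] (g i) = (![0, 1, 0, 0, 0, 0] i : ℕ)) ↔
      g 1 = 1 := by
    revert g
    decide +kernel
  have hrow (g : Perm (Fin 6)) : (∀ i, ![0, 0, 1, 2, 3, 4] (g i) = (![0, 0, 1, 2, 3, 4] i : ℕ)) ↔
      g = 1 ∨ g = swap 0 1 := by
    revert g
    decide +kernel
  have hC (π : Perm (Fin 6)) : (∑ g : Perm (Fin 6) with g 1 = 1,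
      ((Perm.sign g : ℤ) : F) • MonoidAlgebra.of F _ g).coeff π =
        if π 1 = 1 then ((Perm.sign π : ℤ) : F) else 0 := by
    rw [MonoidAlgebra.coeff_sum, Finsupp.finsetSum_apply, Finset.sum_filter]
    rw [Finset.sum_eq_single π]
    · simp
    · intro g _ hg
      split
      · simp [hg]
      · rfl
    · simp
  have hR : (Finset.univ.filter fun g : Perm (Fin 6) => g = 1 ∨ g = swap 0 1) =
      {1, swap 0 1} := by ext g; simp
  simp only [youngElement, youngSymmetrizer, hrow, hcol]
  rw [hR, Finset.sum_pair (by decide), add_mul, MonoidAlgebra.coeff_add, Finsupp.add_apply,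
    MonoidAlgebra.of_apply, MonoidAlgebra.of_apply, MonoidAlgebra.coeff_single_mul_apply,
    MonoidAlgebra.coeff_single_mul_apply, hC, hC, inv_one, one_mul, one_mul, one_mul,
    Perm.mul_apply, swap_inv, Perm.sign_mul, Perm.sign_swap (by decide), rootVector, Pi.sub_apply,
      Pi.single_apply, Pi.single_apply]
  have h : swap 0 1 (π 1) = 1 ↔ π 1 = 0 := by rw [swap_apply_eq_iff, swap_apply_right]
  simp only [h]
  by_cases h1 : π 1 = 1
  · simp [h1]
  · by_cases h0 : π 1 = 0 <;> simp [h1, h0]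

/-- Left multiplication of the Young symmetrizer corresponds, in its coefficients, to the signed
action on the root vector. -/
theorem smul_youngElement_eq_zero_iff (r : F[Perm (Fin 6)]) :
    r • youngElement F = 0 ↔ actVec r (rootVector F) = 0 := by
  have h (π : Perm (Fin 6)) : (r * youngElement F).coeff π =
      ((Perm.sign π : ℤ) : F) * actVec r (rootVector F) (π 1) := by
    unfold actVec
    induction r using MonoidAlgebra.induction_linear with
    | zero => simp
    | add r s hr hs =>
      rw [add_mul, MonoidAlgebra.coeff_add, Finsupp.add_apply, hr, hs, map_add,
        LinearMap.add_apply, Pi.add_apply, mul_add]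
    | single s c =>
      rw [MonoidAlgebra.coeff_single_mul_apply, coeff_youngElement,
        Representation.asAlgebraHom_single, LinearMap.smul_apply, Pi.smul_apply, signedRep_apply,
        Perm.sign_mul, Perm.sign_inv, Perm.mul_apply, smul_eq_mul]
      push_cast
      ring
  rw [smul_eq_mul]
  constructor
  · intro h0
    funext x
    have := h (swap 1 x)
    rw [h0, swap_apply_left] at this
    rcases Int.units_eq_one_or (Perm.sign (swap 1 x)) with e | e <;> simpa [e] using this.symm
  · intro h0
    ext π
    rw [h, h0]
    simp

end Interchange
end

noncomputable section

namespace Interchange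

variable {F : Type*} [Field F]

open Equiv

/-! ### The module of new identities -/

/-- The action of the group algebra on polynomials. -/
abbrev actPoly (r : F[Perm (Fin 6)]) (f : FreeAlg F (Fin 6)) : FreeAlg F (Fin 6) :=
  (permRep F 6).asAlgebraHom r f

theorem actPoly_mem_allIds (r : F[Perm (Fin 6)]) {f : FreeAlg F (Fin 6)} (hf : f ∈ allIds F 6) :
    actPoly r f ∈ allIds F 6 :=
  (permRep F 6).asAlgebraHom_mem_of_forall_mem _ (fun g _ hv => rename_mem_allIds g hv) f hf r

theorem actPoly_mem_consequences (S : Set (FreeAlg F ℕ)) (r : F[Perm (Fin 6)])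
    {f : FreeAlg F (Fin 6)} (hf : f ∈ consequences S (Fin 6)) :
    actPoly r f ∈ consequences S (Fin 6) :=
  (permRep F 6).asAlgebraHom_mem_of_forall_mem _ (fun g _ hv => rename_mem_consequences S g hv) f
    hf r

/-- The coefficients of `f` at the monomials `(a ∘ (b • c)) • (d ∘ e ∘ f)` are the signed
differences of the values of `h`. -/
def HasPotential (u : Op) (f : FreeAlg F (Fin 6)) (h : Fin 6 → F) : Prop :=
  ∀ π : Perm (Fin 6), ((Perm.sign π : ℤ) : F) * coefB u f π = h (π 5) - h (π 3)

theorem HasPotential.add {u : Op} {f g : FreeAlg F (Fin 6)} {h k : Fin 6 → F}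
    (hf : HasPotential u f h) (hg : HasPotential u g k) : HasPotential u (f + g) (h + k) := by
  intro π
  have h1 := hf π
  have h2 := hg π
  rw [coefB] at h1 h2 ⊢
  rw [map_add, mul_add, h1, h2, Pi.add_apply, Pi.add_apply]
  ring

theorem HasPotential.smul {u : Op} {f : FreeAlg F (Fin 6)} {h : Fin 6 → F} (c : F)
    (hf : HasPotential u f h) : HasPotential u (c • f) (c • h) := by
  intro π
  have h1 := hf π
  rw [coefB] at h1 ⊢
  rw [map_smul, smul_eq_mul, Pi.smul_apply, Pi.smul_apply, smul_eq_mul, smul_eq_mul]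
  linear_combination c * h1

theorem HasPotential.actPoly {u : Op} {f : FreeAlg F (Fin 6)} {h : Fin 6 → F}
    (hf : HasPotential u f h) (r : F[Perm (Fin 6)]) :
    HasPotential u (actPoly r f) (actVec r h) := by
  unfold Interchange.actPoly actVec
  induction r using MonoidAlgebra.induction_linear with
  | zero => intro π; simp [coefB]
  | add r s hr hs => simpa only [map_add, LinearMap.add_apply] using hr.add hs
  | single s c =>
    simp only [Representation.asAlgebraHom_single, LinearMap.smul_apply]
    refine HasPotential.smul c fun π => ?_
    have h1 := hf (s⁻¹ * π)
    have h2 : coefB u (permRep F 6 s f) π = coefB u f (s⁻¹ * π) := coefB_rename u s f π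
    rw [Perm.sign_mul, Perm.sign_inv, Perm.mul_apply, Perm.mul_apply] at h1
    rw [signedRep_apply, signedRep_apply, ← mul_sub, ← h1, h2]
    rcases Int.units_eq_one_or (Perm.sign s) with e | e <;> rw [e] <;> push_cast <;> ring

variable (F) in
/-- The linearization of the new identity. -/
abbrev newId (u : Op) : FreeAlg F (Fin 6) := linearize (newLL6 F u u.swap)

theorem hasPotential_newId [CharZero F] (u : Op) :
    HasPotential u (newId F u) ((2 : F) • rootVector F) := by
  intro π
  rw [coefB_linearize, Pi.smul_apply, Pi.smul_apply, smul_eq_mul, smul_eq_mul, mul_sub]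

theorem hasPotential_newId_swap (u : Op) : HasPotential u.swap (newId F u) 0 := by
  intro π
  simp [coefB_linearize_of_ne]

theorem eq_const_of_forall_perm {A : Type*} {h : Fin 6 → A}
    (hh : ∀ π : Perm (Fin 6), h (π 5) = h (π 3)) (x y : Fin 6) : h x = h y := by
  by_cases hxy : x = y
  · rw [hxy]
  -- This permutation sends `5` to `x` and `3` to `y`.
  have := hh (swap (swap 5 x 3) y * swap 5 x)
  rw [Perm.mul_apply, Perm.mul_apply, swap_apply_left, swap_apply_left] at this
  rw [← this, swap_apply_of_ne_of_ne _ hxy]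
  intro h
  rw [eq_comm, swap_apply_eq_iff, swap_apply_right] at h
  exact absurd h (by decide)

/-- An identity of degree `6` is old if and only if its potentials are constant. -/
theorem mem_oldIds_iff_potential [CharZero F] {f : FreeAlg F (Fin 6)} (hf : f ∈ allIds F 6)
    {h : Op → Fin 6 → F} (hh : ∀ u, HasPotential u f (h u)) :
    f ∈ oldIds F 6 ↔ ∀ u x y, h u x = h u y := by
  rw [mem_oldIds_iff]
  constructor
  · rintro ⟨-, h0⟩ u
    refine eq_const_of_forall_perm fun π => ?_
    have := hh u π
    rw [coefB, (expand_eq_zero_iff f).mp h0, mul_zero] at this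
    exact (sub_eq_zero.mp this.symm)
  · intro hc
    refine ⟨hf.1, expand_eq_zero_of_treeB hf fun u a b c d e g => ?_⟩
    by_cases hb : Function.Bijective ![a, b, c, d, e, g]
    · have := hh u (Equiv.ofBijective _ hb)
      rw [hc u _ ((Equiv.ofBijective _ hb) 3), sub_self] at this
      rcases Int.units_eq_one_or (Perm.sign (Equiv.ofBijective _ hb)) with e | e
      · rw [e, Units.val_one, Int.cast_one, one_mul] at this
        exact this
      · rw [e, Units.val_neg, Units.val_one, Int.cast_neg, Int.cast_one, neg_one_mul,
          neg_eq_zero] at this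
        exact this
    · exact coef_rename_of_not_bijective hb (treeB u 0 1 2 3 4 5) hf.1

theorem actVec_smul (r : F[Perm (Fin 6)]) (c : F) (v : Fin 6 → F) :
    actVec r (c • v) = c • actVec r v := map_smul _ _ _

theorem eq_zero_of_const [CharZero F] {v : Fin 6 → F} (hv : ∑ x, v x = 0)
    (hc : ∀ x y, v x = v y) : v = 0 := by
  funext x
  rw [Finset.sum_congr rfl fun y _ => hc y x] at hv
  simpa using hv

/-- The potentials transform by the signed representation. A constant vector in the orbit of the
root vector has sum zero and is therefore zero. -/
theorem actPoly_newId_mem_oldIds_iff [CharZero F] (u : Op) (r : F[Perm (Fin 6)]) :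
    actPoly r (newId F u) ∈ oldIds F 6 ↔ actVec r (rootVector F) = 0 := by
  have h1 := (hasPotential_newId (F := F) u).actPoly r
  have h2 := (hasPotential_newId_swap (F := F) u).actPoly r
  rw [mem_oldIds_iff_potential (h := fun w => if w = u then actVec r ((2 : F) • rootVector F) else
    actVec r 0) (actPoly_mem_allIds r (linearize_newLL6_mem_allIds u))]
  · constructor
    · intro h
      have h0 := h u
      simp only [if_true, actVec_smul] at h0
      refine eq_zero_of_const (sum_actVec r sum_rootVector) fun x y => ?_
      exact mul_left_cancel₀ two_ne_zero (h0 x y)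
    · intro h w x y
      by_cases hw : w = u
      · simp [hw, h]
      · simp [hw]
  · intro w
    by_cases hw : w = u
    · subst hw; simpa using h1
    · have : w = u.swap := by cases w <;> cases u <;> first | rfl | exact absurd rfl hw
      rw [if_neg hw, this]
      exact h2

/-- Modulo old identities, the identities of degree `6` are generated by the two new ones. -/
theorem exists_sub_mem_oldIds [CharZero F] {f : FreeAlg F (Fin 6)} (hf : f ∈ allIds F 6) :
    ∃ r s : F[Perm (Fin 6)],
      f - actPoly r (newId F .circ) - actPoly s (newId F .bullet) ∈ oldIds F 6 := by
  have key (u : Op) : ∃ (r : F[Perm (Fin 6)]) (c : F), HasPotential u f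
      (actVec r ((2 : F) • rootVector F) + fun _ => c) := by
    obtain ⟨h, hh⟩ := exists_potential_coefB u hf
    -- Subtracting the mean makes the sum zero without changing differences. The factor `2⁻¹` below
    -- compensates the factor `2` in the potential of the new identity.
    set c : F := (∑ x, h x) / 6 with hc
    obtain ⟨r, hr⟩ := exists_actVec_eq (F := F) (v := fun x => 2⁻¹ * (h x - c)) (by
      rw [← Finset.mul_sum, Finset.sum_sub_distrib, Finset.sum_const, hc]
      simp only [Finset.card_univ, Fintype.card_fin, nsmul_eq_mul, Nat.cast_ofNat]
      field_simp
      ring)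
    refine ⟨r, c, fun π => ?_⟩
    rw [hh, actVec_smul, hr]
    simp
  obtain ⟨r, c, hr⟩ := key .circ
  obtain ⟨s, d, hs⟩ := key .bullet
  have hr1 := (hasPotential_newId (F := F) .circ).actPoly r
  have hr2 := (hasPotential_newId_swap (F := F) .circ).actPoly r
  have hs1 := (hasPotential_newId (F := F) .bullet).actPoly s
  have hs2 := (hasPotential_newId_swap (F := F) .bullet).actPoly s
  refine ⟨r, s, ?_⟩
  have hmem : f - actPoly r (newId F .circ) - actPoly s (newId F .bullet) ∈ allIds F 6 :=
    sub_mem (sub_mem hf (actPoly_mem_allIds r (linearize_newLL6_mem_allIds .circ)))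
      (actPoly_mem_allIds s (linearize_newLL6_mem_allIds .bullet))
  refine (mem_oldIds_iff_potential (h := fun u _ => match u with
    | .circ => c
    | .bullet => d) hmem ?_).mpr fun _ _ _ => rfl
  rintro (_ | _)
  · have := (hr.add (hr1.smul (-1))).add (hs2.smul (-1))
    simpa [sub_eq_add_neg] using this
  · have := (hs.add (hr2.smul (-1))).add (hs1.smul (-1))
    simpa [sub_eq_add_neg] using this

theorem smul_newClass (r : F[Perm (Fin 6)]) {f : FreeAlg F (Fin 6)} (hf : f ∈ allIds F 6) :
    r • newClass f hf = newClass (actPoly r f) (actPoly_mem_allIds r hf) := by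
  -- The membership proof is quantified so that the polynomial can be rewritten together with it in
  -- the induction.
  have h (x : F[Perm (Fin 6)]) : ∃ hx : actPoly x f ∈ allIds F 6,
      x • newClass f hf = newClass (actPoly x f) hx := by
    induction x using MonoidAlgebra.induction_linear with
    | zero =>
      have h0 : actPoly (0 : F[Perm (Fin 6)]) f = 0 := by simp [actPoly]
      simp only [h0, zero_smul]
      exact ⟨zero_mem _, rfl⟩
    | add x y hx hy =>
      obtain ⟨hx, ex⟩ := hx
      obtain ⟨hy, ey⟩ := hy
      have h0 : actPoly (x + y) f = actPoly x f + actPoly y f := by simp [actPoly]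
      simp only [h0, add_smul, ex, ey]
      exact ⟨add_mem hx hy, rfl⟩
    | single s c =>
      have h0 : actPoly (MonoidAlgebra.single s c) f = c • rename s f := by
        rw [actPoly, Representation.asAlgebraHom_single]
        rfl
      simp only [h0]
      refine ⟨Submodule.smul_mem _ c (rename_mem_allIds s hf), ?_⟩
      apply (newRep F 6).asModuleEquiv.injective
      rw [Representation.asModuleEquiv_map_smul, Representation.asAlgebraHom_single]
      rfl
  exact (h r).2

theorem newClass_eq_zero_iff {f : FreeAlg F (Fin 6)} (hf : f ∈ allIds F 6) :
    newClass f hf = 0 ↔ f ∈ oldIds F 6 := by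
  rw [newClass, LinearEquiv.map_eq_zero_iff, Submodule.Quotient.mk_eq_zero]
  rfl

theorem newClass_surjective (x : NewModule F 6) :
    ∃ (f : FreeAlg F (Fin 6)) (hf : f ∈ allIds F 6), newClass f hf = x := by
  obtain ⟨⟨f, hf⟩, h⟩ := Submodule.Quotient.mk_surjective _ ((newRep F 6).asModuleEquiv x)
  exact ⟨f, hf, by rw [newClass, h, LinearEquiv.symm_apply_apply]⟩

theorem newClass_sub {f g : FreeAlg F (Fin 6)} (hf : f ∈ allIds F 6) (hg : g ∈ allIds F 6) :
    newClass (f - g) (sub_mem hf hg) = newClass f hf - newClass g hg := rfl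

theorem smul_newClass_newId_eq_zero_iff [CharZero F] (u : Op) (r : F[Perm (Fin 6)]) :
    r • newClass (newId F u) (linearize_newLL6_mem_allIds u) = 0 ↔
      actVec r (rootVector F) = 0 := by
  rw [smul_newClass, newClass_eq_zero_iff, actPoly_newId_mem_oldIds_iff]

/-- The two identities have their potentials at different operations, so a common class has constant
potentials and is zero. That they generate everything is `exists_sub_mem_oldIds`. -/
theorem isCompl_newSpan [CharZero F] :
    IsCompl (newSpan (newId F .circ) (linearize_newLL6_mem_allIds .circ))
      (newSpan (newId F .bullet) (linearize_newLL6_mem_allIds .bullet)) := by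
  constructor
  · rw [Submodule.disjoint_def]
    intro x h1 h2
    obtain ⟨r, rfl⟩ := Submodule.mem_span_singleton.mp h1
    obtain ⟨s, hs⟩ := Submodule.mem_span_singleton.mp h2
    rw [eq_comm, ← sub_eq_zero, smul_newClass, smul_newClass, ← newClass_sub,
      newClass_eq_zero_iff] at hs
    have hr1 := (hasPotential_newId (F := F) .circ).actPoly r
    have hr2 : HasPotential .bullet _ _ := (hasPotential_newId_swap (F := F) .circ).actPoly r
    have hs1 := (hasPotential_newId (F := F) .bullet).actPoly s
    have hs2 : HasPotential .circ _ _ := (hasPotential_newId_swap (F := F) .bullet).actPoly s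
    rw [mem_oldIds_iff_potential (h := fun u => match u with
      | .circ => actVec r ((2 : F) • rootVector F)
      | .bullet => (-1 : F) • actVec s ((2 : F) • rootVector F)) (sub_mem
        (actPoly_mem_allIds r (linearize_newLL6_mem_allIds .circ))
        (actPoly_mem_allIds s (linearize_newLL6_mem_allIds .bullet)))] at hs
    · rw [smul_newClass_newId_eq_zero_iff]
      refine eq_zero_of_const (sum_actVec r sum_rootVector) fun x y => ?_
      have := hs .circ x y
      simp only [actVec_smul] at this
      exact mul_left_cancel₀ two_ne_zero this
    · rintro (_ | _)
      · simpa [sub_eq_add_neg] using hr1.add (hs2.smul (-1))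
      · simpa [sub_eq_add_neg] using hr2.add (hs1.smul (-1))
  · rw [codisjoint_iff, eq_top_iff]
    rintro x -
    obtain ⟨f, hf, rfl⟩ := newClass_surjective x
    obtain ⟨r, s, h⟩ := exists_sub_mem_oldIds hf
    have h1 := actPoly_mem_allIds r (linearize_newLL6_mem_allIds (F := F) .circ)
    have h2 := actPoly_mem_allIds s (linearize_newLL6_mem_allIds (F := F) .bullet)
    rw [← newClass_eq_zero_iff (sub_mem (sub_mem hf h1) h2), newClass_sub (sub_mem hf h1) h2,
      newClass_sub hf h1, ← smul_newClass r (linearize_newLL6_mem_allIds .circ),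
      ← smul_newClass s (linearize_newLL6_mem_allIds .bullet), sub_sub, sub_eq_zero] at h
    rw [h]
    exact Submodule.add_mem_sup (Submodule.smul_mem _ _ (Submodule.mem_span_singleton_self _))
      (Submodule.smul_mem _ _ (Submodule.mem_span_singleton_self _))

theorem linearize_mem_consequences {S : Set (FreeAlg F ℕ)} {g : FreeAlg F ℕ} (hg : g ∈ S) :
    linearize g ∈ consequences S (Fin 6) :=
  sub_mem (sub_mem (subst_mem_consequences hg _) (subst_mem_consequences hg _))
    (subst_mem_consequences hg _)

theorem mem_allIds_of_mem_consequences {S : Set (FreeAlg F ℕ)}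
    (hS : ∀ g ∈ S, g ∈ lieIds F ∨ ∃ u : Op, g = newLL6 F u u.swap) {n : ℕ}
    {f : FreeAlg F (Fin n)} (hf : f ∈ multilinear F n) (hc : f ∈ consequences S (Fin n)) :
    f ∈ allIds F n := by
  refine (mem_allIds_iff f).mpr ⟨hf, isBracketId_of_eval (consequences_le_ker (fun g hg v => ?_) _
    hc)⟩
  rcases hS g hg with hg | ⟨u, rfl⟩
  · exact (isLie_brackets_of_assoc (isAI_mulAI _).assoc).eval_eq_zero hg v
  · exact eval_newLL6 (isAI_mulAI _) v u

/-- Modulo old identities, which are Lie consequences, an identity is a combination of renamed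
linearizations, and a linearization is a combination of substitution instances. -/
theorem mem_consequences_of_mem_allIds [CharZero F] {S : Set (FreeAlg F ℕ)} (hL : lieIds F ⊆ S)
    (hS : ∀ u : Op, newLL6 F u u.swap ∈ S) {f : FreeAlg F (Fin 6)} (hf : f ∈ allIds F 6) :
    f ∈ consequences S (Fin 6) := by
  obtain ⟨r, s, h⟩ := exists_sub_mem_oldIds hf
  have h1 : consequences (lieIds F) (Fin 6) ≤ consequences S (Fin 6) :=
    consequences_le fun g hg => by
      rw [← subst_X g]
      exact subst_mem_consequences (hL hg) X
  rw [mem_oldIds_iff, ← mem_consequences_lieIds_iff] at h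
  have h2 := h1 h.2
  rw [Submodule.sub_mem_iff_left _
    (actPoly_mem_consequences S s (linearize_mem_consequences (hS .bullet))),
    Submodule.sub_mem_iff_left _
    (actPoly_mem_consequences S r (linearize_mem_consequences (hS .circ)))] at h2
  exact h2

end Interchange
end

/-! ### The theorem -/

open Interchange in
theorem mainTheorem2 (F : Type*) [Field F] [CharZero F] :
    allIds F 6 = multilinear F 6 ⊓
        consequences
          {anticomm F .circ, anticomm F .bullet, jacobi F .circ, jacobi F .bullet,
            newLL6 F .circ .bullet, newLL6 F .bullet .circ} (Fin 6) ∧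
      ∃ (h₁ : linearize (newLL6 F .circ .bullet) ∈ allIds F 6)
        (h₂ : linearize (newLL6 F .bullet .circ) ∈ allIds F 6),
        IsSimpleModule F[Equiv.Perm (Fin 6)] (newSpan _ h₁) ∧
        IsSimpleModule F[Equiv.Perm (Fin 6)] (newSpan _ h₂) ∧
        Nonempty (newSpan _ h₁ ≃ₗ[F[Equiv.Perm (Fin 6)]] specht21111 F) ∧
        Nonempty (newSpan _ h₂ ≃ₗ[F[Equiv.Perm (Fin 6)]] specht21111 F) ∧
        IsCompl (newSpan _ h₁) (newSpan _ h₂) := by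
  refine ⟨?_, linearize_newLL6_mem_allIds .circ, linearize_newLL6_mem_allIds .bullet,
    isSimpleModule_span (smul_newClass_newId_eq_zero_iff .circ),
    isSimpleModule_span (smul_newClass_newId_eq_zero_iff .bullet),
    nonempty_equiv_span (smul_newClass_newId_eq_zero_iff .circ) smul_youngElement_eq_zero_iff,
    nonempty_equiv_span (smul_newClass_newId_eq_zero_iff .bullet) smul_youngElement_eq_zero_iff,
    isCompl_newSpan⟩
  apply le_antisymm
  · refine fun f hf => ⟨hf.1, mem_consequences_of_mem_allIds ?_ ?_ hf⟩
    · rintro g (rfl | rfl | rfl | rfl) <;> simp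
    · rintro (_ | _) <;> simp [Op.swap]
  · refine fun f hf => mem_allIds_of_mem_consequences ?_ hf.1 hf.2
    rintro g (rfl | rfl | rfl | rfl | rfl | rfl)
    · exact Or.inl (anticomm_mem_lieIds _)
    · exact Or.inl (anticomm_mem_lieIds _)
    · exact Or.inl (jacobi_mem_lieIds _)
    · exact Or.inl (jacobi_mem_lieIds _)
    · exact Or.inr ⟨.circ, rfl⟩
    · exact Or.inr ⟨.bullet, rfl⟩
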